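/- Let $q$ be a power of a prime $p$, let $\Phi^+$ be the set of positive roots of type $\mathrm E_6$, with simple roots $\alpha_1,\dots,\alpha_6$ (Bourbaki labelling), and let $U=\mathrm{UE}_6(q)$ be the subgroup generated by the root elements $x_\alpha(t)$, $\alpha\in\Phi^+$, $t\in\mathbb F_q$, of the Chevalley group of type $\mathrm E_6$ over $\mathbb F_q$; put $X_\alpha=\{x_\alpha(t)\mid t\in\mathbb F_q\}$. Write $c_1c_2c_3c_4c_5c_6$ for $\sum_i c_i\alpha_i$, and let $\alpha_7=101000$, $\alpha_9=001100$, $\alpha_{10}=000110$, $\alpha_{11}=000011$, $\alpha_{12}=101100$, $\alpha_{13}=011100$, $\alpha_{14}=010110$, $\alpha_{16}=000111$, $\alpha_{18}=101110$, $\alpha_{19}=011110$, $\alpha_{22}=111110$, $\alpha_{24}=011210$, $\alpha_{25}=011111$; write $x_i=x_{\alpha_i}$, $X_i=X_{\alpha_i}$. Let $$\mathcal S=\{\alpha_i\mid i\in\{1,4,6,7,9,10,11,12,13,14,16,18,19,22,24,25\}\},\qquad \mathcal Z=\{\alpha_i\mid i\in\{12,16,18,22,24,25\}\}$$ (the unique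 nonabelian $[6,16,12]$-core of $\mathrm{UE}_6(q)$: $|\mathcal Z|=6$, $|\mathcal S|=16$, and $\mathcal S$ contains $12$ relations $\alpha+\beta=\gamma$). A set $\mathcal P\subseteq\Phi^+$ is a pattern if $\alpha,\beta\in\mathcal P$ and $\alpha+\beta\in\Phi^+$ imply $\alpha+\beta\in\mathcal P$; a pattern $\mathcal K\subseteq\mathcal P$ is normal in $\mathcal P$ if $\delta\in\mathcal K$, $\beta\in\mathcal P$ and $\delta+\beta\in\mathcal P$ imply $\delta+\beta\in\mathcal K$. Let $\mathcal P$ be any pattern and $\mathcal K$ any normal pattern in $\mathcal P$ with $\mathcal P\setminus\mathcal K=\mathcal S$, and let $X_{\mathcal P}$, $X_{\mathcal K}$ be the subgroups of $U$ generated by the $X_\alpha$ with $\alpha\in\mathcal P$, respectively $\alpha\in\mathcal K$. Then $X_{\mathcal K}\trianglelefteq X_{\mathcal P}$, and for the quattern group $X_{\mathcal S}=X_{\mathcal P}/X_{\mathcal K}$ and $$\operatorname{Irr}(X_{\mathcal S})_{\mathcal Z}=\{\chi\in\operatorname{Irr}(X_{\mathcal S})\mid X_\alpha\not\subseteq\ker\chi\text{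 for all }\alpha\in\mathcal Z\}$$ the following holds, where $\phi(t)=e^{2\pi i\operatorname{Tr}(t)/p}$ for $t\in\mathbb F_q$, with $\operatorname{Tr}$ the trace of $\mathbb F_q$ over $\mathbb F_p$. (1) If $p\ne3$, then $\operatorname{Irr}(X_{\mathcal S})_{\mathcal Z}$ consists of $(q-1)^6$ characters, all of degree $q^5$. They are parametrized bijectively as $\chi^{a}$ by $a=(a_{12},a_{16},a_{18},a_{22},a_{24},a_{25})\in(\mathbb F_q^\times)^6$, where $\chi^a(x_i(t))=\chi^a(1)\,\phi(a_it)$ for all $\alpha_i\in\mathcal Z$ and $t\in\mathbb F_q$. (2) If $p=3$, then $\operatorname{Irr}(X_{\mathcal S})_{\mathcal Z}$ consists of $q^2(q-1)^6$ characters, all of degree $q^4$. They are parametrized bijectively as $\chi^a_{b_1,b_2}$ by $a\in(\mathbb F_q^\times)^6$ as in (1) and $b_1,b_2\in\mathbb F_q$, where again $\chi^a_{b_1,b_2}(x_i(t))=\chi^a_{b_1,b_2}(1)\,\phi(a_it)$ for $\alpha_i\in\mathcal Z$. Moreover, the parametrizations of the root subgroups being fixed by a suitable choice of the signs of the structure constants,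 $\chi^a_{b_1,b_2}$ is induced from the linear character of the subgroup generated by all $$x_{1,6,7,14}(t)=x_1(a_{18}a_{24}a_{25}t)\,x_6(a_{18}a_{22}a_{24}t)\,x_7(a_{16}a_{22}a_{24}t)\,x_{14}(-a_{12}a_{18}a_{25}t)\,x_{22}(\tfrac12a_{12}a_{16}a_{18}a_{22}a_{24}a_{25}t^2),$$ $$x_{4,6,7,13}(t)=x_4(a_{18}a_{25}t)\,x_6(a_{18}a_{24}t)\,x_7(2a_{16}a_{24}t)\,x_{13}(-a_{16}a_{18}t)\,x_{12}(a_{16}a_{18}a_{24}a_{25}t^2),$$ by $X_9,X_{10},X_{11},X_{19}$ and by the $X_\alpha$ with $\alpha\in\mathcal Z$, whose values are $\phi(b_1t)$ at $x_{1,6,7,14}(t)$, $\phi(b_2t)$ at $x_{4,6,7,13}(t)$, $1$ on $X_9,X_{10},X_{11},X_{19}$, and $\phi(a_it)$ at $x_i(t)$ for $\alpha_i\in\mathcal Z$. -/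

import Mathlib

open scoped Matrix

namespace UE6

/-! ### The root system of type `E₆` -/

/-- Elements of the root lattice of type `E₆`, in coordinates with respect to the simple roots
`α₁, …, α₆` (Bourbaki labelling). -/
abbrev Lat : Type := Fin 6 → ℤ

/-- The invariant bilinear form on the root lattice, normalized by `(α, α) = 2` for roots. -/
def form (a b : Lat) : ℤ := a ⬝ᵥ (CartanMatrix.E₆ *ᵥ b)

/-- The roots of type `E₆` are the vectors of norm `2` of the root lattice. -/
def IsRoot (a : Lat) : Prop := form a a = 2

instance (a : Lat) : Decidable (IsRoot a) := inferInstanceAs (Decidable (_ = _))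

/-- The set `Φ⁺` of positive roots. -/
def posRoots : Set Lat := {a | IsRoot a ∧ 0 ≤ a}

/-- The type of all roots. -/
abbrev Root : Type := {a : Lat // IsRoot a}

theorem isRoot_neg {a : Lat} (h : IsRoot a) : IsRoot (-a) := by
  simpa [IsRoot, form, Matrix.mulVec_neg] using h

/-- The root `-α`. -/
def Root.neg (α : Root) : Root := ⟨-α.1, isRoot_neg α.2⟩

/-- The positive roots in the usual order (by height, then lexicographically from the left);
the value `0` at the other indices is never used. -/
def root : ℕ → Lat
  | 1 => ![1, 0, 0, 0, 0, 0]
  | 2 => ![0, 1, 0, 0, 0, 0]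
  | 3 => ![0, 0, 1, 0, 0, 0]
  | 4 => ![0, 0, 0, 1, 0, 0]
  | 5 => ![0, 0, 0, 0, 1, 0]
  | 6 => ![0, 0, 0, 0, 0, 1]
  | 7 => ![1, 0, 1, 0, 0, 0]
  | 8 => ![0, 1, 0, 1, 0, 0]
  | 9 => ![0, 0, 1, 1, 0, 0]
  | 10 => ![0, 0, 0, 1, 1, 0]
  | 11 => ![0, 0, 0, 0, 1, 1]
  | 12 => ![1, 0, 1, 1, 0, 0]
  | 13 => ![0, 1, 1, 1, 0, 0]
  | 14 => ![0, 1, 0, 1, 1, 0]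
  | 15 => ![0, 0, 1, 1, 1, 0]
  | 16 => ![0, 0, 0, 1, 1, 1]
  | 17 => ![1, 1, 1, 1, 0, 0]
  | 18 => ![1, 0, 1, 1, 1, 0]
  | 19 => ![0, 1, 1, 1, 1, 0]
  | 20 => ![0, 1, 0, 1, 1, 1]
  | 21 => ![0, 0, 1, 1, 1, 1]
  | 22 => ![1, 1, 1, 1, 1, 0]
  | 23 => ![1, 0, 1, 1, 1, 1]
  | 24 => ![0, 1, 1, 2, 1, 0]
  | 25 => ![0, 1, 1, 1, 1, 1]
  | 26 => ![1, 1, 1, 2, 1, 0]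
  | 27 => ![1, 1, 1, 1, 1, 1]
  | 28 => ![0, 1, 1, 2, 1, 1]
  | 29 => ![1, 1, 2, 2, 1, 0]
  | 30 => ![1, 1, 1, 2, 1, 1]
  | 31 => ![0, 1, 1, 2, 2, 1]
  | 32 => ![1, 1, 2, 2, 1, 1]
  | 33 => ![1, 1, 1, 2, 2, 1]
  | 34 => ![1, 1, 2, 2, 2, 1]
  | 35 => ![1, 1, 2, 3, 2, 1]
  | 36 => ![1, 2, 2, 3, 2, 1]
  | _ => 0

/-! ### The Chevalley group `UE₆(q)` and its root subgroups -/

/-- The structure constants: `sgn a b = (-1) ^ c(a, b)`, where `c` is the bilinear form with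
`c(αᵢ, αᵢ) = 1` and `c(αᵢ, αⱼ) = 1` for exactly one orientation of each edge of the Dynkin
diagram, so that `c(a, a) ≡ (a, a) / 2` and `c(a, b) + c(b, a) ≡ (a, b)` modulo `2`. -/
def sgn (a b : Lat) : ℤ :=
  (Int.negOnePow (a ⬝ᵥ b +
    (a 2 * b 0 + a 3 * b 2 + a 4 * b 3 + a 5 * b 4 + a 1 * b 3)) : ℤˣ)

section Chevalley

variable (F : Type*) [Field F]

/-- The Lie algebra of type `E₆` over `F`, obtained from the `ℤ`-form with basis the simple
coroots `hᵢ` and the root vectors `e_β`: the pair `(h, f)` stands for `∑ h i • hᵢ + ∑ f β • e_β`.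
Its bracket is `[h, e_β] = β(h) e_β`, `[e_α, e_β] = sgn α β • e_{α+β}` if `α + β` is a root,
`[e_α, e_{-α}] = -h_α` (`h_α` the coroot of `α`), all other brackets of basis vectors being `0`. -/
abbrev LieE6 : Type _ := (Fin 6 → F) × (Root → F)

variable {F}

/-- The value `α(h)` of the root `α` on `h = ∑ h i • hᵢ`. -/
def evalRoot (α : Root) (h : Fin 6 → F) : F :=
  ∑ j, ((α.1 ᵥ* CartanMatrix.E₆) j : F) * h j

/-- The operator `ad e_α` on the Lie algebra of type `E₆`. -/
def adE (α : Root) : LieE6 F →ₗ[F] LieE6 F where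
  toFun v :=
    (fun i => -(v.2 α.neg * (α.1 i : F)),
     fun β => if h : IsRoot (β.1 - α.1) then (sgn α.1 (β.1 - α.1) : F) * v.2 ⟨β.1 - α.1, h⟩
       else if β = α then -evalRoot α v.1 else 0)
  map_add' v w := by
    ext i
    · simp; ring
    · simp only [Prod.snd_add, Pi.add_apply]
      split_ifs
      · ring
      · simp [evalRoot, mul_add, Finset.sum_add_distrib]; ring
      · simp
  map_smul' c v := by
    ext i
    · simp; ring
    · simp only [Prod.smul_snd, Pi.smul_apply, smul_eq_mul, RingHom.id_apply]
      split_ifs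
      · ring
      · simp only [evalRoot, Prod.smul_fst, Pi.smul_apply, smul_eq_mul, mul_neg, Finset.mul_sum]
        congr 1
        exact Finset.sum_congr rfl fun j _ => by ring
      · simp

/-- The operator `(ad e_α)² / 2`, which is integral: it sends `e_{-α}` to `e_α` and all other
basis vectors to `0`. -/
def adEHalfSq (α : Root) : LieE6 F →ₗ[F] LieE6 F where
  toFun v := (0, fun β => if β = α then v.2 α.neg else 0)
  map_add' v w := by
    ext i
    · simp
    · simp only [Prod.snd_add, Pi.add_apply]
      split_ifs <;> simp
  map_smul' c v := by
    ext i
    · simp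
    · simp only [Prod.smul_snd, Pi.smul_apply, smul_eq_mul, RingHom.id_apply]
      split_ifs <;> simp

/-- `exp (t ad e_α) = 1 + t ad e_α + t² (ad e_α)² / 2` as a linear map; `(ad e_α)³ = 0`. -/
def expAd (α : Root) (t : F) : LieE6 F →ₗ[F] LieE6 F :=
  LinearMap.id + t • adE α + t ^ 2 • adEHalfSq α

theorem form_self_sub (a b : Lat) : form (b - a) (b - a) = form b b - 2 * form a b + form a a := by
  simp [form, dotProduct, Matrix.mulVec, CartanMatrix.E₆, Fin.sum_univ_succ]
  ring

theorem neg_ne (α : Root) : α.neg ≠ α := by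
  intro h
  have h1 : (-α.1 : Lat) = α.1 := congrArg Subtype.val h
  have h2 : α.1 = 0 := by
    funext i
    have := congrFun h1 i
    simp only [Pi.neg_apply] at this
    simp only [Pi.zero_apply]
    omega
  have h3 := α.2
  rw [h2] at h3
  simp [IsRoot, form] at h3

theorem not_isRoot_zero : ¬ IsRoot (0 : Lat) := by simp [IsRoot, form]

theorem not_isRoot_neg_sub (α : Root) : ¬ IsRoot (α.neg.1 - α.1) := by
  have h : form α.1 α.neg.1 = -2 := by
    have := α.2
    simp only [IsRoot, form] at this
    simp [form, Root.neg, Matrix.mulVec_neg, this]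
  have h1 := α.neg.2
  have h2 := α.2
  simp only [IsRoot] at h1 h2 ⊢
  rw [form_self_sub, h, h1, h2]
  norm_num

theorem adE_adE (α : Root) (v : LieE6 F) : adE α (adE α v) = (2 : F) • adEHalfSq α v := by
  ext i
  · simp [adE, adEHalfSq, not_isRoot_neg_sub, neg_ne]
  · simp only [adE, adEHalfSq, LinearMap.coe_mk, AddHom.coe_mk, Prod.smul_snd, Pi.smul_apply,
      smul_eq_mul]
    have hα := α.2
    have hi := i.2
    by_cases h : IsRoot (i.1 - α.1)
    · have hne : i ≠ α := by
        rintro rfl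
        exact not_isRoot_zero (by simpa using h)
      rw [dif_pos h, if_neg hne]
      have h' := h
      simp only [IsRoot] at h' hα hi
      have h1 : ¬ IsRoot (i.1 - α.1 - α.1) := by
        intro h2
        simp only [IsRoot] at h2
        rw [form_self_sub] at h' h2
        have h3 : form α.1 (i.1 - α.1) = form α.1 i.1 - form α.1 α.1 := by
          simp [form, Matrix.mulVec_sub, dotProduct_sub]
        have h4 := form_self_sub α.1 i.1
        omega
      have h2 : (⟨i.1 - α.1, h⟩ : Root) ≠ α := by
        intro h2
        have h3 : i.1 - α.1 = α.1 := congrArg Subtype.val h2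
        have h4 : form α.1 (i.1 - α.1) = form α.1 i.1 - form α.1 α.1 := by
          simp [form, Matrix.mulVec_sub, dotProduct_sub]
        rw [form_self_sub] at h'
        rw [h3] at h4
        omega
      rw [dif_neg h1, if_neg h2]
      simp
    · rw [dif_neg h]
      split_ifs
      · have h2 : ((2 : ℤ) : F) = 2 := by norm_num
        have h3 : evalRoot α (fun i => (α.1 i : F)) = 2 := by
          rw [← h2, ← (hα : form α.1 α.1 = 2)]
          rw [form, Matrix.dotProduct_mulVec]
          simp [evalRoot, dotProduct]
        have h4 : evalRoot α (fun i => -(v.2 α.neg * (α.1 i : F)))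
            = -(v.2 α.neg * evalRoot α (fun i => (α.1 i : F))) := by
          simp only [evalRoot, Finset.mul_sum, ← Finset.sum_neg_distrib]
          exact Finset.sum_congr rfl fun j _ => by ring
        rw [h4, h3]
        ring
      · simp

theorem adE_adEHalfSq (α : Root) (v : LieE6 F) : adE α (adEHalfSq α v) = 0 := by
  ext i
  · simp [adE, adEHalfSq, neg_ne]
  · have h0 : evalRoot α (0 : Fin 6 → F) = 0 := by simp [evalRoot]
    simp only [adE, adEHalfSq, LinearMap.coe_mk, AddHom.coe_mk, Prod.snd_zero, Pi.zero_apply, h0,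
      neg_zero, ite_self]
    split_ifs with h h1
    · exfalso
      have h3 : i.1 - α.1 = α.1 := congrArg Subtype.val h1
      have h4 : form α.1 (i.1 - α.1) = form α.1 i.1 - form α.1 α.1 := by
        simp [form, Matrix.mulVec_sub, dotProduct_sub]
      have hα := α.2
      have hi := i.2
      simp only [IsRoot] at h hα hi
      rw [form_self_sub] at h
      rw [h3] at h4
      omega
    · simp
    · rfl

theorem adEHalfSq_adE (α : Root) (v : LieE6 F) : adEHalfSq α (adE α v) = 0 := by
  ext i
  · simp [adE, adEHalfSq]
  · simp [adE, adEHalfSq, not_isRoot_neg_sub, neg_ne]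

theorem adEHalfSq_adEHalfSq (α : Root) (v : LieE6 F) : adEHalfSq α (adEHalfSq α v) = 0 := by
  ext i
  · simp [adEHalfSq]
  · simp [adEHalfSq, neg_ne]

theorem expAd_expAd (α : Root) (s t : F) (v : LieE6 F) :
    expAd α s (expAd α t v) = expAd α (s + t) v := by
  simp only [expAd, LinearMap.add_apply, LinearMap.smul_apply, LinearMap.id_apply, map_add,
    map_smul, adE_adE, adE_adEHalfSq, adEHalfSq_adE, adEHalfSq_adEHalfSq]
  module

/-- The root element `x_α(t) = exp (t ad e_α)` of the Chevalley group of type `E₆` over `F`. -/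
def x (α : Root) (t : F) : LieE6 F ≃ₗ[F] LieE6 F :=
  { expAd α t with
    invFun := expAd α (-t)
    left_inv := fun v => by
      change expAd α (-t) (expAd α t v) = v
      rw [expAd_expAd]; simp [expAd]
    right_inv := fun v => by
      change expAd α t (expAd α (-t) v) = v
      rw [expAd_expAd]; simp [expAd] }

variable (F)

/-- The subgroup `X_P` generated by the root subgroups `X_α`, `α ∈ P`. In particular
`X posRoots` is the group `UE₆(q)` when `F` is the field with `q` elements. -/
def X (P : Set Lat) : Subgroup (LieE6 F ≃ₗ[F] LieE6 F) :=
  Subgroup.closure {g | ∃ (α : Root) (t : F), α.1 ∈ P ∧ g = x α t}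

end Chevalley

/-! ### Patterns and quattern groups -/

/-- A pattern (closed subset) of `Φ⁺`. -/
def IsPattern (P : Set Lat) : Prop :=
  P ⊆ posRoots ∧ ∀ α ∈ P, ∀ β ∈ P, α + β ∈ posRoots → α + β ∈ P

/-- `K` is a normal pattern in the pattern `P`. -/
def IsNormalPattern (K P : Set Lat) : Prop :=
  IsPattern P ∧ IsPattern K ∧ K ⊆ P ∧ ∀ δ ∈ K, ∀ β ∈ P, δ + β ∈ P → δ + β ∈ K

section Quattern

variable (F : Type*) [Field F] (P K : Set Lat)

/-- `X_K` as a subgroup of `X_P`. -/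
abbrev XIn : Subgroup (X F P) := (X F K).subgroupOf (X F P)

variable [(XIn F P K).Normal]

/-- The quattern group `X_S = X_P / X_K`, where `S = P \ K`. -/
abbrev QuatternGroup : Type _ := X F P ⧸ XIn F P K

variable {F}

open Classical in
/-- The image of the root element `x_α(t)` in the quattern group, for a root `α ∈ P`
(the value `1` in the other cases is never used). -/
noncomputable def xq (α : Lat) (t : F) : QuatternGroup F P K :=
  if h : IsRoot α ∧ α ∈ P then
    QuotientGroup.mk ⟨x ⟨α, h.1⟩ t, Subgroup.subset_closure ⟨⟨α, h.1⟩, t, h.2, rfl⟩⟩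
  else 1

end Quattern

/-! ### Characters -/

section Characters

variable (G : Type*) [Group G]

/-- The set `Irr(G)` of irreducible complex characters of `G`. -/
def Irr : Set (G → ℂ) :=
  {χ | ∃ (n : ℕ) (ρ : Representation ℂ G (Fin n → ℂ)), ρ.IsIrreducible ∧ χ = ρ.character}

variable {G}

/-- The kernel of a character. -/
def charKer (χ : G → ℂ) : Set G := {g | χ g = χ 1}

open Classical in
/-- The induced character `Ind_H^G ψ` of a linear character `ψ` of a subgroup `H` of the finite
group `G`: `g ↦ |H|⁻¹ ∑_{y ∈ G} ψ°(y⁻¹ g y)`, where `ψ°` extends `ψ` by `0`. -/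
noncomputable def indChar (H : Subgroup G) (ψ : H →* ℂˣ) (g : G) : ℂ :=
  (Nat.card H : ℂ)⁻¹ *
    ∑ᶠ y : G, if h : y⁻¹ * g * y ∈ H then (ψ ⟨y⁻¹ * g * y, h⟩ : ℂ) else 0

end Characters

/-- The set `Irr(X_S)_Z` of the irreducible characters of the quattern group `X_S = X_P / X_K`
with central root support `Z`: those whose kernel contains no `X_α` with `α ∈ Z`. -/
def IrrSupp (F : Type*) [Field F] (P K : Set Lat) [(XIn F P K).Normal] (Z : Set Lat) :
    Set (QuatternGroup F P K → ℂ) :=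
  {χ | χ ∈ Irr (QuatternGroup F P K) ∧
    ∀ α ∈ Z, ¬ Set.range (fun t : F => xq P K α t) ⊆ charKer χ}

/-- The character `φ(t) = exp (2πi Tr(t) / p)` of the additive group of `F`. -/
noncomputable def phi (p : ℕ) [Fact p.Prime] {F : Type*} [Field F] [Algebra (ZMod p) F]
    (t : F) : ℂ :=
  ZMod.stdAddChar (Algebra.trace (ZMod p) F t)

/-! ### The `[6, 16, 12]`-core -/

/-- The quattern `S` of the `[6, 16, 12]`-core. -/
def coreS : Finset Lat :=
  ({1, 4, 6, 7, 9, 10, 11, 12, 13, 14, 16, 18, 19, 22, 24, 25} : Finset ℕ).image root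

/-- The indices of the six central roots of the core. -/
def zIdx : Fin 6 → ℕ := ![12, 16, 18, 22, 24, 25]

/-- The set `Z` of central roots of the core. -/
def coreZ : Finset Lat := Finset.univ.image (fun k => root (zIdx k))

/-- The core has the form `[6, 16, 12]` (each sum `α + β = γ` in `S` is counted twice). -/
theorem core_form : coreZ.card = 6 ∧ coreS.card = 16 ∧
    ((coreS ×ˢ coreS).filter (fun v => v.1 + v.2 ∈ coreS)).card = 2 * 12 := by
  decide +kernel

/-- `Z` consists of all the central roots of `S`. -/
theorem coreZ_eq : coreZ = coreS.filter (fun γ => ∀ α ∈ coreS, γ + α ∉ coreS) := by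
  decide +kernel

/-- The core is irreducible: no pair `(β, δ)` satisfies the conditions for a further reduction. -/
theorem core_irreducible : ¬ ∃ γ ∈ coreZ, ∃ δ ∈ coreS.erase γ, ∃ β ∈ coreS.erase γ,
    δ + β = γ ∧ (∀ α ∈ coreS, ∀ α' ∈ coreS, α + α' ≠ β) ∧
      ∀ α ∈ coreS.erase β, δ + α ∉ coreS := by
  decide +kernel

/-- `P = Φ⁺ \ {α₂, α₃, α₅, α₁₅}`. -/
def coreP : Finset Lat := ((Finset.Icc 1 36) \ {2, 3, 5, 15}).image root

/-- `S` is a quattern. -/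
theorem core_isQuattern : IsNormalPattern ↑(coreP \ coreS) ↑coreP ∧
    (↑coreP \ ↑(coreP \ coreS) : Set Lat) = ↑coreS := by
  have h1 : ∀ α ∈ coreP, IsRoot α ∧ ∀ i, 0 ≤ α i := by decide +kernel
  have h2 : ∀ α ∈ coreP, ∀ β ∈ coreP, IsRoot (α + β) → α + β ∈ coreP := by decide +kernel
  have h3 : ∀ α ∈ coreP \ coreS, ∀ β ∈ coreP, α + β ∈ coreP → α + β ∈ coreP \ coreS := by
    decide +kernel
  have h4 : coreP \ (coreP \ coreS) = coreS := by decide +kernel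
  have hK : ∀ α ∈ coreP \ coreS, α ∈ coreP := fun α h => (Finset.mem_sdiff.mp h).1
  refine ⟨⟨⟨fun α h => h1 α h, fun α hα β hβ h => h2 α hα β hβ h.1⟩,
    ⟨fun α h => h1 α (hK α h), fun α hα β hβ h =>
      h3 α hα β (hK β hβ) (h2 α (hK α hα) β (hK β hβ) h.1)⟩,
    fun α h => hK α h, fun α hα β hβ h => h3 α hα β hβ h⟩, ?_⟩
  rw [← Finset.coe_sdiff, h4]

/-! ### Labels of the characters -/

section Labels

variable (p : ℕ) [Fact p.Prime] {F : Type*} [Field F] [Algebra (ZMod p) F]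
  (P K : Set Lat) [(XIn F P K).Normal]

/-- The label `(a₁₂, a₁₆, a₁₈, a₂₂, a₂₄, a₂₅)` of a character: it is a multiple of
`x_i(t) ↦ φ(aᵢ t)` on the root subgroup `X_i`, for each central root `αᵢ` of the core. -/
def HasCentralLabel (a : Fin 6 → Fˣ) (χ : QuatternGroup F P K → ℂ) : Prop :=
  ∀ (k : Fin 6) (t : F), χ (xq P K (root (zIdx k)) t) = χ 1 * phi p ((a k : F) * t)

variable {P K}

/-- The diagonal element `x_{1,6,7,14}(t)`, normalized by a factor in `X₂₂` which makes it
additive in `t`. -/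
noncomputable def x1' (P K : Set Lat) [(XIn F P K).Normal] (a : Fin 6 → Fˣ) (t : F) :
    QuatternGroup F P K :=
  let a12 : F := a 0
  let a16 : F := a 1
  let a18 : F := a 2
  let a22 : F := a 3
  let a24 : F := a 4
  let a25 : F := a 5
  xq P K (root 1) (a18 * a24 * a25 * t) * xq P K (root 6) (a18 * a22 * a24 * t) *
    xq P K (root 7) (a16 * a22 * a24 * t) * xq P K (root 14) (-(a12 * a18 * a25 * t)) *
    xq P K (root 22) (a12 * a16 * a18 * a22 * a24 * a25 * t ^ 2 / 2)

/-- The diagonal element `x_{4,6,7,13}(t)`, normalized by a factor in `X₁₂` which makes it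
additive in `t`. -/
noncomputable def x2' (P K : Set Lat) [(XIn F P K).Normal] (a : Fin 6 → Fˣ) (t : F) :
    QuatternGroup F P K :=
  let a16 : F := a 1
  let a18 : F := a 2
  let a24 : F := a 4
  let a25 : F := a 5
  xq P K (root 4) (a18 * a25 * t) * xq P K (root 6) (a18 * a24 * t) *
    xq P K (root 7) (2 * a16 * a24 * t) * xq P K (root 13) (-(a16 * a18 * t)) *
    xq P K (root 12) (a16 * a18 * a24 * a25 * t ^ 2)

/-- The subgroup `X' X_J X_Z` of the quattern group, `J = {α₉, α₁₀, α₁₁, α₁₉}`, generated by the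
elements `x_{1,6,7,14}(t)` and `x_{4,6,7,13}(t)` and by the root subgroups of `J` and `Z`. -/
noncomputable def labelSubgroup (P K : Set Lat) [(XIn F P K).Normal] (a : Fin 6 → Fˣ) :
    Subgroup (QuatternGroup F P K) :=
  Subgroup.closure ({g | ∃ t, g = x1' P K a t} ∪ {g | ∃ t, g = x2' P K a t} ∪
    {g | ∃ j ∈ ({9, 10, 11, 19} : Finset ℕ), ∃ t : F, g = xq P K (root j) t} ∪
    {g | ∃ (k : Fin 6) (t : F), g = xq P K (root (zIdx k)) t})

/-- The linear character `ψ` of `X' X_J X_Z` is the one with label `(a, b)`: it is trivial on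
`X_J`, it is `x_i(t) ↦ φ(aᵢ t)` on the central root subgroups, and it takes the values
`φ(b₁ t)` at `x_{1,6,7,14}(t)` and `φ(b₂ t)` at `x_{4,6,7,13}(t)`. -/
def IsLabelChar (a : Fin 6 → Fˣ) (b : F × F) (ψ : labelSubgroup P K a →* ℂˣ) : Prop :=
  ∀ (h : labelSubgroup P K a) (t : F),
    (h.1 = x1' P K a t → (ψ h : ℂ) = phi p (b.1 * t)) ∧
    (h.1 = x2' P K a t → (ψ h : ℂ) = phi p (b.2 * t)) ∧
    (∀ j ∈ ({9, 10, 11, 19} : Finset ℕ), h.1 = xq P K (root j) t → (ψ h : ℂ) = 1) ∧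
    (∀ k : Fin 6, h.1 = xq P K (root (zIdx k)) t → (ψ h : ℂ) = phi p ((a k : F) * t))

end Labels

end UE6

namespace UE6

/-! ### The bilinear form and the structure constants -/

/-! The quattern group is nilpotent of class two: whenever two roots of `coreS` add up to a root of
`coreS`, the sum lies in `coreZ`. Collecting root elements therefore identifies it with `Core F`,
that is `F ^ 10 × F ^ 6` with a bilinear cocycle `coc` whose twelve monomials are the twelve
relations of the core. Two facts make this rigorous for all `P` and `K` at once (`coreEquiv`): the
commutator formula, checked coordinatewise on the Lie algebra, and the independence modulo `X F K`
of root elements for distinct positive roots outside `K`. The latter holds because the action on the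
vectors `e_{-α}` detects the factors of least height (`eq_zero_of_prod_mem_X`).

On an irreducible representation the centre acts by `φ (∑ c k * z k)`, and the support condition
says that all `c k` are nonzero. Commutators then act by the scalars `φ (altForm c v w)`. Hence the
representation is scalar on `radGroup c`, its character vanishes elsewhere, and orthogonality gives
degree² · |`radGroup c`| = `q ^ 16`. Conversely every multiplicative extension of the central
character to `radGroup c` occurs, so the characters over `c` correspond to these extensions
(`parametrization`).

It remains to find the radical of an alternating form on `F ^ 10`. The linear system has two blocks
of five unknowns, and elimination in each ends with `3 y = 0`, up to nonzero factors. If `p ≠ 3` the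
radical is zero, the degree is `q ^ 5`, and the central character determines the character. If `p =
3` the radical is a plane, the degree is `q ^ 4`, and there are `q ^ 2` extensions.

For `p = 3` the group `isoGroup c` comes from a maximal isotropic subspace containing the radical.
There the cocycle is symmetric after applying `lin c`, and the correction `lin c (coc v v)` turns
the central character into linear characters, because `-1/2 = 1` in `F`. Inducing one of them gives
`q ^ 4` times its restriction on `radGroup c` and `0` elsewhere, which is exactly the irreducible
character found before. -/

theorem form_add_left (a b c : Lat) : form (a + b) c = form a c + form b c := by
  simp [form, add_dotProduct]

theorem form_add_right (a b c : Lat) : form a (b + c) = form a b + form a c := by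
  simp [form, Matrix.mulVec_add, dotProduct_add]

theorem form_neg_left (a c : Lat) : form (-a) c = -form a c := by
  simp [form]

theorem form_neg_right (a c : Lat) : form a (-c) = -form a c := by
  simp [form, Matrix.mulVec_neg]

theorem form_sub_right (a b c : Lat) : form a (b - c) = form a b - form a c := by
  simp [form, Matrix.mulVec_sub, dotProduct_sub]

theorem form_comm (a b : Lat) : form a b = form b a := by
  simp [form, dotProduct, Matrix.mulVec, CartanMatrix.E₆, Fin.sum_univ_succ]
  ring

/-- Squares are completed along the three arms of the Dynkin diagram towards the branch node, which
has coordinate `a 3`. This yields both positive definiteness and bounds on the coordinates of roots.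
-/
theorem six_mul_form_self (a : Lat) : 6 * form a a =
    3 * (2 * a 0 - a 2) ^ 2 + (3 * a 2 - 2 * a 3) ^ 2 + 3 * (2 * a 5 - a 4) ^ 2 +
      (3 * a 4 - 2 * a 3) ^ 2 + 3 * (2 * a 1 - a 3) ^ 2 + a 3 ^ 2 := by
  simp [form, dotProduct, Matrix.mulVec, CartanMatrix.E₆, Fin.sum_univ_succ]
  ring

theorem form_self_nonneg (a : Lat) : 0 ≤ form a a := by
  have := six_mul_form_self a
  have : 0 ≤ 6 * form a a := by rw [this]; positivity
  omega

theorem eq_zero_of_form_self {a : Lat} (h : form a a = 0) : a = 0 := by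
  have h0 := six_mul_form_self a
  rw [h] at h0
  have h3 : a 3 = 0 := by
    by_contra hne
    have : 0 < a 3 ^ 2 := by positivity
    nlinarith [sq_nonneg (2 * a 0 - a 2), sq_nonneg (3 * a 2 - 2 * a 3), sq_nonneg (2 * a 5 - a 4),
      sq_nonneg (3 * a 4 - 2 * a 3), sq_nonneg (2 * a 1 - a 3)]
  rw [h3] at h0
  have h2 : a 2 = 0 := by
    by_contra hne
    have : 0 < a 2 ^ 2 := by positivity
    nlinarith [sq_nonneg (2 * a 0 - a 2), sq_nonneg (2 * a 5 - a 4), sq_nonneg (a 4),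
      sq_nonneg (a 1)]
  have h4 : a 4 = 0 := by
    by_contra hne
    have : 0 < a 4 ^ 2 := by positivity
    nlinarith [sq_nonneg (2 * a 0 - a 2), sq_nonneg (2 * a 5 - a 4), sq_nonneg (a 2),
      sq_nonneg (a 1)]
  rw [h2, h4] at h0
  have h1 : a 0 = 0 := by
    by_contra hne
    have : 0 < a 0 ^ 2 := by positivity
    nlinarith [sq_nonneg (a 5), sq_nonneg (a 1)]
  have h5 : a 1 = 0 := by
    by_contra hne
    have : 0 < a 1 ^ 2 := by positivity
    nlinarith [sq_nonneg (a 5), sq_nonneg (a 0)]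
  have h6 : a 5 = 0 := by
    by_contra hne
    have : 0 < a 5 ^ 2 := by positivity
    nlinarith [sq_nonneg (a 1), sq_nonneg (a 0)]
  funext i
  fin_cases i <;> assumption

theorem eq_of_form_eq_two {a b : Lat} (ha : IsRoot a) (hb : IsRoot b) (h : form a b = 2) :
    b = a := by
  apply sub_eq_zero.mp
  apply eq_zero_of_form_self
  rw [form_self_sub, h, ha, hb]
  norm_num

theorem eq_neg_of_form_eq_neg_two {a b : Lat} (ha : IsRoot a) (hb : IsRoot b)
    (h : form a b = -2) : b = -a :=
  eq_of_form_eq_two (isRoot_neg ha) hb (by rw [form_neg_left, h]; norm_num)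

theorem form_le_two {a b : Lat} (ha : IsRoot a) (hb : IsRoot b) : form a b ≤ 2 := by
  have h := form_self_nonneg (b - a)
  rw [form_self_sub, ha, hb] at h
  omega

theorem neg_two_le_form {a b : Lat} (ha : IsRoot a) (hb : IsRoot b) : -2 ≤ form a b := by
  have := form_le_two (isRoot_neg ha) hb
  rw [form_neg_left] at this
  omega

/-- The norm of `b - a` is `4 - 2 (a, b)`: in a simply laced system the form alone decides which
sums and differences are roots. -/
theorem isRoot_sub_iff {a b : Lat} (ha : IsRoot a) (hb : IsRoot b) :
    IsRoot (b - a) ↔ form a b = 1 := by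
  rw [IsRoot, form_self_sub, ha, hb]
  omega

theorem isRoot_add_iff {a b : Lat} (ha : IsRoot a) (hb : IsRoot b) :
    IsRoot (a + b) ↔ form a b = -1 := by
  have h := isRoot_sub_iff (isRoot_neg ha) hb
  rw [sub_neg_eq_add, add_comm b a, form_neg_left] at h
  rw [h]
  omega

theorem sgn_add_left (a b c : Lat) : sgn (a + b) c = sgn a c * sgn b c := by
  simp only [sgn, ← Units.val_mul, ← Int.negOnePow_add]
  congr 2
  simp only [add_dotProduct, Pi.add_apply]
  ring

theorem sgn_add_right (a b c : Lat) : sgn a (b + c) = sgn a b * sgn a c := by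
  simp only [sgn, ← Units.val_mul, ← Int.negOnePow_add]
  congr 2
  simp only [dotProduct_add, Pi.add_apply]
  ring

theorem sgn_neg_right (a b : Lat) : sgn a (-b) = sgn a b := by
  simp only [sgn]
  rw [← Int.negOnePow_neg]
  congr 2
  simp only [dotProduct_neg, Pi.neg_apply]
  ring

theorem sgn_sub_right (a b c : Lat) : sgn a (b - c) = sgn a b * sgn a c := by
  rw [sub_eq_add_neg, sgn_add_right, sgn_neg_right]

theorem sgn_mul_self (a b : Lat) : sgn a b * sgn a b = 1 := by
  simp [sgn, ← Units.val_mul]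

theorem sgn_comm (a b : Lat) : sgn b a = (Int.negOnePow (form a b) : ℤˣ) * sgn a b := by
  simp only [sgn, ← Units.val_mul, ← Int.negOnePow_add]
  congr 1
  rw [Int.negOnePow_eq_iff]
  refine ⟨b 2 * a 0 + b 3 * a 2 + b 4 * a 3 + b 5 * a 4 + b 1 * a 3 - a ⬝ᵥ b, ?_⟩
  simp [form, dotProduct, Matrix.mulVec, CartanMatrix.E₆, Fin.sum_univ_succ]
  ring

theorem sgn_comm_of_odd {a b : Lat} (h : Odd (form a b)) : sgn b a = -sgn a b := by
  rw [sgn_comm, Int.negOnePow_odd _ h]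
  simp

theorem sgn_comm_of_even {a b : Lat} (h : Even (form a b)) : sgn b a = sgn a b := by
  rw [sgn_comm, Int.negOnePow_even _ h]
  simp

theorem sgn_self {a : Lat} (ha : IsRoot a) : sgn a a = -1 := by
  have h : form a a = 2 * (a ⬝ᵥ a - (a 0 * a 2 + a 2 * a 3 + a 3 * a 4 + a 4 * a 5 + a 1 * a 3)) := by
    simp [form, dotProduct, Matrix.mulVec, CartanMatrix.E₆, Fin.sum_univ_succ]
    ring
  rw [ha] at h
  have h1 : a ⬝ᵥ a = 1 + (a 0 * a 2 + a 2 * a 3 + a 3 * a 4 + a 4 * a 5 + a 1 * a 3) := by omega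
  rw [sgn, h1, Int.negOnePow_odd _ ⟨a 0 * a 2 + a 2 * a 3 + a 3 * a 4 + a 4 * a 5 + a 1 * a 3, by ring⟩]
  simp


/-! ### Root elements in coordinates -/

section Coordinates

variable {F : Type*} [Field F]

/-- The coefficient of `e_a` in `v`, extended by `0` to lattice vectors `a` that are not roots. -/
def co (v : LieE6 F) (a : Lat) : F := if h : IsRoot a then v.2 ⟨a, h⟩ else 0

theorem co_root (v : LieE6 F) (α : Root) : co v α.1 = v.2 α := by
  simp [co, α.2]

theorem lie_ext {v w : LieE6 F} (h1 : ∀ i, v.1 i = w.1 i)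
    (h2 : ∀ a, IsRoot a → co v a = co w a) : v = w := by
  refine Prod.ext (funext h1) (funext fun β => ?_)
  rw [← co_root, ← co_root]
  exact h2 _ β.2

theorem expAd_fst (α : Root) (t : F) (v : LieE6 F) (i : Fin 6) :
    (expAd α t v).1 i = v.1 i - t * co v (-α.1) * (α.1 i : F) := by
  have h : co v (-α.1) = v.2 α.neg := co_root v α.neg
  simp [expAd, adE, adEHalfSq, h]
  ring

/-- The cases reflect that `e_b` is reached from `e_{b-α}` if `(α, b) = 1`, from the Cartan part and
`e_{-α}` if `b = α`, and from nothing else. -/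
theorem co_expAd (α : Root) (t : F) (v : LieE6 F) {b : Lat} (hb : IsRoot b) :
    co (expAd α t v) b = co v b + (if form α.1 b = 1 then t * (sgn α.1 (b - α.1) : F) * co v (b - α.1)
      else if form α.1 b = 2 then t ^ 2 * co v (-α.1) - t * evalRoot α v.1 else 0) := by
  have h : co v (-α.1) = v.2 α.neg := co_root v α.neg
  have e : form α.1 b = 2 ↔ (⟨b, hb⟩ : Root) = α :=
    ⟨fun h => Subtype.ext (eq_of_form_eq_two α.2 hb h), fun h => by rw [← h]; exact hb⟩
  have e' := isRoot_sub_iff α.2 hb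
  rw [co, dif_pos hb, co, dif_pos hb, h]
  simp only [expAd, LinearMap.add_apply, LinearMap.id_apply, LinearMap.smul_apply, Prod.snd_add,
    Prod.smul_snd, Pi.add_apply, Pi.smul_apply, smul_eq_mul, adE, adEHalfSq, LinearMap.coe_mk,
    AddHom.coe_mk]
  by_cases h1 : form α.1 b = 1
  · have h2 : ¬ form α.1 b = 2 := by omega
    rw [dif_pos (e'.2 h1), if_neg (fun h => h2 (e.2 h)), if_pos h1, co, dif_pos (e'.2 h1)]
    ring
  · rw [dif_neg (fun h => h1 (e'.1 h)), if_neg h1]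
    by_cases h2 : form α.1 b = 2
    · rw [if_pos (e.1 h2), if_pos h2, if_pos (e.1 h2)]
      ring
    · rw [if_neg (fun h => h2 (e.2 h)), if_neg h2, if_neg (fun h => h2 (e.2 h))]
      ring

theorem evalRoot_expAd (α β : Root) (t : F) (v : LieE6 F) :
    evalRoot α (expAd β t v).1 = evalRoot α v.1 - t * co v (-β.1) * (form α.1 β.1 : F) := by
  have h : (form α.1 β.1 : F) = ∑ j, ((α.1 ᵥ* CartanMatrix.E₆) j : F) * (β.1 j : F) := by
    rw [form, Matrix.dotProduct_mulVec]
    simp [dotProduct]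
  rw [h]
  simp only [evalRoot, expAd_fst, Finset.mul_sum, ← Finset.sum_sub_distrib]
  exact Finset.sum_congr rfl fun j _ => by ring

theorem evalRoot_add {α β γ : Root} (h : γ.1 = α.1 + β.1) (f : Fin 6 → F) :
    evalRoot γ f = evalRoot α f + evalRoot β f := by
  simp only [evalRoot, h, Matrix.add_vecMul, Pi.add_apply, Int.cast_add, add_mul,
    Finset.sum_add_distrib]

theorem co_expAd_of_le_zero (α : Root) (t : F) (v : LieE6 F) {b : Lat} (hb : IsRoot b)
    (h : form α.1 b ≤ 0) : co (expAd α t v) b = co v b := by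
  rw [co_expAd α t v hb, if_neg (by omega), if_neg (by omega), add_zero]

theorem co_expAd_of_eq_one (α : Root) (t : F) (v : LieE6 F) {b : Lat} (hb : IsRoot b)
    (h : form α.1 b = 1) :
    co (expAd α t v) b = co v b + t * (sgn α.1 (b - α.1) : F) * co v (b - α.1) := by
  rw [co_expAd α t v hb, if_pos h]

theorem co_expAd_self (α : Root) (t : F) (v : LieE6 F) :
    co (expAd α t v) α.1 = co v α.1 + (t ^ 2 * co v (-α.1) - t * evalRoot α v.1) := by
  have h : form α.1 α.1 = 2 := α.2
  rw [co_expAd α t v α.2, if_neg (by omega), if_pos h]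

/-- The commutator formula when `α + β` is a root. -/
theorem expAd_comm_of_form_eq_neg_one {α β γ : Root} (h : form α.1 β.1 = -1)
    (hγ : γ.1 = α.1 + β.1) (s t : F) (v : LieE6 F) :
    expAd α s (expAd β t v) =
      expAd γ ((sgn α.1 β.1 : F) * s * t) (expAd β t (expAd α s v)) := by
  have hα : form α.1 α.1 = 2 := α.2
  have hβ : form β.1 β.1 = 2 := β.2
  have hβα : form β.1 α.1 = -1 := by rw [form_comm]; exact h
  have nα := isRoot_neg α.2
  have nβ := isRoot_neg β.2
  have nγ := isRoot_neg γ.2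
  have hN : (sgn α.1 β.1 : F) * sgn α.1 β.1 = 1 := by
    rw [← Int.cast_mul, sgn_mul_self, Int.cast_one]
  have hsα : (sgn α.1 α.1 : F) = -1 := by rw [sgn_self α.2]; simp
  have hsβ : (sgn β.1 β.1 : F) = -1 := by rw [sgn_self β.2]; simp
  have hsβα : (sgn β.1 α.1 : F) = -sgn α.1 β.1 := by
    rw [sgn_comm_of_odd (h ▸ by decide)]; simp
  have sαγ : (sgn α.1 γ.1 : F) = -sgn α.1 β.1 := by
    rw [hγ, sgn_add_right, Int.cast_mul, hsα, neg_one_mul]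
  have sβγ : (sgn β.1 γ.1 : F) = sgn α.1 β.1 := by
    rw [hγ, sgn_add_right, Int.cast_mul, hsβ, hsβα, mul_neg_one, neg_neg]
  -- This sign is compared below with the product of the two signs met on the way from `d - γ` to
  -- `d` through `d - α` or `d - β`; it is the Jacobi identity in terms of signs.
  have sdγ : ∀ d, (sgn γ.1 (d - γ.1) : F) = -(sgn α.1 d * sgn β.1 d) := fun d => by
    rw [hγ]
    simp only [sgn_sub_right, sgn_add_right, sgn_add_left, Int.cast_mul, hsα, hsβ, hsβα]
    linear_combination -(sgn α.1 d * sgn β.1 d : F) * hN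
  have fγ : ∀ d, form γ.1 d = form α.1 d + form β.1 d := fun d => by rw [hγ, form_add_left]
  have gγ : ∀ d, form d γ.1 = form d α.1 + form d β.1 := fun d => by rw [hγ, form_add_right]
  have e1 : -α.1 - β.1 = -γ.1 := by rw [hγ]; abel
  have e2 : -β.1 - α.1 = -γ.1 := by rw [hγ]; abel
  have vα : ∀ w : LieE6 F, co (expAd β t w) (-α.1) =
      co w (-α.1) + t * sgn α.1 β.1 * co w (-γ.1) := fun w => by
    rw [co_expAd_of_eq_one _ _ _ nα (by rw [form_neg_right, hβα]; norm_num), e1, hγ, sgn_neg_right,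
      sgn_add_right, Int.cast_mul, hsβ, hsβα]
    ring
  have sγβ : (sgn γ.1 (-β.1) : F) = -sgn α.1 β.1 := by
    rw [hγ, sgn_neg_right, sgn_add_left, Int.cast_mul, hsβ, mul_neg_one]
  have sγα : (sgn γ.1 (-α.1) : F) = sgn α.1 β.1 := by
    rw [hγ, sgn_neg_right, sgn_add_left, Int.cast_mul, hsα, hsβα, neg_one_mul, neg_neg]
  have vβ : co (expAd α s v) (-β.1) = co v (-β.1) - s * sgn α.1 β.1 * co v (-γ.1) := by
    rw [co_expAd_of_eq_one _ _ _ nβ (by rw [form_neg_right, h]; norm_num), e2, hγ, sgn_neg_right,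
      sgn_add_right, Int.cast_mul, hsα]
    ring
  have vγ : ∀ w : LieE6 F, co (expAd β t w) (-γ.1) = co w (-γ.1) := fun w =>
    co_expAd_of_le_zero _ _ _ nγ (by rw [form_neg_right, gγ]; omega)
  have vγ' : ∀ w : LieE6 F, co (expAd α s w) (-γ.1) = co w (-γ.1) := fun w =>
    co_expAd_of_le_zero _ _ _ nγ (by rw [form_neg_right, gγ]; omega)
  refine lie_ext (fun i => ?_) (fun d hd => ?_)
  · have hi : (γ.1 i : F) = α.1 i + β.1 i := by rw [hγ]; simp
    rw [expAd_fst, expAd_fst, expAd_fst, expAd_fst, expAd_fst, vα, vβ, vγ, vγ', hi]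
    ring
  have m1 := form_le_two α.2 hd
  have m2 := neg_two_le_form α.2 hd
  have n1 := form_le_two β.2 hd
  have n2 := neg_two_le_form β.2 hd
  have l1 := form_le_two γ.2 hd
  have l2 := neg_two_le_form γ.2 hd
  have fd := fγ d
  -- The Cartan part enters only at `d = α`, `d = β` and `d = γ`. For the other `d`, the values `(α,
  -- d)` and `(β, d)` decide which of `d - α`, `d - β`, `d - γ` are roots.
  by_cases hm2 : form α.1 d = 2
  · obtain rfl := eq_of_form_eq_two α.2 hd hm2
    have e3 : α.1 - γ.1 = -β.1 := by rw [hγ]; abel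
    rw [co_expAd_self, co_expAd_of_le_zero β t v hd (by omega),
      co_expAd_of_eq_one γ _ _ hd (by omega), co_expAd_of_le_zero β _ _ hd (by omega), e3,
      co_expAd_self, vα, evalRoot_expAd, h,
      co_expAd_of_le_zero β t _ nβ (by rw [form_neg_right]; omega), vβ, sγβ]
    push_cast
    linear_combination (s * t * co v (-β.1) - s ^ 2 * t * sgn α.1 β.1 * co v (-γ.1)) * hN
  by_cases hn2 : form β.1 d = 2
  · obtain rfl := eq_of_form_eq_two β.2 hd hn2
    have e3 : β.1 - γ.1 = -α.1 := by rw [hγ]; abel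
    rw [co_expAd_of_le_zero α _ _ hd (by omega), co_expAd_self,
      co_expAd_of_eq_one γ _ _ hd (by omega), co_expAd_self, e3,
      co_expAd_of_le_zero α _ _ hd (by omega), evalRoot_expAd, hβα, vα,
      co_expAd_of_le_zero α s _ nα (by rw [form_neg_right]; omega), vγ', sγα, vβ]
    push_cast
    linear_combination -(s * t * co v (-α.1) + s * t ^ 2 * sgn α.1 β.1 * co v (-γ.1)) * hN
  by_cases hm : form α.1 d = 1
  · have hdα := (isRoot_sub_iff α.2 hd).2 hm
    by_cases hn : form β.1 d = 1
    -- Here `(γ, d) = 1 + 1 = 2`, which forces `d = γ`.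
    · obtain rfl := eq_of_form_eq_two γ.2 hd (by omega)
      have e3 : γ.1 - α.1 = β.1 := by rw [hγ]; abel
      have e4 : γ.1 - β.1 = α.1 := by rw [hγ]; abel
      rw [co_expAd_of_eq_one α _ _ hd hm, co_expAd_of_eq_one β _ _ hd hn, e3, e4, co_expAd_self,
        co_expAd_self, co_expAd_of_eq_one β _ _ hd hn, e4, co_expAd_of_eq_one α _ _ hd hm, e3,
        evalRoot_expAd, evalRoot_expAd, vγ, vγ', evalRoot_add hγ, co_expAd_self, vβ, hsβα, fγ, fγ,
        hα, hβ, h, hβα]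
      push_cast
      ring
    · rw [co_expAd_of_eq_one α _ _ hd hm, co_expAd_of_le_zero β _ _ hd (by omega)]
      by_cases hn0 : form β.1 d = 0
      · have hdγ := (isRoot_sub_iff γ.2 hd).2 (by omega)
        have e3 : d - α.1 - β.1 = d - γ.1 := by rw [hγ]; abel
        rw [co_expAd_of_eq_one β _ _ hdα (by rw [form_sub_right]; omega), e3,
          co_expAd_of_eq_one γ _ _ hd (by omega), co_expAd_of_le_zero β _ _ hd (by omega),
          co_expAd_of_eq_one α _ _ hd hm,
          co_expAd_of_le_zero β _ _ hdγ (by rw [form_sub_right, gγ]; omega),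
          co_expAd_of_le_zero α _ _ hdγ (by rw [form_sub_right, gγ]; omega), sdγ]
        simp only [sgn_sub_right, Int.cast_mul, hsα, sβγ]
        ring
      · rw [co_expAd_of_le_zero β _ _ hdα (by rw [form_sub_right]; omega),
          co_expAd_of_le_zero γ _ _ hd (by omega), co_expAd_of_le_zero β _ _ hd (by omega),
          co_expAd_of_eq_one α _ _ hd hm]
  · rw [co_expAd_of_le_zero α _ _ hd (by omega)]
    by_cases hn : form β.1 d = 1
    · have hdβ := (isRoot_sub_iff β.2 hd).2 hn
      by_cases hm0 : form α.1 d = 0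
      · have hdγ := (isRoot_sub_iff γ.2 hd).2 (by omega)
        have e3 : d - β.1 - α.1 = d - γ.1 := by rw [hγ]; abel
        rw [co_expAd_of_eq_one β _ _ hd hn, co_expAd_of_eq_one γ _ _ hd (by omega),
          co_expAd_of_eq_one β _ _ hd hn, co_expAd_of_le_zero α _ _ hd (by omega),
          co_expAd_of_eq_one α _ _ hdβ (by rw [form_sub_right]; omega), e3,
          co_expAd_of_le_zero β _ _ hdγ (by rw [form_sub_right, gγ]; omega),
          co_expAd_of_le_zero α _ _ hdγ (by rw [form_sub_right, gγ]; omega), sdγ]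
        simp only [sgn_sub_right, Int.cast_mul, hsβ, sαγ]
        ring
      · rw [co_expAd_of_eq_one β _ _ hd hn, co_expAd_of_le_zero γ _ _ hd (by omega),
          co_expAd_of_eq_one β _ _ hd hn, co_expAd_of_le_zero α _ _ hd (by omega),
          co_expAd_of_le_zero α _ _ hdβ (by rw [form_sub_right]; omega)]
    · rw [co_expAd_of_le_zero β _ _ hd (by omega), co_expAd_of_le_zero γ _ _ hd (by omega),
        co_expAd_of_le_zero β _ _ hd (by omega), co_expAd_of_le_zero α _ _ hd (by omega)]

/-- Commutation is symmetric in `α` and `β`, so it suffices to treat the coordinates `d` with `(β,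
d) ≤ (α, d)`. This excludes `d = β` and halves the case analysis. -/
theorem co_expAd_comm_of_le {α β : Root} (h : form α.1 β.1 = 0 ∨ form α.1 β.1 = 1) (s t : F)
    (v : LieE6 F) {d : Lat} (hd : IsRoot d) (hle : form β.1 d ≤ form α.1 d) :
    co (expAd α s (expAd β t v)) d = co (expAd β t (expAd α s v)) d := by
  have hα : form α.1 α.1 = 2 := α.2
  have hβ : form β.1 β.1 = 2 := β.2
  have hβα : form β.1 α.1 = form α.1 β.1 := form_comm _ _
  have nα := isRoot_neg α.2
  have vα : co (expAd β t v) (-α.1) = co v (-α.1) :=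
    co_expAd_of_le_zero _ _ _ nα (by rw [form_neg_right]; omega)
  have m1 := form_le_two α.2 hd
  by_cases hm2 : form α.1 d = 2
  · obtain rfl := eq_of_form_eq_two α.2 hd hm2
    rw [co_expAd_self, vα, evalRoot_expAd]
    rcases h with h | h
    · rw [co_expAd_of_le_zero β _ _ hd (by omega), co_expAd_of_le_zero β _ _ hd (by omega),
        co_expAd_self, h]
      push_cast
      ring
    · have hd' := (isRoot_sub_iff β.2 α.2).2 (by omega)
      have e : α.1 - β.1 - α.1 = -β.1 := by abel
      have hN : (sgn α.1 β.1 : F) * sgn α.1 β.1 = 1 := by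
        rw [← Int.cast_mul, sgn_mul_self, Int.cast_one]
      rw [co_expAd_of_eq_one β _ _ hd (by omega), co_expAd_of_eq_one β _ _ hd (by omega),
        co_expAd_self, co_expAd_of_eq_one α _ _ hd' (by rw [form_sub_right]; omega), e, h,
        sgn_sub_right, sgn_neg_right, sgn_self β.2, sgn_comm_of_odd (h ▸ by decide)]
      push_cast
      linear_combination -(s * t * co v (-β.1)) * hN
  · by_cases hm : form α.1 d = 1
    · have hdα := (isRoot_sub_iff α.2 hd).2 hm
      rw [co_expAd_of_eq_one α _ _ hd hm]
      by_cases hn : form β.1 d = 1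
      · have hdβ := (isRoot_sub_iff β.2 hd).2 hn
        rw [co_expAd_of_eq_one β _ _ hd hn, co_expAd_of_eq_one β _ _ hd hn,
          co_expAd_of_eq_one α _ _ hd hm]
        rcases h with h | h
        · rw [co_expAd_of_eq_one α _ _ hdβ (by rw [form_sub_right]; omega),
            co_expAd_of_eq_one β _ _ hdα (by rw [form_sub_right]; omega), sub_right_comm d β.1 α.1]
          simp only [sgn_sub_right, sgn_self α.2, sgn_self β.2, Int.cast_mul,
            sgn_comm_of_even (show Even (form α.1 β.1) from h ▸ by decide)]
          ring
        · rw [co_expAd_of_le_zero α _ _ hdβ (by rw [form_sub_right]; omega),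
            co_expAd_of_le_zero β _ _ hdα (by rw [form_sub_right]; omega)]
          ring
      · rw [co_expAd_of_le_zero β _ _ hd (by omega), co_expAd_of_le_zero β _ _ hd (by omega),
          co_expAd_of_eq_one α _ _ hd hm,
          co_expAd_of_le_zero β _ _ hdα (by rw [form_sub_right]; omega)]
    · rw [co_expAd_of_le_zero α _ _ hd (by omega), co_expAd_of_le_zero β _ _ hd (by omega),
        co_expAd_of_le_zero β _ _ hd (by omega), co_expAd_of_le_zero α _ _ hd (by omega)]

/-- The commutator formula when `α + β` is neither a root nor zero and `α ≠ β`. -/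
theorem expAd_comm_of_form_nonneg {α β : Root} (h : form α.1 β.1 = 0 ∨ form α.1 β.1 = 1) (s t : F)
    (v : LieE6 F) : expAd α s (expAd β t v) = expAd β t (expAd α s v) := by
  have hβα : form β.1 α.1 = form α.1 β.1 := form_comm _ _
  have vα : co (expAd β t v) (-α.1) = co v (-α.1) :=
    co_expAd_of_le_zero _ _ _ (isRoot_neg α.2) (by rw [form_neg_right]; omega)
  have vβ : co (expAd α s v) (-β.1) = co v (-β.1) :=
    co_expAd_of_le_zero _ _ _ (isRoot_neg β.2) (by rw [form_neg_right]; omega)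
  refine lie_ext (fun i => ?_) (fun d hd => ?_)
  · rw [expAd_fst, expAd_fst, expAd_fst, expAd_fst, vα, vβ]
    ring
  · rcases le_total (form β.1 d) (form α.1 d) with hle | hle
    · exact co_expAd_comm_of_le h s t v hd hle
    · exact (co_expAd_comm_of_le (by rwa [hβα]) t s v hd hle).symm

theorem x_apply (α : Root) (t : F) (v : LieE6 F) : x α t v = expAd α t v := rfl

theorem x_add (α : Root) (s t : F) : x α (s + t) = x α s * x α t := by
  ext1 v
  exact (expAd_expAd α s t v).symm

theorem x_zero (α : Root) : x α (0 : F) = 1 := by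
  ext1 v
  simp [x_apply, expAd]

theorem x_neg (α : Root) (t : F) : x α (-t) = (x α t)⁻¹ := by
  rw [eq_inv_iff_mul_eq_one, ← x_add, neg_add_cancel, x_zero]

theorem x_mul_x_of_isRoot {α β γ : Root} (hγ : γ.1 = α.1 + β.1) (s t : F) :
    x α s * x β t = x γ ((sgn α.1 β.1 : F) * s * t) * x β t * x α s := by
  ext1 v
  exact expAd_comm_of_form_eq_neg_one ((isRoot_add_iff α.2 β.2).1 (hγ ▸ γ.2)) hγ s t v

theorem x_mul_x_of_not_isRoot {α β : Root} (h0 : α.1 + β.1 ≠ 0) (h : ¬ IsRoot (α.1 + β.1))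
    (s t : F) : x α s * x β t = x β t * x α s := by
  rw [isRoot_add_iff α.2 β.2] at h
  have h1 := form_le_two α.2 β.2
  have h2 := neg_two_le_form α.2 β.2
  have h3 : form α.1 β.1 ≠ -2 := fun h3 =>
    h0 (by rw [eq_neg_of_form_eq_neg_two α.2 β.2 h3, add_neg_cancel])
  by_cases h4 : form α.1 β.1 = 2
  · obtain rfl : β = α := Subtype.ext (eq_of_form_eq_two α.2 β.2 h4)
    rw [← x_add, ← x_add, add_comm]
  · ext1 v
    exact expAd_comm_of_form_nonneg (by omega) s t v

end Coordinates


/-! ### Generation of pattern subgroups -/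

section Patterns

variable {F : Type*} [Field F]

theorem x_mem_X {P : Set Lat} (α : Root) (h : α.1 ∈ P) (t : F) : x α t ∈ X F P :=
  Subgroup.subset_closure ⟨α, t, h, rfl⟩

theorem X_mono {K P : Set Lat} (h : K ⊆ P) : X F K ≤ X F P :=
  Subgroup.closure_mono fun _ ⟨α, t, hα, hg⟩ => ⟨α, t, h hα, hg⟩

theorem add_ne_zero_of_posRoots {a b : Lat} (ha : a ∈ posRoots) (hb : b ∈ posRoots) :
    a + b ≠ 0 := by
  intro h
  have h0 : a = 0 := by
    funext i
    have h1 := ha.2 i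
    have h2 := hb.2 i
    have h3 := congrFun h i
    simp only [Pi.add_apply, Pi.zero_apply] at h1 h2 h3 ⊢
    omega
  exact not_isRoot_zero (h0 ▸ ha.1)

theorem add_mem_posRoots {a b : Lat} (ha : a ∈ posRoots) (hb : b ∈ posRoots)
    (h : IsRoot (a + b)) : a + b ∈ posRoots :=
  ⟨h, add_nonneg ha.2 hb.2⟩

/-- By the commutator formula, conjugating `x β t` by `x α s` only adds a factor at `α + β`, which
lies in `K` by normality of the pattern. -/
theorem conj_mem_X {K P : Set Lat} (hK : IsNormalPattern K P) {α : Root} (hα : α.1 ∈ P) (s : F)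
    {g : LieE6 F ≃ₗ[F] LieE6 F} (hg : g ∈ X F K) : x α s * g * (x α s)⁻¹ ∈ X F K := by
  induction hg using Subgroup.closure_induction with
  | mem g hg =>
    obtain ⟨β, t, hβ, rfl⟩ := hg
    have pα := hK.1.1 hα
    have pβ := hK.2.1.1 hβ
    by_cases h : IsRoot (α.1 + β.1)
    · have h1 : α.1 + β.1 ∈ P := hK.1.2 _ hα _ (hK.2.2.1 hβ) (add_mem_posRoots pα pβ h)
      have h2 : α.1 + β.1 ∈ K := by
        rw [add_comm] at h1 ⊢
        exact hK.2.2.2 _ hβ _ hα h1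
      rw [x_mul_x_of_isRoot (γ := ⟨_, h⟩) rfl, mul_inv_cancel_right]
      exact mul_mem (x_mem_X _ h2 _) (x_mem_X _ hβ _)
    · rw [x_mul_x_of_not_isRoot (add_ne_zero_of_posRoots pα pβ) h, mul_inv_cancel_right]
      exact x_mem_X _ hβ _
  | one => simp
  | mul g g' _ _ h h' =>
    have e : x α s * (g * g') * (x α s)⁻¹ = (x α s * g * (x α s)⁻¹) * (x α s * g' * (x α s)⁻¹) := by
      group
    rw [e]
    exact mul_mem h h'
  | inv g _ h =>
    have e : x α s * g⁻¹ * (x α s)⁻¹ = (x α s * g * (x α s)⁻¹)⁻¹ := by group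
    rw [e]
    exact inv_mem h

theorem X_le_normalizer {K P : Set Lat} (hK : IsNormalPattern K P) :
    X F P ≤ Subgroup.normalizer (X F K : Set (LieE6 F ≃ₗ[F] LieE6 F)) := by
  refine (Subgroup.closure_le _).2 ?_
  rintro _ ⟨α, s, hα, rfl⟩
  refine Subgroup.mem_normalizer_iff.2 fun g => ⟨fun hg => conj_mem_X hK hα s hg, fun hg => ?_⟩
  have := conj_mem_X hK hα (-s) hg
  rw [x_neg] at this
  convert this using 1
  group

theorem XIn_normal {K P : Set Lat} (hK : IsNormalPattern K P) : (XIn F P K).Normal :=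
  (Subgroup.normal_subgroupOf_iff_le_normalizer (X_mono hK.2.2.1)).2 (X_le_normalizer hK)

/-! ### The height filtration -/

/-- The height of a lattice vector. -/
def ht (a : Lat) : ℤ := ∑ i, a i

theorem ht_add (a b : Lat) : ht (a + b) = ht a + ht b := by simp [ht, Finset.sum_add_distrib]

theorem ht_sub (a b : Lat) : ht (a - b) = ht a - ht b := by simp [ht]

theorem ht_neg (a : Lat) : ht (-a) = -ht a := by simp [ht]

theorem ht_pos {a : Lat} (ha : a ∈ posRoots) : 0 < ht a := by
  refine Finset.sum_pos' (fun i _ => ha.2 i) ?_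
  by_contra! h
  refine not_isRoot_zero ?_
  have : a = 0 := funext fun i => le_antisymm (h i (Finset.mem_univ i)) (ha.2 i)
  exact this ▸ ha.1

/-- A crude box, needed only to make patterns finite: the sum of squares equals `12` on roots, so
each of the six linear forms has absolute value below `4`. -/
theorem mem_Icc_of_isRoot {a : Lat} (ha : IsRoot a) :
    a ∈ Set.Icc (fun _ => -4 : Lat) (fun _ => 4) := by
  have h0 := six_mul_form_self a
  rw [ha] at h0
  have s1 := sq_nonneg (2 * a 0 - a 2)
  have s2 := sq_nonneg (3 * a 2 - 2 * a 3)
  have s3 := sq_nonneg (2 * a 5 - a 4)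
  have s4 := sq_nonneg (3 * a 4 - 2 * a 3)
  have s5 := sq_nonneg (2 * a 1 - a 3)
  have s6 := sq_nonneg (a 3)
  have key : ∀ y : ℤ, y ^ 2 ≤ 12 → -4 < y ∧ y < 4 := fun y hy => by
    constructor <;> nlinarith
  have k1 := key (2 * a 0 - a 2) (by omega)
  have k2 := key (3 * a 2 - 2 * a 3) (by omega)
  have k3 := key (2 * a 5 - a 4) (by omega)
  have k4 := key (3 * a 4 - 2 * a 3) (by omega)
  have k5 := key (2 * a 1 - a 3) (by omega)
  have k6 := key (a 3) (by omega)
  constructor <;> intro i <;> fin_cases i <;> simp <;> omega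

theorem finite_posRoots : posRoots.Finite :=
  (Set.finite_Icc (fun _ => -4 : Lat) (fun _ => 4)).subset fun _ h => mem_Icc_of_isRoot h.1

/-- The vectors of the Lie algebra with components in degrees `≥ n` only. -/
def fil (F : Type*) [Field F] (n : ℤ) : AddSubgroup (LieE6 F) where
  carrier := {v | (0 < n → v.1 = 0) ∧ ∀ a, IsRoot a → ht a < n → co v a = 0}
  zero_mem' := by simp [co]
  add_mem' := by
    rintro v w ⟨h1, h2⟩ ⟨h3, h4⟩
    refine ⟨fun h => by simp [h1 h, h3 h], fun a ha h => ?_⟩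
    have h5 := h2 a ha h
    have h6 := h4 a ha h
    simp only [co, dif_pos ha] at h5 h6 ⊢
    simp [h5, h6]
  neg_mem' := by
    rintro v ⟨h1, h2⟩
    refine ⟨fun h => by simp [h1 h], fun a ha h => ?_⟩
    have h5 := h2 a ha h
    simp only [co, dif_pos ha] at h5 ⊢
    simp [h5]

theorem fil_anti {m n : ℤ} (h : m ≤ n) : fil F n ≤ fil F m := fun _ hv =>
  ⟨fun hm => hv.1 (by omega), fun a ha hm => hv.2 a ha (by omega)⟩

theorem co_sub (v w : LieE6 F) (a : Lat) : co (v - w) a = co v a - co w a := by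
  by_cases h : IsRoot a <;> simp [co, h]

/-- The operator `ad e_α` raises degrees by `ht α ≥ h`, and its half square by twice as much; the
Cartan part sits in degree `0`. -/
theorem x_sub_mem_fil {α : Root} {h n : ℤ} (h0 : 0 ≤ h) (hα : h ≤ ht α.1) (t : F) {v : LieE6 F}
    (hv : v ∈ fil F n) : x α t v - v ∈ fil F (n + h) := by
  refine ⟨fun hn => funext fun i => ?_, fun a ha hn => ?_⟩
  · have : co v (-α.1) = 0 := hv.2 _ (isRoot_neg α.2) (by rw [ht_neg]; omega)
    rw [Prod.fst_sub, Pi.sub_apply, x_apply, expAd_fst, this]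
    simp
  · rw [co_sub, x_apply, co_expAd α t v ha]
    split_ifs with h1 h2
    · rw [hv.2 _ ((isRoot_sub_iff α.2 ha).2 h1) (by rw [ht_sub]; omega)]
      ring
    · have e := eq_of_form_eq_two α.2 ha h2
      have hn' : 0 < n := by rw [e] at hn; omega
      rw [hv.2 _ (isRoot_neg α.2) (by rw [ht_neg]; omega), hv.1 hn']
      simp [evalRoot]
    · ring

/-- The operators `g` such that `g` and `g⁻¹` are congruent to the identity modulo terms that raise
degrees by at least `h`. -/
def unip (F : Type*) [Field F] (h : ℤ) (h0 : 0 ≤ h) : Subgroup (LieE6 F ≃ₗ[F] LieE6 F) where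
  carrier := {g | ∀ n, ∀ v ∈ fil F n, g v - v ∈ fil F (n + h) ∧ g⁻¹ v - v ∈ fil F (n + h)}
  one_mem' := by
    intro n v _
    simp only [inv_one, LinearEquiv.coe_one, id_eq, sub_self, zero_mem, and_self]
  mul_mem' := by
    have key : ∀ g g' : LieE6 F ≃ₗ[F] LieE6 F, (∀ n, ∀ v ∈ fil F n, g v - v ∈ fil F (n + h)) →
        (∀ n, ∀ v ∈ fil F n, g' v - v ∈ fil F (n + h)) →
        ∀ n, ∀ v ∈ fil F n, (g * g') v - v ∈ fil F (n + h) := by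
      intro g g' hg hg' n v hv
      have h1 := hg' n v hv
      have h2 := fil_anti (m := n + h) (by omega) (hg _ _ h1)
      have h3 := hg n v hv
      -- With `w = g' v - v`, the difference is `(g w - w) + (g v - v) + w`, and each term raises
      -- degrees by at least `h`.
      have e : (g * g') v - v = (g (g' v - v) - (g' v - v)) + (g v - v) + (g' v - v) := by
        rw [LinearEquiv.mul_apply, map_sub]
        abel
      rw [e]
      exact add_mem (add_mem h2 h3) h1
    intro g g' hg hg' n v hv
    refine ⟨key g g' (fun n v hv => (hg n v hv).1) (fun n v hv => (hg' n v hv).1) n v hv, ?_⟩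
    rw [mul_inv_rev]
    exact key g'⁻¹ g⁻¹ (fun n v hv => (hg' n v hv).2) (fun n v hv => (hg n v hv).2) n v hv
  inv_mem' := by
    intro g hg n v hv
    rw [inv_inv]
    exact (hg n v hv).symm

theorem x_mem_unip {α : Root} {h : ℤ} (h0 : 0 ≤ h) (hα : h ≤ ht α.1) (t : F) :
    x α t ∈ unip F h h0 := by
  intro n v hv
  rw [← x_neg]
  exact ⟨x_sub_mem_fil h0 hα t hv, x_sub_mem_fil h0 hα (-t) hv⟩

theorem X_le_unip {K : Set Lat} {h : ℤ} (h0 : 0 ≤ h) (hK : ∀ a ∈ K, h ≤ ht a) :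
    X F K ≤ unip F h h0 := by
  refine (Subgroup.closure_le _).2 ?_
  rintro _ ⟨α, t, hα, rfl⟩
  exact x_mem_unip h0 (hK _ hα) t

/-! ### Leading coefficients and the independence of root elements -/

open Classical in
/-- The root vector `e_{-α}`. -/
noncomputable def eNeg (F : Type*) [Field F] (α : Root) : LieE6 F := (0, Pi.single α.neg 1)

theorem co_eNeg (α β : Root) : co (eNeg F α) (-β.1) = if α = β then 1 else 0 := by
  have h : co (eNeg F α) (-β.1) = (eNeg F α).2 β.neg := co_root _ β.neg
  rw [h, eNeg]
  by_cases hαβ : α = β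
  · simp [hαβ]
  · have : β.neg ≠ α.neg := fun h => hαβ (Subtype.ext (neg_injective (congrArg Subtype.val h)).symm)
    simp [hαβ, this]

theorem eNeg_mem_fil (α : Root) (h : 0 ≤ ht α.1) : eNeg F α ∈ fil F (-ht α.1) := by
  refine ⟨fun h1 => by omega, fun a ha h1 => ?_⟩
  have := co_eNeg (F := F) α ⟨-a, isRoot_neg ha⟩
  rw [neg_neg] at this
  rw [this, if_neg]
  rintro rfl
  rw [ht_neg] at h1
  omega

/-- The Cartan component of `g e_{-α}`. -/
noncomputable def leadCoeff (α : Root) (g : LieE6 F ≃ₗ[F] LieE6 F) : Fin 6 → F := (g (eNeg F α)).1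

/-- A root element `x β t` creates a Cartan component only out of `e_{-β}`, so `leadCoeff α`
isolates the factor at `α`. -/
theorem leadCoeff_x (α β : Root) (t : F) (i : Fin 6) :
    leadCoeff α (x β t) i = if α = β then -(t * (α.1 i : F)) else 0 := by
  rw [leadCoeff, x_apply, expAd_fst, co_eNeg]
  split_ifs with h
  · simp [eNeg, h]
  · simp [eNeg]

theorem leadCoeff_one (α : Root) : leadCoeff α (1 : LieE6 F ≃ₗ[F] LieE6 F) = 0 := rfl

/-- The element `g'` changes `e_{-α}` by terms of degree at least `0`, and `g` changes those terms
only in degrees at least `ht α > 0`, outside the Cartan part. Hence the leading coefficients add. -/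
theorem leadCoeff_mul {α : Root} (h0 : 0 < ht α.1) {g g' : LieE6 F ≃ₗ[F] LieE6 F}
    (hg : g ∈ unip F (ht α.1) h0.le) (hg' : g' ∈ unip F (ht α.1) h0.le) :
    leadCoeff α (g * g') = leadCoeff α g + leadCoeff α g' := by
  have h1 := (hg' _ _ (eNeg_mem_fil α h0.le)).1
  have h2 := (hg _ _ h1).1.1 (by omega)
  rw [Prod.fst_sub, map_sub, Prod.fst_sub, Prod.fst_sub] at h2
  have h3 : (eNeg F α).1 = 0 := rfl
  rw [h3, sub_zero] at h2
  rw [leadCoeff, leadCoeff, leadCoeff, LinearEquiv.mul_apply]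
  linear_combination h2

theorem leadCoeff_eq_zero {α : Root} {h : ℤ} (h0 : 0 ≤ ht α.1) (hα : ht α.1 < h)
    {g : LieE6 F ≃ₗ[F] LieE6 F} (hg : g ∈ unip F h (h0.trans hα.le)) : leadCoeff α g = 0 := by
  have h1 := (hg _ _ (eNeg_mem_fil α h0)).1.1 (by omega)
  rw [Prod.fst_sub] at h1
  exact sub_eq_zero.1 h1

/-- Half the norm is an integral quadratic form in the coordinates and equals `1` on roots, so the
coordinates cannot all vanish in `F`, whatever the characteristic. -/
theorem exists_cast_ne_zero {a : Lat} (ha : IsRoot a) : ∃ i, (a i : F) ≠ 0 := by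
  by_contra! h0
  have h : form a a = 2 * (a ⬝ᵥ a - (a 0 * a 2 + a 2 * a 3 + a 3 * a 4 + a 4 * a 5 + a 1 * a 3)) := by
    simp [form, dotProduct, Matrix.mulVec, CartanMatrix.E₆, Fin.sum_univ_succ]
    ring
  rw [ha] at h
  have h1 : a ⬝ᵥ a = 1 + (a 0 * a 2 + a 2 * a 3 + a 3 * a 4 + a 4 * a 5 + a 1 * a 3) := by omega
  have h2 := congrArg (Int.cast : ℤ → F) h1
  simp [dotProduct, h0] at h2

/-- An element of `X_K` is a product of a root element for a root `β` of minimal height and an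
element of `X_{K \ {β}}`. -/
theorem exists_eq_x_mul {K : Set Lat} (hK : IsPattern K) {β : Root} (hβ : β.1 ∈ K)
    (hmin : ∀ a ∈ K, ht β.1 ≤ ht a) :
    IsPattern (K \ {β.1}) ∧ ∀ g ∈ X F K, ∃ t, ∃ g' ∈ X F (K \ {β.1}), g = x β t * g' := by
  have hN : IsNormalPattern (K \ {β.1}) K := by
    -- A sum of two roots of `K` is strictly higher than the minimal height, so it cannot be `β`;
    -- this makes `K \ {β}` a normal pattern.
    have key : ∀ a ∈ K, ∀ b ∈ K, a + b ≠ β.1 := by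
      intro a ha b hb h
      have h1 := congrArg ht h
      have h2 := hmin a ha
      have h3 := ht_pos (hK.1 hb)
      rw [ht_add] at h1
      omega
    exact ⟨hK, ⟨Set.sdiff_subset.trans hK.1, fun a ha b hb h =>
      ⟨hK.2 a ha.1 b hb.1 h, key a ha.1 b hb.1⟩⟩, Set.sdiff_subset, fun a ha b hb h =>
      ⟨h, key a ha.1 b hb⟩⟩
  refine ⟨hN.2.1, fun g hg => ?_⟩
  induction hg using Subgroup.closure_induction with
  | mem g hg =>
    obtain ⟨α, t, hα, rfl⟩ := hg
    by_cases h : α = β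
    · exact ⟨t, 1, one_mem _, by rw [h, mul_one]⟩
    · exact ⟨0, x α t, x_mem_X (P := K \ {β.1}) _ ⟨hα, fun h' => h (Subtype.ext h')⟩ t, by rw [x_zero, one_mul]⟩
  | one => exact ⟨0, 1, one_mem _, by rw [x_zero, one_mul]⟩
  | mul g g' _ _ h h' =>
    obtain ⟨t, u, hu, rfl⟩ := h
    obtain ⟨t', u', hu', rfl⟩ := h'
    refine ⟨t + t', (x β (-t') * u * (x β (-t'))⁻¹) * u', mul_mem (conj_mem_X hN hβ _ hu) hu', ?_⟩
    rw [x_add, x_neg]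
    group
  | inv g _ h =>
    obtain ⟨t, u, hu, rfl⟩ := h
    refine ⟨-t, x β t * u⁻¹ * (x β t)⁻¹, conj_mem_X hN hβ _ (inv_mem hu), ?_⟩
    rw [x_neg]
    group

/-- Induction on the size of `K`, splitting off the root `β` of least height: the factor at `β`
either is trivial or does not interfere with the coefficient at `α`, unless `β = α`. -/
theorem mem_of_leadCoeff_ne_zero {K : Set Lat} (hK : IsPattern K) {α : Root} (h0 : 0 < ht α.1)
    {g : LieE6 F ≃ₗ[F] LieE6 F} (hg : g ∈ X F K) (hg' : g ∈ unip F (ht α.1) h0.le)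
    (hα : leadCoeff α g ≠ 0) : α.1 ∈ K := by
  induction hn : K.ncard using Nat.strong_induction_on generalizing K α g with
  | _ n ih =>
  have hfin : K.Finite := finite_posRoots.subset hK.1
  rcases K.eq_empty_or_nonempty with rfl | hne
  · have : X F (∅ : Set Lat) = ⊥ := by simp [X]
    rw [this, Subgroup.mem_bot] at hg
    rw [hg, leadCoeff_one] at hα
    exact (hα rfl).elim
  obtain ⟨b, hb, hmin⟩ := Set.exists_min_image K ht hfin hne
  set β : Root := ⟨b, (hK.1 hb).1⟩
  obtain ⟨hK', hex⟩ := exists_eq_x_mul (F := F) hK (β := β) hb hmin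
  obtain ⟨t, u, hu, rfl⟩ := hex g hg
  have hlt : (K \ {β.1}).ncard < n := hn ▸ Set.ncard_sdiff_singleton_lt_of_mem hb hfin
  have hβ0 : 0 < ht β.1 := ht_pos (hK.1 hb)
  -- If `β` is lower than `α`, the coefficient of `g` at `β` vanishes by height, and that of `u` by
  -- induction, because `β ∉ K \ {β}`; hence `t = 0`. Otherwise both factors lie in `unip F (ht α)`,
  -- where leading coefficients add.
  rcases lt_or_ge (ht β.1) (ht α.1) with h | h
  · have huu : u ∈ unip F (ht β.1) hβ0.le := X_le_unip hβ0.le (fun a ha => hmin a ha.1) hu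
    have h1 := leadCoeff_mul hβ0 (x_mem_unip hβ0.le le_rfl t) huu
    rw [leadCoeff_eq_zero hβ0.le h hg'] at h1
    have h2 : leadCoeff β u = 0 := by
      by_contra h2
      exact (ih _ hlt hK' hβ0 hu huu h2 rfl).2 rfl
    obtain ⟨i, hi⟩ := exists_cast_ne_zero (F := F) β.2
    have h3 := congrFun h1 i
    rw [h2, add_zero, leadCoeff_x, if_pos rfl, Pi.zero_apply, zero_eq_neg] at h3
    obtain rfl : t = 0 := (mul_eq_zero.1 h3).resolve_right hi
    rw [x_zero, one_mul] at hg' hα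
    exact (ih _ hlt hK' h0 hu hg' hα rfl).1
  · by_cases hαβ : α = β
    · rw [hαβ]
      exact hb
    · have hx : x β t ∈ unip F (ht α.1) h0.le := x_mem_unip h0.le h t
      have huu : u ∈ unip F (ht α.1) h0.le := by
        have := mul_mem (inv_mem hx) hg'
        rwa [inv_mul_cancel_left] at this
      rw [leadCoeff_mul h0 hx huu] at hα
      refine (ih _ hlt hK' h0 hu huu (fun h2 => hα ?_) rfl).1
      rw [h2, add_zero]
      funext i
      rw [leadCoeff_x, if_neg hαβ, Pi.zero_apply]

/-- A product of root elements for distinct roots outside the pattern `K` lies in `X_K` only if it is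
trivial. -/
theorem eq_zero_of_prod_mem_X {K : Set Lat} (hK : IsPattern K) {l : List Root} (hl : l.Nodup)
    (hpos : ∀ α ∈ l, α.1 ∈ posRoots ∧ α.1 ∉ K) (s : Root → F)
    (h : (l.map fun α => x α (s α)).prod ∈ X F K) : ∀ α ∈ l, s α = 0 := by
  by_contra! hne
  obtain ⟨α₀, hα₀, hs₀⟩ := hne
  classical
  -- With `α` of least height among the nontrivial factors, all factors lie in `unip F (ht α)`, and
  -- the coefficient at `α` of the product is that of the single factor at `α`.
  obtain ⟨α, hα, hmin⟩ := Finset.exists_min_image (l.toFinset.filter fun α => s α ≠ 0)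
    (fun α => ht α.1) ⟨α₀, by simp [hα₀, hs₀]⟩
  simp only [Finset.mem_filter, List.mem_toFinset] at hα hmin
  have h0 := ht_pos (hpos α hα.1).1
  have hmem : ∀ β ∈ l, x β (s β) ∈ unip F (ht α.1) h0.le := by
    intro β hβ
    by_cases hs : s β = 0
    · rw [hs, x_zero]
      exact one_mem _
    · exact x_mem_unip h0.le (hmin β ⟨hβ, hs⟩) _
  have hlead : ∀ m : List Root, m ⊆ l → m.Nodup → ∀ i,
      (m.map fun β => x β (s β)).prod ∈ unip F (ht α.1) h0.le ∧
      leadCoeff α (m.map fun β => x β (s β)).prod i =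
        if α ∈ m then -(s α * (α.1 i : F)) else 0 := by
    intro m
    induction m with
    | nil => intro _ _ i; simp [leadCoeff_one, one_mem]
    | cons β m ih =>
      intro hm hnd i
      have hβ := hmem β (hm (by simp))
      obtain ⟨h1, h2⟩ := ih (fun _ h => hm (List.mem_cons_of_mem _ h)) (List.nodup_cons.1 hnd).2 i
      rw [List.map_cons, List.prod_cons]
      refine ⟨mul_mem hβ h1, ?_⟩
      rw [leadCoeff_mul h0 hβ h1, Pi.add_apply, h2, leadCoeff_x]
      by_cases hαβ : α = β
      · subst hαβ
        simp [(List.nodup_cons.1 hnd).1]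
      · simp [hαβ]
  obtain ⟨i, hi⟩ := exists_cast_ne_zero (F := F) α.2
  obtain ⟨h1, h2⟩ := hlead l (fun _ h => h) hl i
  refine (hpos α hα.1).2 (mem_of_leadCoeff_ne_zero hK h0 h h1 fun h3 => ?_)
  rw [h3, if_pos hα.1, Pi.zero_apply, zero_eq_neg] at h2
  exact (mul_ne_zero hα.2 hi) h2

end Patterns


/-! ### Collecting products modulo a commuting family -/

section Collect

variable {G ι A Z : Type*} [Group G] [AddCommMonoid Z]

/-- The exponent of the central factor that appears when the product of `u i (v i)` and that of
`u i (w i)`, `i ∈ l`, are collected into one ordered product. -/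
def collectSum (N : ι → ι → A → A → Z) (v w : ι → A) : List ι → Z
  | [] => 0
  | i :: l => (l.map fun j => N j i (v j) (w i)).sum + collectSum N v w l

variable {u : ι → A → G} {ζ : Z → G} {N : ι → ι → A → A → Z}

theorem prod_map_mul_comm (h0 : ζ 0 = 1) (hadd : ∀ z z', ζ (z + z') = ζ z * ζ z')
    (hcomm : ∀ z i s, Commute (ζ z) (u i s))
    (hN : ∀ i j s t, u i s * u j t = ζ (N i j s t) * u j t * u i s) (v : ι → A) (i : ι) (t : A)
    (l : List ι) : (l.map fun j => u j (v j)).prod * u i t =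
      ζ (l.map fun j => N j i (v j) t).sum * (u i t * (l.map fun j => u j (v j)).prod) := by
  induction l with
  | nil => simp [h0]
  | cons j l ih =>
    simp only [List.map_cons, List.prod_cons, List.sum_cons, hadd]
    rw [mul_assoc, ih, ← mul_assoc, ← (hcomm _ j (v j)).eq, mul_assoc, ← mul_assoc (u j (v j)),
      hN j i, ← hadd, add_comm, hadd]
    simp only [mul_assoc]

/-- Each `u i (w i)` is moved left past the factors `u j (v j)` with `j` later in the list. The
commutators are central, so they accumulate in one factor without producing new ones. -/
theorem prod_map_mul_prod_map [Add A] (h0 : ζ 0 = 1) (hadd : ∀ z z', ζ (z + z') = ζ z * ζ z')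
    (hcomm : ∀ z i s, Commute (ζ z) (u i s)) (hu : ∀ i s t, u i (s + t) = u i s * u i t)
    (hN : ∀ i j s t, u i s * u j t = ζ (N i j s t) * u j t * u i s) (v w : ι → A) (l : List ι) :
    (l.map fun j => u j (v j)).prod * (l.map fun j => u j (w j)).prod =
      ζ (collectSum N v w l) * (l.map fun j => u j (v j + w j)).prod := by
  induction l with
  | nil => simp [h0, collectSum]
  | cons i l ih =>
    simp only [List.map_cons, List.prod_cons, collectSum, hadd, hu]
    have h1 := prod_map_mul_comm h0 hadd hcomm hN v i (w i) l
    calc u i (v i) * (l.map fun j => u j (v j)).prod * (u i (w i) * (l.map fun j => u j (w j)).prod)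
        = u i (v i) * ((l.map fun j => u j (v j)).prod * u i (w i)) *
          (l.map fun j => u j (w j)).prod := by simp only [mul_assoc]
      _ = (u i (v i) * ζ (l.map fun j => N j i (v j) (w i)).sum) * u i (w i) *
          ((l.map fun j => u j (v j)).prod * (l.map fun j => u j (w j)).prod) := by
        rw [h1]; simp only [mul_assoc]
      _ = ζ (l.map fun j => N j i (v j) (w i)).sum * (u i (v i) *
          (u i (w i) * ζ (collectSum N v w l))) * (l.map fun j => u j (v j + w j)).prod := by
        rw [ih, ← (hcomm _ i (v i)).eq]; simp only [mul_assoc]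
      _ = _ := by
        rw [← (hcomm _ i (w i)).eq, ← mul_assoc (u i (v i)), ← (hcomm _ i (v i)).eq]
        simp only [mul_assoc, hu]

end Collect

/-! ### A model of the quattern group -/

/-- The indices of the roots of the core outside `Z`. -/
def nIdx : Fin 10 → ℕ := ![1, 4, 6, 7, 9, 10, 11, 13, 14, 19]

/-- The structure constants of the core. -/
def nConst (i j : Fin 10) (k : Fin 6) : ℤ :=
  if root (nIdx i) + root (nIdx j) = root (zIdx k) then sgn (root (nIdx i)) (root (nIdx j)) else 0

section Model

variable {F : Type*} [Field F]

/-- The cocycle describing the multiplication of the quattern group of the core. -/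
def coc (v w : Fin 10 → F) : Fin 6 → F :=
  ![v 3 * w 1 - v 4 * w 0, v 5 * w 2 - v 6 * w 1, -(v 5 * w 3), -(v 9 * w 0) - v 8 * w 3,
    v 8 * w 4 + v 7 * w 5 - v 9 * w 1, v 9 * w 2 + v 7 * w 6]

theorem coc_add_left (v v' w : Fin 10 → F) : coc (v + v') w = coc v w + coc v' w := by
  ext k
  fin_cases k <;> simp [coc] <;> ring

theorem coc_add_right (v w w' : Fin 10 → F) : coc v (w + w') = coc v w + coc v w' := by
  ext k
  fin_cases k <;> simp [coc] <;> ring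

@[simp] theorem coc_zero_left (w : Fin 10 → F) : coc 0 w = 0 := by
  ext k
  fin_cases k <;> simp [coc]

@[simp] theorem coc_zero_right (w : Fin 10 → F) : coc w 0 = 0 := by
  ext k
  fin_cases k <;> simp [coc]

theorem coc_neg_left (v w : Fin 10 → F) : coc (-v) w = -coc v w := by
  ext k
  fin_cases k <;> simp [coc] <;> ring

variable (F) in
/-- The group with underlying set `F ^ 10 × F ^ 6` and multiplication
`(v, z) (v', z') = (v + v', z + z' + coc v v')`. -/
@[ext]
structure Core where
  /-- The coordinates at the roots of the core outside `Z`. -/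
  v : Fin 10 → F
  /-- The coordinates at the roots in `Z`. -/
  z : Fin 6 → F

namespace Core

instance : One (Core F) := ⟨⟨0, 0⟩⟩
instance : Mul (Core F) := ⟨fun g h => ⟨g.v + h.v, g.z + h.z + coc g.v h.v⟩⟩
instance : Inv (Core F) := ⟨fun g => ⟨-g.v, -g.z + coc g.v g.v⟩⟩

@[simp] theorem one_v : (1 : Core F).v = 0 := rfl
@[simp] theorem one_z : (1 : Core F).z = 0 := rfl
@[simp] theorem mul_v (g h : Core F) : (g * h).v = g.v + h.v := rfl
@[simp] theorem mul_z (g h : Core F) : (g * h).z = g.z + h.z + coc g.v h.v := rfl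
@[simp] theorem inv_v (g : Core F) : g⁻¹.v = -g.v := rfl
@[simp] theorem inv_z (g : Core F) : g⁻¹.z = -g.z + coc g.v g.v := rfl

/-- Associativity is the cocycle identity, which follows from the bilinearity of `coc`. -/
instance : Group (Core F) :=
  Group.ofLeftAxioms
    (fun a b c => by
      ext1
      · simp [add_assoc]
      · simp only [mul_v, mul_z, coc_add_left, coc_add_right]
        abel)
    (fun a => by ext1 <;> simp)
    (fun a => by
      ext1
      · simp
      · simp [coc_neg_left])

variable (F) in
/-- The underlying set of the model. -/
def equivProd : Core F ≃ (Fin 10 → F) × (Fin 6 → F) where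
  toFun g := (g.v, g.z)
  invFun p := ⟨p.1, p.2⟩
  left_inv _ := rfl
  right_inv _ := rfl

instance [Finite F] : Finite (Core F) := .of_equiv _ (equivProd F).symm

theorem card_eq (F : Type*) [Fintype F] : Nat.card (Core F) = Fintype.card F ^ 16 := by
  rw [Nat.card_congr (equivProd F)]
  simp [← pow_add]

end Core

/-- Only pairs in descending order whose roots sum to a root of `Z` contribute. These are the twelve
relations, each giving one monomial of `coc` with the sign prescribed by `sgn`. -/
theorem collectSum_eq_coc (v w : Fin 10 → F) :
    collectSum (fun i j s t k => (nConst i j k : F) * s * t) v w (List.finRange 10) = coc v w := by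
  have e : List.finRange 10 = [0, 1, 2, 3, 4, 5, 6, 7, 8, 9] := by decide
  have h0 : ∀ i j : Fin 10, j < i → nConst i j 0 =
      if i = 3 ∧ j = 1 then 1 else if i = 4 ∧ j = 0 then -1 else 0 := by decide +kernel
  have h1 : ∀ i j : Fin 10, j < i → nConst i j 1 =
      if i = 5 ∧ j = 2 then 1 else if i = 6 ∧ j = 1 then -1 else 0 := by decide +kernel
  have h2 : ∀ i j : Fin 10, j < i → nConst i j 2 =
      if i = 5 ∧ j = 3 then -1 else 0 := by decide +kernel
  have h3 : ∀ i j : Fin 10, j < i → nConst i j 3 =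
      if i = 9 ∧ j = 0 then -1 else if i = 8 ∧ j = 3 then -1 else 0 := by decide +kernel
  have h4 : ∀ i j : Fin 10, j < i → nConst i j 4 =
      if i = 8 ∧ j = 4 then 1 else if i = 7 ∧ j = 5 then 1 else if i = 9 ∧ j = 1 then -1 else 0 := by
    decide +kernel
  have h5 : ∀ i j : Fin 10, j < i → nConst i j 5 =
      if i = 9 ∧ j = 2 then 1 else if i = 7 ∧ j = 6 then 1 else 0 := by decide +kernel
  funext k
  simp only [e, collectSum, List.map_cons, List.map_nil, List.sum_cons, List.sum_nil, Pi.add_apply]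
  fin_cases k
  · simp [h0, coc]; ring
  · simp [h1, coc]; ring
  · simp [h2, coc]
  · simp [h3, coc]; ring
  · simp [h4, coc]; ring
  · simp [h5, coc]

end Model

/-! ### The quattern group of the core -/

section QuatternOfCore

variable {F : Type*} [Field F] {P K : Set Lat} [(XIn F P K).Normal]

theorem xq_root {α : Root} (h : α.1 ∈ P) (t : F) :
    xq P K α.1 t = QuotientGroup.mk ⟨x α t, x_mem_X α h t⟩ := by
  rw [xq, dif_pos ⟨α.2, h⟩]

theorem xq_add (α : Lat) (s t : F) : xq P K α (s + t) = xq P K α s * xq P K α t := by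
  unfold xq
  split_ifs with h
  · rw [← QuotientGroup.mk_mul]
    congr 1
    exact Subtype.ext (x_add _ s t)
  · rw [mul_one]

@[simp] theorem xq_zero (α : Lat) : xq P K α (0 : F) = 1 := by
  have h := xq_add (P := P) (K := K) α (0 : F) 0
  rw [add_zero] at h
  exact left_eq_mul.1 h

theorem xq_of_mem {α : Lat} (h : α ∈ K) (t : F) : xq P K α t = 1 := by
  unfold xq
  split_ifs with hα
  · rw [QuotientGroup.eq_one_iff, Subgroup.mem_subgroupOf]
    exact x_mem_X (⟨α, hα.1⟩ : Root) h t
  · rfl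

theorem xq_of_notMem {α : Lat} (h : α ∉ P) (t : F) : xq P K α t = 1 := by
  rw [xq, dif_neg fun h' => h h'.2]

theorem xq_of_notMem_diff {α : Lat} (h : α ∉ P \ K) (t : F) : xq P K α t = 1 := by
  by_cases hα : α ∈ P
  · exact xq_of_mem (by_contra fun h' => h ⟨hα, h'⟩) t
  · exact xq_of_notMem hα t

theorem xq_mul_xq (hP : IsPattern P) {α β : Lat} (hα : α ∈ P) (hβ : β ∈ P) (s t : F) :
    xq P K α s * xq P K β t =
      xq P K (α + β) ((sgn α β : F) * s * t) * xq P K β t * xq P K α s := by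
  have pα := hP.1 hα
  have pβ := hP.1 hβ
  lift α to Root using pα.1
  lift β to Root using pβ.1
  by_cases h : IsRoot (α.1 + β.1)
  · have hγ := hP.2 _ hα _ hβ (add_mem_posRoots pα pβ h)
    have e := xq_root (F := F) (K := K) (α := ⟨_, h⟩) hγ ((sgn α.1 β.1 : F) * s * t)
    rw [e, xq_root hα, xq_root hβ, ← QuotientGroup.mk_mul, ← QuotientGroup.mk_mul,
      ← QuotientGroup.mk_mul]
    congr 1
    exact Subtype.ext (x_mul_x_of_isRoot (γ := ⟨_, h⟩) rfl s t)
  -- If `α + β` is not a root, the factor at `α + β` is the default value `1`.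
  · rw [xq, xq, xq, dif_neg (c := IsRoot (α.1 + β.1) ∧ _) fun h' => h h'.1, one_mul,
      dif_pos ⟨α.2, hα⟩, dif_pos ⟨β.2, hβ⟩, ← QuotientGroup.mk_mul, ← QuotientGroup.mk_mul]
    congr 1
    exact Subtype.ext (x_mul_x_of_not_isRoot (add_ne_zero_of_posRoots pα pβ) h s t)

theorem prod_map_xq {ι : Type*} (r : ι → Root) (hr : ∀ i, (r i).1 ∈ P) (s : ι → F) (l : List ι) :
    ∃ h : (l.map fun i => x (r i) (s i)).prod ∈ X F P,
      (l.map fun i => xq P K (r i).1 (s i)).prod = QuotientGroup.mk ⟨_, h⟩ := by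
  induction l with
  | nil => exact ⟨by simp [one_mem], rfl⟩
  | cons i l ih =>
    obtain ⟨h, e⟩ := ih
    refine ⟨by rw [List.map_cons, List.prod_cons]; exact mul_mem (x_mem_X _ (hr i) _) h, ?_⟩
    rw [List.map_cons, List.prod_cons, e, xq_root (hr i), ← QuotientGroup.mk_mul]
    rfl

theorem eq_zero_of_prod_map_xq {ι : Type*} (hK : IsNormalPattern K P) {r : ι → Root}
    (hinj : Function.Injective r) (hr : ∀ i, (r i).1 ∈ P \ K) (s : ι → F) {l : List ι}
    (hl : l.Nodup) (h : (l.map fun i => xq P K (r i).1 (s i)).prod = 1) : ∀ i ∈ l, s i = 0 := by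
  obtain ⟨hm, e⟩ := prod_map_xq (K := K) r (fun i => (hr i).1) s l
  rw [e, QuotientGroup.eq_one_iff, Subgroup.mem_subgroupOf] at h
  -- The exponents are transported along the injection `r`, so that they become a function of the
  -- root itself.
  have e' : (l.map fun i => x (r i) (s i)) =
      (l.map r).map fun α => x α (Function.extend r s 0 α) := by
    simp [hinj.extend_apply]
  change (l.map fun i => x (r i) (s i)).prod ∈ X F K at h
  rw [e'] at h
  have := eq_zero_of_prod_mem_X hK.2.1 (hl.map hinj) (fun α hα => by
    obtain ⟨i, -, rfl⟩ := List.mem_map.1 hα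
    exact ⟨hK.1.1 (hr i).1, (hr i).2⟩) _ h
  intro i hi
  have h2 := this (r i) (List.mem_map_of_mem hi)
  rwa [hinj.extend_apply] at h2

/-- The roots of the core. -/
def coreRoot : Fin 10 ⊕ Fin 6 → Root :=
  Sum.elim (fun i => ⟨root (nIdx i), by revert i; decide +kernel⟩)
    (fun k => ⟨root (zIdx k), by revert k; decide +kernel⟩)

theorem coreRoot_injective : Function.Injective coreRoot := by
  have : ∀ i j, (coreRoot i).1 = (coreRoot j).1 → i = j := by decide +kernel
  exact fun i j h => this i j (congrArg Subtype.val h)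

theorem coreRoot_mem (i : Fin 10 ⊕ Fin 6) : (coreRoot i).1 ∈ coreS := by
  revert i
  decide +kernel

theorem exists_coreRoot_eq {α : Lat} (h : α ∈ coreS) : ∃ i, (coreRoot i).1 = α := by
  revert α
  decide +kernel

theorem nIdx_add_notMem : ∀ i j, (∀ k, root (nIdx i) + root (nIdx j) ≠ root (zIdx k)) →
    root (nIdx i) + root (nIdx j) ∉ coreS := by
  decide +kernel

theorem zIdx_add_notMem : ∀ k, ∀ α ∈ coreS, root (zIdx k) + α ∉ coreS := by
  decide +kernel

/-- The product of root elements for the central roots. -/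
noncomputable def zetaProd (P K : Set Lat) [(XIn F P K).Normal] (z : Fin 6 → F) :
    QuatternGroup F P K :=
  ((List.finRange 6).map fun k => xq P K (root (zIdx k)) (z k)).prod

/-- The map from the model to the quattern group. -/
noncomputable def ofCore (P K : Set Lat) [(XIn F P K).Normal] (g : Core F) : QuatternGroup F P K :=
  ((List.finRange 10).map fun i => xq P K (root (nIdx i)) (g.v i)).prod * zetaProd P K g.z

theorem coreS_subset (hS : P \ K = ↑coreS) : (↑coreS : Set Lat) ⊆ P := hS ▸ Set.sdiff_subset

/-- The commutator sits at a sum outside `S = P \ K`, hence is trivial in the quotient. -/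
theorem commute_xq_zIdx (hK : IsNormalPattern K P) (hS : P \ K = ↑coreS) (k : Fin 6) (s : F) {α : Lat} (hα : α ∈ coreS) (t : F) :
    Commute (xq P K (root (zIdx k)) s) (xq P K α t) := by
  have h := xq_mul_xq (K := K) hK.1 (coreS_subset hS (coreRoot_mem (.inr k)))
    (coreS_subset hS hα) s t
  have h1 : root (zIdx k) + α ∉ P \ K := hS ▸ zIdx_add_notMem k α hα
  change xq P K (root (zIdx k)) s * _ =
    xq P K (root (zIdx k) + α) _ * _ * xq P K (root (zIdx k)) s at h
  rwa [xq_of_notMem_diff h1, one_mul] at h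

theorem zetaProd_add (hK : IsNormalPattern K P) (hS : P \ K = ↑coreS) (z z' : Fin 6 → F) :
    zetaProd P K (z + z') = zetaProd P K z * zetaProd P K z' := by
  -- The collecting lemma is applied to a commuting family: the central factor is identically `1`,
  -- and its exponent monoid `ℕ` is a dummy.
  have := prod_map_mul_prod_map (G := QuatternGroup F P K) (Z := ℕ) (ζ := fun _ => 1)
    (u := fun k s => xq P K (root (zIdx k)) s) (N := fun _ _ _ _ => 0) rfl (fun _ _ => by simp)
    (fun _ _ _ => Commute.one_left _) (fun k s t => xq_add _ s t)
    (fun k l s t => by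
      rw [one_mul]
      exact commute_xq_zIdx hK hS k s (coreRoot_mem (.inr l)) t) z z' (List.finRange 6)
  rw [one_mul] at this
  exact this.symm

theorem zetaProd_zero : zetaProd P K (0 : Fin 6 → F) = 1 := by
  simp [zetaProd]

theorem zetaProd_single (k : Fin 6) (t : F) :
    zetaProd P K (Pi.single k t) = xq P K (root (zIdx k)) t := by
  have : List.finRange 6 = [0, 1, 2, 3, 4, 5] := by decide
  rw [zetaProd, this]
  fin_cases k <;> simp [Pi.single_apply]

theorem commute_zetaProd (hK : IsNormalPattern K P) (hS : P \ K = ↑coreS) (z : Fin 6 → F) {α : Lat} (hα : α ∈ coreS) (t : F) :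
    Commute (zetaProd P K z) (xq P K α t) := by
  refine Commute.list_prod_left _ _ fun g hg => ?_
  obtain ⟨k, -, rfl⟩ := List.mem_map.1 hg
  exact commute_xq_zIdx hK hS k _ hα t

/-- For two noncentral roots, either the sum is a unique root of `Z`, or it lies outside `S` and the
commutator dies. So the commutators are given by `nConst`, and collecting produces `coc`. -/
theorem ofCore_mul (hK : IsNormalPattern K P) (hS : P \ K = ↑coreS) (g h : Core F) : ofCore P K (g * h) = ofCore P K g * ofCore P K h := by
  have key := prod_map_mul_prod_map (G := QuatternGroup F P K) (ζ := zetaProd P K)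
    (u := fun i s => xq P K (root (nIdx i)) s) (N := fun i j s t k => (nConst i j k : F) * s * t)
    zetaProd_zero (zetaProd_add hK hS)
    (fun z i s => commute_zetaProd hK hS z (coreRoot_mem (.inl i)) s) (fun i s t => xq_add _ s t)
    (fun i j s t => by
      have h := xq_mul_xq (K := K) hK.1 (coreS_subset hS (coreRoot_mem (.inl i)))
        (coreS_subset hS (coreRoot_mem (.inl j))) s t
      refine h.trans ?_
      congr 2
      change xq P K (root (nIdx i) + root (nIdx j)) _ = _
      by_cases hk : ∃ k, root (nIdx i) + root (nIdx j) = root (zIdx k)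
      · obtain ⟨k, hk⟩ := hk
        rw [hk, ← zetaProd_single]
        congr 1
        funext k'
        by_cases hkk : k' = k
        · subst hkk
          rw [Pi.single_eq_same, nConst, if_pos hk]
          rfl
        · have : nConst i j k' = 0 := if_neg fun hk' => hkk <| Sum.inr_injective <|
            coreRoot_injective (Subtype.ext (hk'.symm.trans hk))
          simp [this, hkk]
      · have h1 : root (nIdx i) + root (nIdx j) ∉ P \ K :=
          hS ▸ nIdx_add_notMem i j (fun k hk' => hk ⟨k, hk'⟩)
        rw [xq_of_notMem_diff h1, ← zetaProd_zero]
        congr 1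
        funext k
        have : nConst i j k = 0 := if_neg fun hk' => hk ⟨k, hk'⟩
        simp [this])
    g.v h.v (List.finRange 10)
  rw [collectSum_eq_coc] at key
  have hc : ∀ z : Fin 6 → F, ∀ v : Fin 10 → F, Commute (zetaProd P K z)
      ((List.finRange 10).map fun i => xq P K (root (nIdx i)) (v i)).prod := by
    intro z v
    refine Commute.list_prod_right _ _ fun g hg => ?_
    obtain ⟨i, -, rfl⟩ := List.mem_map.1 hg
    exact commute_zetaProd hK hS z (coreRoot_mem (.inl i)) _
  have key' : ((List.finRange 10).map fun i => xq P K (root (nIdx i)) (g.v i)).prod *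
      ((List.finRange 10).map fun i => xq P K (root (nIdx i)) (h.v i)).prod =
      zetaProd P K (coc g.v h.v) *
        ((List.finRange 10).map fun i => xq P K (root (nIdx i)) ((g * h).v i)).prod := key
  unfold ofCore
  rw [(hc g.z h.v).mul_mul_mul_comm, key', (hc _ _).eq, mul_assoc, ← zetaProd_add hK hS,
    ← zetaProd_add hK hS, Core.mul_z, add_comm]

theorem ofCore_z (z : Fin 6 → F) : ofCore P K (⟨0, z⟩ : Core F) = zetaProd P K z := by
  simp [ofCore]

theorem ofCore_single_z (k : Fin 6) (t : F) :
    ofCore P K (⟨0, Pi.single k t⟩ : Core F) = xq P K (root (zIdx k)) t := by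
  rw [ofCore_z, zetaProd_single]

theorem ofCore_single_v (i : Fin 10) (t : F) :
    ofCore P K (⟨Pi.single i t, 0⟩ : Core F) = xq P K (root (nIdx i)) t := by
  have : List.finRange 10 = [0, 1, 2, 3, 4, 5, 6, 7, 8, 9] := by decide
  rw [ofCore, zetaProd_zero, this]
  fin_cases i <;> simp [Pi.single_apply]

/-- The homomorphism from the model to the quattern group. -/
noncomputable def coreHom (hK : IsNormalPattern K P) (hS : P \ K = ↑coreS) :
    Core F →* QuatternGroup F P K :=
  MonoidHom.mk' (ofCore P K) (ofCore_mul hK hS)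

/-- An element of the kernel gives a product of root elements for the sixteen distinct roots of `S`
that lies in `X F K`; by independence all its coordinates vanish. -/
theorem coreHom_injective (hK : IsNormalPattern K P) (hS : P \ K = ↑coreS) :
    Function.Injective (coreHom (F := F) hK hS) := by
  refine (injective_iff_map_eq_one _).2 fun g hg => ?_
  have h := eq_zero_of_prod_map_xq (K := K) (P := P) hK coreRoot_injective
    (fun i => hS ▸ coreRoot_mem i) (Sum.elim g.v g.z)
    (l := (List.finRange 10).map Sum.inl ++ (List.finRange 6).map Sum.inr) (by decide +kernel) (by
      rw [List.map_append, List.prod_append, List.map_map, List.map_map]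
      exact hg)
  ext i
  · exact h (.inl i) (by simp)
  · exact h (.inr i) (by simp)

theorem coreHom_surjective (hK : IsNormalPattern K P) (hS : P \ K = ↑coreS) :
    Function.Surjective (coreHom (F := F) hK hS) := by
  intro q
  obtain ⟨⟨g, hg⟩, rfl⟩ := QuotientGroup.mk_surjective q
  change QuotientGroup.mk _ ∈ (coreHom (F := F) hK hS).range
  induction hg using Subgroup.closure_induction with
  | mem g hg =>
    obtain ⟨α, t, hα, rfl⟩ := hg
    have e := xq_root (K := K) hα t
    rw [← e]
    by_cases h : α.1 ∈ P \ K
    · have h' := h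
      rw [hS] at h'
      obtain ⟨i | k, hi⟩ := exists_coreRoot_eq h'
      · rw [← hi]
        exact ⟨_, ofCore_single_v i t⟩
      · rw [← hi]
        exact ⟨_, ofCore_single_z k t⟩
    · rw [xq_of_notMem_diff h]
      exact one_mem _
  | one => exact one_mem _
  | mul g g' hg hg' h h' => exact mul_mem h h'
  | inv g hg h => exact inv_mem h

/-- The quattern group of the core is isomorphic to the model. -/
noncomputable def coreEquiv (hK : IsNormalPattern K P) (hS : P \ K = ↑coreS) :
    Core F ≃* QuatternGroup F P K :=
  MulEquiv.ofBijective (coreHom hK hS) ⟨coreHom_injective hK hS, coreHom_surjective hK hS⟩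

theorem coreEquiv_single_z (hK : IsNormalPattern K P) (hS : P \ K = ↑coreS) (k : Fin 6) (t : F) :
    coreEquiv hK hS ⟨0, Pi.single k t⟩ = xq P K (root (zIdx k)) t :=
  ofCore_single_z k t

theorem coreEquiv_single_v (hK : IsNormalPattern K P) (hS : P \ K = ↑coreS) (i : Fin 10) (t : F) :
    coreEquiv hK hS ⟨Pi.single i t, 0⟩ = xq P K (root (nIdx i)) t :=
  ofCore_single_v i t

end QuatternOfCore


/-! ### Irreducible representations that are scalar on a subgroup -/

section Representations

variable {G : Type*} [Group G]

/-- Schur's lemma over the algebraically closed field `ℂ`. -/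
theorem exists_eq_smul_of_commute {V : Type*} [AddCommGroup V] [Module ℂ V] [FiniteDimensional ℂ V]
    (ρ : Representation ℂ G V) [ρ.IsIrreducible] (T : V →ₗ[ℂ] V) (hT : ∀ g, T * ρ g = ρ g * T) :
    ∃ c : ℂ, T = c • 1 := by
  obtain ⟨c, hc⟩ :=
    (Representation.IsIrreducible.algebraMap_intertwiningMap_bijective_of_isAlgClosed
      (ρ := ρ)).2 ⟨T, hT⟩
  refine ⟨c, ?_⟩
  have := congrArg Representation.IntertwiningMap.toLinearMap hc
  exact this.symm.trans rfl

theorem nontrivial_of_isIrreducible {V : Type*} [AddCommGroup V] [Module ℂ V]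
    (ρ : Representation ℂ G V) [ρ.IsIrreducible] : Nontrivial V := by
  by_contra h
  rw [not_nontrivial_iff_subsingleton] at h
  exact bot_ne_top (α := Subrepresentation ρ)
    (Subrepresentation.toSubmodule_injective (Subsingleton.elim _ _))

/-- Conjugation by `h` multiplies `ρ g` by `c` but preserves its trace. -/
theorem character_eq_zero_of_mul {V : Type*} [AddCommGroup V] [Module ℂ V]
    (ρ : Representation ℂ G V) {g h : G} {c : ℂ} (hc : c ≠ 1)
    (e : ρ g * ρ h = c • (ρ h * ρ g)) : ρ.character g = 0 := by
  have h1 : ρ (h⁻¹ * g * h⁻¹⁻¹) = c • ρ g := by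
    rw [inv_inv, mul_assoc, map_mul, map_mul, e, mul_smul_comm, ← mul_assoc, ← map_mul,
      inv_mul_cancel, map_one, one_mul]
  have h2 := ρ.char_conj g h⁻¹
  rw [Representation.character, h1, map_smul, smul_eq_mul] at h2
  have h3 : (c - 1) * ρ.character g = 0 := by
    rw [sub_mul, one_mul, sub_eq_zero]
    exact h2
  exact (mul_eq_zero.1 h3).resolve_left (sub_ne_zero.2 hc)

/-- In the orthogonality relation only `R` contributes, and there `χ g * χ g⁻¹` is the square of the
degree since the two scalars are mutually inverse. -/
theorem sq_finrank_mul_card [Finite G] {V : Type*} [AddCommGroup V] [Module ℂ V]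
    [FiniteDimensional ℂ V] (ρ : Representation ℂ G V) [ρ.IsIrreducible] (R : Subgroup G) (μ : G → ℂ)
    (hR : ∀ r ∈ R, ρ r = μ r • 1) (h0 : ∀ g ∉ R, ρ.character g = 0) :
    Module.finrank ℂ V ^ 2 * Nat.card R = Nat.card G := by
  classical
  have := Fintype.ofFinite G
  have hne : (Nat.card G : ℂ) ≠ 0 := Nat.cast_ne_zero.2 Nat.card_pos.ne'
  have : Invertible (Nat.card G : ℂ) := invertibleOfNonzero hne
  have h1 := Representation.char_orthonormal ρ ρ
  rw [if_pos ⟨.refl ρ⟩, inv_mul_eq_iff_eq_mul₀ hne, mul_one] at h1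
  have h2 : ∀ g, ρ.character g * ρ.character g⁻¹ =
      if g ∈ R then (Module.finrank ℂ V : ℂ) ^ 2 else 0 := by
    intro g
    split_ifs with hg
    · have h3 : (ρ g * ρ g⁻¹ : V →ₗ[ℂ] V) = 1 := by rw [← map_mul, mul_inv_cancel, map_one]
      rw [Representation.character, Representation.character, hR g hg, hR _ (inv_mem hg)] at *
      rw [smul_mul_smul_comm, mul_one] at h3
      have h4 := congrArg (LinearMap.trace ℂ V) h3
      simp only [map_smul, LinearMap.trace_one, smul_eq_mul] at h4 ⊢
      linear_combination (Module.finrank ℂ V : ℂ) * h4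
    · rw [h0 g hg, zero_mul]
  simp only [h2] at h1
  rw [Finset.sum_ite, Finset.sum_const_zero, add_zero, Finset.sum_const, nsmul_eq_mul] at h1
  have h3 : (Finset.univ.filter fun g => g ∈ R).card = Nat.card R := by
    rw [Nat.card_eq_fintype_card, Fintype.card_subtype]
  rw [h3] at h1
  rw [mul_comm]
  exact_mod_cast h1

theorem exists_fin_representation {V : Type*} [AddCommGroup V] [Module ℂ V] [FiniteDimensional ℂ V]
    (σ : Representation ℂ G V) (R : Set G) (μ : G → ℂ) (hσ : ∀ r ∈ R, σ r = μ r • 1) :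
    ∃ ρ : Representation ℂ G (Fin (Module.finrank ℂ V) → ℂ), ∀ r ∈ R, ρ r = μ r • 1 := by
  let e := (Module.finBasis ℂ V).equivFun
  refine ⟨((e.conjAlgEquiv ℂ : _ ≃ₐ[ℂ] _) : _ →* _).comp σ, fun r hr => ?_⟩
  rw [MonoidHom.comp_apply, hσ r hr]
  exact (map_smul (e.conjAlgEquiv ℂ) (μ r) 1).trans (by rw [map_one])

/-- A proper nonzero subrepresentation would again be scalar on `R`, with smaller dimension. -/
theorem isIrreducible_of_minimal (R : Set G) (μ : G → ℂ) {n : ℕ} (hn : n ≠ 0)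
    (ρ : Representation ℂ G (Fin n → ℂ)) (hρ : ∀ r ∈ R, ρ r = μ r • 1)
    (hmin : ∀ m < n, m ≠ 0 → ¬ ∃ σ : Representation ℂ G (Fin m → ℂ), ∀ r ∈ R, σ r = μ r • 1) :
    ρ.IsIrreducible := by
  have : Nonempty (Fin n) := ⟨⟨0, Nat.pos_of_ne_zero hn⟩⟩
  have : Nontrivial (Subrepresentation ρ) := by
    refine ⟨⊥, ⊤, fun h => ?_⟩
    exact bot_ne_top (congrArg Subrepresentation.toSubmodule h)
  refine ⟨fun N => ?_⟩
  by_contra! h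
  have h1 : N.toSubmodule ≠ ⊥ := fun h1 => h.1 (Subrepresentation.toSubmodule_injective h1)
  have h2 : N.toSubmodule ≠ ⊤ := fun h2 => h.2 (Subrepresentation.toSubmodule_injective h2)
  have h3 := Submodule.finrank_lt h2
  rw [Module.finrank_fin_fun] at h3
  refine hmin _ h3 (fun h4 => h1 (Submodule.finrank_eq_zero.1 h4))
    (exists_fin_representation N.toRepresentation R μ fun r hr => ?_)
  ext v : 2
  change ρ r v = _
  rw [hρ r hr]
  rfl

/-- The functions on `G` that transform by `μ` under left translation by `R`. -/
def equivariantFunctions (R : Subgroup G) (μ : G → ℂ) : Submodule ℂ (G → ℂ) where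
  carrier := {f | ∀ r ∈ R, ∀ g, f (r * g) = μ r * f g}
  zero_mem' := by simp
  add_mem' := fun hf hf' r hr g => by simp [hf r hr g, hf' r hr g, mul_add]
  smul_mem' := fun c f hf r hr g => by simp [hf r hr g, mul_left_comm]

/-- The action of `G` on equivariant functions by right translation. -/
def equivariantRep (R : Subgroup G) (μ : G → ℂ) :
    Representation ℂ G (equivariantFunctions R μ) where
  toFun g :=
    { toFun := fun f => ⟨fun y => f.1 (y * g), fun r hr y => by
        beta_reduce
        rw [mul_assoc]
        exact f.2 r hr (y * g)⟩
      map_add' := fun _ _ => rfl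
      map_smul' := fun _ _ => rfl }
  map_one' := by
    ext f y
    simp
  map_mul' g h := by
    ext f y
    simp [mul_assoc]

/-- A linear character of a subgroup `R` that is invariant under conjugation by `G` occurs in an
irreducible representation of `G` which is scalar on `R`. -/
theorem exists_irreducible [Finite G] (R : Subgroup G) (μ : G → ℂ) (h1 : μ 1 = 1)
    (hmul : ∀ r ∈ R, ∀ s ∈ R, μ (r * s) = μ r * μ s)
    (hconj : ∀ r ∈ R, ∀ g : G, g * r * g⁻¹ ∈ R ∧ μ (g * r * g⁻¹) = μ r) :
    ∃ (n : ℕ) (ρ : Representation ℂ G (Fin n → ℂ)), ρ.IsIrreducible ∧ ∀ r ∈ R, ρ r = μ r • 1 := by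
  classical
  -- The representation induced from `μ`, realized on equivariant functions, shows that some nonzero
  -- dimension occurs; the least such dimension is irreducible.
  have hex : ∃ n, n ≠ 0 ∧ ∃ σ : Representation ℂ G (Fin n → ℂ), ∀ r ∈ (R : Set G), σ r = μ r • 1 := by
    refine ⟨Module.finrank ℂ (equivariantFunctions R μ), ?_,
      exists_fin_representation (equivariantRep R μ) R μ fun r hr => ?_⟩
    · intro h
      have h2 := Submodule.finrank_eq_zero.1 h
      -- Extending `μ` by zero gives a nonzero equivariant function.
      have h3 : (fun g => if g ∈ R then μ g else 0) ∈ equivariantFunctions R μ := by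
        intro r hr g
        by_cases hg : g ∈ R
        · simp [hg, mul_mem hr hg, hmul r hr g hg]
        · simp [hg, (R.mul_mem_cancel_left hr).not.2 hg]
      rw [h2, Submodule.mem_bot] at h3
      have h4 := congrFun h3 1
      simp [one_mem, h1] at h4
    · ext f y
      have h2 := (hconj r hr y).1
      -- Right translation by `r` becomes left translation: `f (y r) = f ((y r y⁻¹) y) = μ r * f y`,
      -- using the invariance of `μ`.
      have h3 := f.2 _ h2 y
      rw [inv_mul_cancel_right, (hconj r hr y).2] at h3
      exact h3
  obtain ⟨hn, ρ, hρ⟩ := Nat.find_spec hex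
  exact ⟨_, ρ, isIrreducible_of_minimal R μ hn ρ hρ fun m hm hm0 h =>
    Nat.find_min hex hm ⟨hm0, h⟩, hρ⟩

/-! ### Induced characters -/

theorem indChar_of_notMem (H : Subgroup G) [H.Normal] (ψ : H →* ℂˣ) {g : G} (hg : g ∉ H) :
    indChar H ψ g = 0 := by
  classical
  have h : ∀ y : G, y⁻¹ * g * y ∉ H := fun y hy => hg (by
    have := Subgroup.Normal.conj_mem ‹H.Normal› _ hy y
    convert this using 1
    group)
  simp [indChar, h]

/-- The sum defining the induced character is `ψ g` times the sum of the multiplicative character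
`κ` over `G`, which is `|G|` or `0`. -/
theorem indChar_of_mem [Finite G] (H : Subgroup G) (ψ : H →* ℂˣ) {g : G} (hg : g ∈ H) (κ : G →* ℂ)
    (hκ : ∀ y, ∃ h : y⁻¹ * g * y ∈ H, (ψ ⟨_, h⟩ : ℂ) = ψ ⟨g, hg⟩ * κ y) :
    (κ = 1 → indChar H ψ g = H.index * ψ ⟨g, hg⟩) ∧ (κ ≠ 1 → indChar H ψ g = 0) := by
  classical
  have := Fintype.ofFinite G
  have e : indChar H ψ g = (Nat.card H : ℂ)⁻¹ * (ψ ⟨g, hg⟩ * ∑ y : G, κ y) := by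
    rw [indChar, finsum_eq_sum_of_fintype]
    congr 1
    rw [Finset.mul_sum]
    refine Finset.sum_congr rfl fun y _ => ?_
    obtain ⟨h, hy⟩ := hκ y
    rw [dif_pos h, hy]
  rw [e]
  constructor
  · rintro rfl
    have h1 : (Nat.card H : ℂ) ≠ 0 := Nat.cast_ne_zero.2 Nat.card_pos.ne'
    have h2 : (Nat.card H : ℂ) * H.index = Fintype.card G := by
      rw [← Nat.card_eq_fintype_card]
      exact_mod_cast H.card_mul_index
    simp only [MonoidHom.one_apply, Finset.sum_const, Finset.card_univ, nsmul_eq_mul, mul_one, ← h2]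
    field_simp
  · intro h
    rw [sum_hom_units_eq_zero κ h, mul_zero, mul_zero]

end Representations


/-! ### Additive characters of finite fields -/

section AdditiveCharacters

variable (p : ℕ) [Fact p.Prime] {F : Type*} [Field F] [Algebra (ZMod p) F]

variable (F) in
/-- The additive character `φ`. -/
noncomputable def phiChar : AddChar F ℂ :=
  (ZMod.stdAddChar (N := p)).compAddMonoidHom (Algebra.trace (ZMod p) F).toAddMonoidHom

theorem phi_add (s t : F) : phi p (s + t) = phi p s * phi p t :=
  (phiChar p F).map_add_eq_mul s t

@[simp] theorem phi_zero : phi p (0 : F) = 1 :=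
  (phiChar p F).map_zero_eq_one

theorem phi_ne_zero (t : F) : phi p t ≠ 0 := by
  intro h
  have := phi_add p t (-t)
  rw [h, zero_mul, add_neg_cancel, phi_zero] at this
  exact one_ne_zero this

variable [Finite F]

/-- Over a field a nontrivial additive character is primitive, and nontriviality is the
nondegeneracy of the trace. -/
theorem phiChar_isPrimitive : (phiChar p F).IsPrimitive := by
  refine AddChar.IsPrimitive.of_ne_one fun h => ?_
  have : CharP F p := charP_of_injective_algebraMap (algebraMap (ZMod p) F).injective p
  obtain rfl := ringChar.eq F p
  obtain ⟨b, hb⟩ := FiniteField.trace_to_zmod_nondegenerate F (a := 1) one_ne_zero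
  rw [one_mul] at hb
  refine hb (ZMod.injective_stdAddChar ?_)
  rw [AddChar.map_zero_eq_one]
  exact DFunLike.congr_fun h b

theorem eq_zero_of_phi_mul {a : F} (h : ∀ t, phi p (a * t) = 1) : a = 0 := by
  by_contra ha
  exact phiChar_isPrimitive p ha (AddChar.ext _ _ h)

theorem eq_of_phi_mul {a b : F} (h : ∀ t, phi p (a * t) = phi p (b * t)) : a = b := by
  refine sub_eq_zero.1 (eq_zero_of_phi_mul p fun t => ?_)
  have h1 := phi_add p ((a - b) * t) (b * t)
  rw [sub_mul, sub_add_cancel, h] at h1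
  rw [sub_mul]
  exact mul_right_cancel₀ (phi_ne_zero p _) (h1.symm.trans (one_mul _).symm)

/-- Self-duality of `F` by counting: `b ↦ φ (b ·)` is injective, and there are as many additive
characters as elements. -/
theorem exists_eq_phi_mul (f : F → ℂ) (h0 : f 0 = 1) (hadd : ∀ s t, f (s + t) = f s * f t) :
    ∃ b : F, ∀ t, f t = phi p (b * t) := by
  have := Fintype.ofFinite F
  have hinj := AddChar.to_mulShift_inj_of_isPrimitive (phiChar_isPrimitive p (F := F))
  have hbij := (Fintype.bijective_iff_injective_and_card _).2
    ⟨hinj, (AddChar.card_eq (α := F)).symm⟩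
  obtain ⟨b, hb⟩ := hbij.2 ⟨f, h0, hadd⟩
  exact ⟨b, fun t => (DFunLike.congr_fun hb t).symm⟩

end AdditiveCharacters


/-! ### Characters of the model with a given central character -/

section CentralCharacter

variable {F : Type*} [Field F]

/-- The linear form on `F ^ 6` with coefficients `c`. -/
def lin (c z : Fin 6 → F) : F := ∑ k, c k * z k

theorem lin_add (c z z' : Fin 6 → F) : lin c (z + z') = lin c z + lin c z' := by
  simp [lin, mul_add, Finset.sum_add_distrib]

theorem lin_sub (c z z' : Fin 6 → F) : lin c (z - z') = lin c z - lin c z' := by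
  simp [lin, mul_sub]

@[simp] theorem lin_zero (c : Fin 6 → F) : lin c 0 = 0 := by
  simp [lin]

theorem lin_single (c : Fin 6 → F) (k : Fin 6) (t : F) : lin c (Pi.single k t) = c k * t := by
  simp [lin, Pi.single_apply]

/-- The alternating form on `F ^ 10` given by commutators and the linear form with coefficients
`c`. -/
def altForm (c : Fin 6 → F) (v w : Fin 10 → F) : F := lin c (coc v w) - lin c (coc w v)

theorem altForm_add_left (c : Fin 6 → F) (v v' w : Fin 10 → F) :
    altForm c (v + v') w = altForm c v w + altForm c v' w := by
  simp only [altForm, coc_add_left, coc_add_right, lin_add]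
  ring

theorem altForm_add_right (c : Fin 6 → F) (v w w' : Fin 10 → F) :
    altForm c v (w + w') = altForm c v w + altForm c v w' := by
  simp only [altForm, coc_add_left, coc_add_right, lin_add]
  ring

theorem altForm_swap (c : Fin 6 → F) (v w : Fin 10 → F) : altForm c w v = -altForm c v w := by
  simp [altForm]

theorem altForm_eq (c : Fin 6 → F) (v w : Fin 10 → F) : altForm c v w =
    c 0 * (v 3 * w 1 - v 4 * w 0 - w 3 * v 1 + w 4 * v 0) +
    c 1 * (v 5 * w 2 - v 6 * w 1 - w 5 * v 2 + w 6 * v 1) +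
    c 2 * (w 5 * v 3 - v 5 * w 3) +
    c 3 * (w 9 * v 0 + w 8 * v 3 - v 9 * w 0 - v 8 * w 3) +
    c 4 * (v 8 * w 4 + v 7 * w 5 - v 9 * w 1 - w 8 * v 4 - w 7 * v 5 + w 9 * v 1) +
    c 5 * (v 9 * w 2 + v 7 * w 6 - w 9 * v 2 - w 7 * v 6) := by
  simp [altForm, lin, coc, Fin.sum_univ_succ]
  ring

theorem altForm_smul_right (c : Fin 6 → F) (v w : Fin 10 → F) (t : F) :
    altForm c v (t • w) = altForm c v w * t := by
  simp only [altForm_eq, Pi.smul_apply, smul_eq_mul]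
  ring

/-- The elements of the model that are central modulo the kernel of a central character with
coefficients `c`. -/
def radGroup (c : Fin 6 → F) : Subgroup (Core F) where
  carrier := {g | ∀ w, altForm c g.v w = 0}
  one_mem' w := by simp [altForm]
  mul_mem' hg hh w := by simp [altForm_add_left, hg w, hh w]
  inv_mem' {g} hg w := by
    have h := altForm_add_left c g.v (-g.v) w
    rw [add_neg_cancel, hg w, zero_add] at h
    rw [Core.inv_v, ← h]
    simp [altForm]

theorem mem_radGroup {c : Fin 6 → F} {g : Core F} :
    g ∈ radGroup c ↔ ∀ w, altForm c g.v w = 0 := Iff.rfl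

theorem Core.mul_comm_eq (g h : Core F) :
    g * h = ⟨0, coc g.v h.v - coc h.v g.v⟩ * (h * g) := by
  ext1
  · simp [add_comm]
  · simp only [Core.mul_z, coc_zero_left]
    abel

theorem Core.conj_eq (g h : Core F) : h * g * h⁻¹ = ⟨0, coc h.v g.v - coc g.v h.v⟩ * g := by
  rw [Core.mul_comm_eq h g, mul_assoc, mul_assoc, mul_inv_cancel, mul_one]

variable (p : ℕ) [Fact p.Prime] [Algebra (ZMod p) F] {G : Type*} [Group G] (e : Core F ≃* G)

section

variable {V : Type*} [AddCommGroup V] [Module ℂ V] (ρ : Representation ℂ G V) {c : Fin 6 → F}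

theorem rep_mul_rep (hc : ∀ z, ρ (e ⟨0, z⟩) = phi p (lin c z) • 1) (g h : Core F) :
    ρ (e g) * ρ (e h) = phi p (altForm c g.v h.v) • (ρ (e h) * ρ (e g)) := by
  rw [← map_mul, ← map_mul, Core.mul_comm_eq, map_mul, map_mul, hc, smul_mul_assoc, one_mul, lin_sub,
    ← map_mul, ← map_mul, altForm]

/-- If some `w` pairs nontrivially with `g.v`, a multiple `t • w` gives an element whose commutator
with `g` acts by a scalar other than `1`. -/
theorem character_eq_zero_of_notMem [Finite F] (hc : ∀ z, ρ (e ⟨0, z⟩) = phi p (lin c z) • 1)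
    {g : Core F} (hg : g ∉ radGroup c) : ρ.character (e g) = 0 := by
  rw [mem_radGroup] at hg
  push Not at hg
  obtain ⟨w, hw⟩ := hg
  have : ∃ t, phi p (altForm c g.v w * t) ≠ 1 := by
    by_contra! h
    exact hw (eq_zero_of_phi_mul p h)
  obtain ⟨t, ht⟩ := this
  rw [← altForm_smul_right] at ht
  exact character_eq_zero_of_mul ρ ht (rep_mul_rep p e ρ hc g ⟨t • w, 0⟩)

variable [FiniteDimensional ℂ V] [ρ.IsIrreducible]

/-- Commutators with elements of `radGroup c` act trivially, so Schur's lemma applies to these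
elements. -/
theorem exists_smul_of_mem_radGroup (hc : ∀ z, ρ (e ⟨0, z⟩) = phi p (lin c z) • 1) :
    ∃ μ : Core F → ℂ, ∀ g ∈ radGroup c, ρ (e g) = μ g • 1 := by
  have : ∀ g : Core F, ∃ m : ℂ, g ∈ radGroup c → ρ (e g) = m • 1 := by
    intro g
    by_cases hg : g ∈ radGroup c
    · obtain ⟨m, hm⟩ := exists_eq_smul_of_commute ρ (ρ (e g)) fun h => by
        obtain ⟨h, rfl⟩ := e.surjective h
        rw [rep_mul_rep p e ρ hc g h, hg, phi_zero, one_smul]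
      exact ⟨m, fun _ => hm⟩
    · exact ⟨0, fun h => (hg h).elim⟩
  choose μ hμ using this
  exact ⟨μ, hμ⟩

theorem sq_finrank_mul_card_radGroup [Fintype F]
    (hc : ∀ z, ρ (e ⟨0, z⟩) = phi p (lin c z) • 1) :
    Module.finrank ℂ V ^ 2 * Nat.card (radGroup c) = Fintype.card F ^ 16 := by
  have : Finite G := .of_equiv _ e.toEquiv
  obtain ⟨μ, hμ⟩ := exists_smul_of_mem_radGroup p e ρ hc
  have h := sq_finrank_mul_card ρ ((radGroup c).map e.toMonoidHom) (μ ∘ e.symm)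
    (by
      rintro _ ⟨g, hg, rfl⟩
      simpa using hμ g hg)
    (by
      intro g hg
      obtain ⟨g, rfl⟩ := e.surjective g
      exact character_eq_zero_of_notMem p e ρ hc fun h => hg ⟨g, h, rfl⟩)
  have hcard : Nat.card ((radGroup c).map e.toMonoidHom) = Nat.card (radGroup c) :=
    (Nat.card_congr (e.subgroupMap (radGroup c)).toEquiv).symm
  rwa [hcard, ← Nat.card_congr e.toEquiv, Core.card_eq] at h

/-- The centre of the model acts on an irreducible representation through a character. -/
theorem exists_central_label [Finite F] :
    ∃ c : Fin 6 → F, ∀ z, ρ (e ⟨0, z⟩) = phi p (lin c z) • 1 := by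
  have hcomm : ∀ (z : Fin 6 → F) (g : Core F), (⟨0, z⟩ : Core F) * g = g * ⟨0, z⟩ := by
    intro z g
    ext1 <;> simp [add_comm]
  have hsc : ∀ z : Fin 6 → F, ∃ m : ℂ, ρ (e ⟨0, z⟩) = m • 1 := fun z =>
    exists_eq_smul_of_commute ρ _ fun h => by
      obtain ⟨h, rfl⟩ := e.surjective h
      rw [← map_mul, ← map_mul, hcomm, map_mul, map_mul]
  choose m hm using hsc
  have hV : Nontrivial V := nontrivial_of_isIrreducible ρ
  have hinj : ∀ c d : ℂ, (c • 1 : V →ₗ[ℂ] V) = d • 1 → c = d := fun c d h =>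
    smul_left_injective ℂ (one_ne_zero (α := Module.End ℂ V)) h
  have hadd : ∀ z z', m (z + z') = m z * m z' := by
    intro z z'
    apply hinj
    rw [← hm, mul_smul, ← hm]
    have : (⟨0, z + z'⟩ : Core F) = ⟨0, z⟩ * ⟨0, z'⟩ := by ext1 <;> simp
    rw [this, map_mul, map_mul, hm z, smul_mul_assoc, one_mul]
  have h0 : m 0 = 1 := by
    apply hinj
    rw [← hm, one_smul]
    exact (congrArg ρ (map_one e)).trans (map_one ρ)
  have hk : ∀ k, ∃ b : F, ∀ t, m (Pi.single k t) = phi p (b * t) := fun k =>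
    exists_eq_phi_mul p (fun t => m (Pi.single k t)) (by simp [h0]) fun s t => by
      rw [Pi.single_add, hadd]
  choose c hc using hk
  refine ⟨c, fun z => ?_⟩
  rw [hm]
  congr 1
  have key : ∀ s : Finset (Fin 6), m (∑ k ∈ s, Pi.single k (z k)) = phi p (∑ k ∈ s, c k * z k) := by
    intro s
    induction s using Finset.induction_on with
    | empty => simp [h0]
    | insert k s hks ih => rw [Finset.sum_insert hks, Finset.sum_insert hks, hadd, ih, hc, phi_add]
  rw [lin, ← key, Finset.univ_sum_single]

end

/-- Conjugating an element of `radGroup c` multiplies it by a central element killed by `lin c`, so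
`μ` is invariant and `exists_irreducible` applies. -/
theorem exists_irreducible_of_radGroup [Finite F] {c : Fin 6 → F} (μ : Core F → ℂ)
    (hz : ∀ z, μ ⟨0, z⟩ = phi p (lin c z))
    (hmul : ∀ g ∈ radGroup c, ∀ h ∈ radGroup c, μ (g * h) = μ g * μ h) :
    ∃ (n : ℕ) (ρ : Representation ℂ G (Fin n → ℂ)), ρ.IsIrreducible ∧
      ∀ g ∈ radGroup c, ρ (e g) = μ g • 1 := by
  have : Finite G := .of_equiv _ e.toEquiv
  obtain ⟨n, ρ, h1, h2⟩ := exists_irreducible ((radGroup c).map e.toMonoidHom) (μ ∘ e.symm)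
    (by
      rw [Function.comp_apply, map_one]
      exact (hz 0).trans (by simp))
    (by
      rintro _ ⟨g, hg, rfl⟩ _ ⟨h, hh, rfl⟩
      simpa using hmul g hg h hh)
    (by
      rintro _ ⟨g, hg, rfl⟩ h
      obtain ⟨h, rfl⟩ := e.surjective h
      have hg' := mem_radGroup.1 hg
      have hcz : (⟨0, coc h.v g.v - coc g.v h.v⟩ : Core F) ∈ radGroup c := fun w => by
        simp [altForm]
      have e1 : e h * e.toMonoidHom g * (e h)⁻¹ = e (⟨0, coc h.v g.v - coc g.v h.v⟩ * g) := by
        rw [← Core.conj_eq, map_mul, map_mul, map_inv]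
        rfl
      rw [e1]
      refine ⟨⟨_, mul_mem hcz hg, rfl⟩, ?_⟩
      have h3 : lin c (coc h.v g.v - coc g.v h.v) = 0 := by
        rw [lin_sub]
        have := altForm_swap c g.v h.v
        rw [hg', neg_zero] at this
        exact this
      simp [hmul _ hcz _ hg, hz, h3])
  exact ⟨n, ρ, h1, fun g hg => by simpa using h2 (e g) ⟨g, hg, rfl⟩⟩

end CentralCharacter


/-! ### The radical of the commutator form -/

section Radical

variable {F : Type*} [Field F] {c : Fin 6 → F} {v : Fin 10 → F}

/-- The form is tested against the ten basis vectors. The unknowns `v 3, v 4, v 5, v 6, v 9` occur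
alone in five equations; the other five involve the remaining unknowns, coupled to the first block
only through `c 2`. -/
theorem radical_equations (h : ∀ w, altForm c v w = 0) :
    (c 0 * v 4 + c 3 * v 9 = 0 ∧ c 0 * v 3 - c 1 * v 6 - c 4 * v 9 = 0 ∧
      c 1 * v 5 + c 5 * v 9 = 0 ∧ c 0 * v 1 + c 2 * v 5 + c 3 * v 8 = 0 ∧
      c 0 * v 0 + c 4 * v 8 = 0) ∧
    (-(c 1 * v 2) + c 2 * v 3 + c 4 * v 7 = 0 ∧ c 1 * v 1 + c 5 * v 7 = 0 ∧
      c 4 * v 5 + c 5 * v 6 = 0 ∧ c 3 * v 3 - c 4 * v 4 = 0 ∧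
      c 3 * v 0 + c 4 * v 1 - c 5 * v 2 = 0) := by
  have k0 := h (Pi.single 0 1)
  have k1 := h (Pi.single 1 1)
  have k2 := h (Pi.single 2 1)
  have k3 := h (Pi.single 3 1)
  have k4 := h (Pi.single 4 1)
  have k5 := h (Pi.single 5 1)
  have k6 := h (Pi.single 6 1)
  have k7 := h (Pi.single 7 1)
  have k8 := h (Pi.single 8 1)
  have k9 := h (Pi.single 9 1)
  simp [altForm_eq] at k0 k1 k2 k3 k4 k5 k6 k7 k8 k9
  refine ⟨⟨?_, ?_, ?_, ?_, ?_⟩, ?_, ?_, ?_, ?_, ?_⟩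
  · linear_combination -k0
  · linear_combination k1
  · linear_combination k2
  · linear_combination -k3
  · linear_combination k4
  · linear_combination k5
  · linear_combination k6
  · linear_combination -k7
  · linear_combination k8
  · linear_combination k9

theorem radical_eq_zero (h3 : (3 : F) ≠ 0) (hc : ∀ k, c k ≠ 0) (h : ∀ w, altForm c v w = 0) :
    v = 0 := by
  obtain ⟨⟨e0, e1, e2, e3, e4⟩, e5, e6, e7, e8, e9⟩ := radical_equations h
  have cancel : ∀ k (y : F), c k * y = 0 → y = 0 := fun k y hy =>
    (mul_eq_zero.1 hy).resolve_left (hc k)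
  have cancel3 : ∀ y : F, 3 * y = 0 → y = 0 := fun y hy => (mul_eq_zero.1 hy).resolve_left h3
  -- Expressing `v 3, v 4, v 5, v 6` through `v 9` turns `e1` into `-3 * c 4 * v 9 = 0`. Once `v 3`
  -- and `v 5` vanish, `e9` likewise becomes `3 * c 4 * v 1 = 0`, up to nonzero factors.
  have v9 : v 9 = 0 := cancel 3 _ (cancel 4 _ (cancel 5 _ (cancel3 _ (by
    linear_combination -c 3 * c 5 * e1 + c 0 * c 5 * e8 + c 4 * c 5 * e0 - c 1 * c 3 * e7 +
      c 3 * c 4 * e2))))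
  have v4 : v 4 = 0 := cancel 0 _ (by linear_combination e0 - c 3 * v9)
  have v5 : v 5 = 0 := cancel 1 _ (by linear_combination e2 - c 5 * v9)
  have v6 : v 6 = 0 := cancel 5 _ (by linear_combination e7 - c 4 * v5)
  have v3 : v 3 = 0 := cancel 3 _ (by linear_combination e8 + c 4 * v4)
  have v1 : v 1 = 0 := cancel 0 _ (cancel 1 _ (cancel 4 _ (cancel3 _ (by
    linear_combination c 0 * c 1 * e9 - c 1 * c 3 * e4 + c 1 * c 4 * e3 - c 0 * c 5 * e5 +
      c 0 * c 4 * e6 - c 1 * c 2 * c 4 * v5 + c 0 * c 2 * c 5 * v3))))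
  have v7 : v 7 = 0 := cancel 5 _ (by linear_combination e6 - c 1 * v1)
  have v8 : v 8 = 0 := cancel 3 _ (by linear_combination e3 - c 0 * v1 - c 2 * v5)
  have v0 : v 0 = 0 := cancel 0 _ (by linear_combination e4 - c 4 * v8)
  have v2 : v 2 = 0 := cancel 1 _ (by linear_combination -e5 + c 2 * v3 + c 4 * v7)
  funext i
  fin_cases i <;> assumption

/-- The vectors of the radical in characteristic `3`. -/
def radVec (c : Fin 6 → F) (t s : F) : Fin 10 → F :=
  ![c 2 * c 4 * c 5 * t, c 2 * c 5 * s, c 2 * c 3 * c 4 * t + c 2 * c 4 * s,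
    c 1 * c 3 * c 4 * t - c 1 * c 4 * s, c 1 * c 3 ^ 2 * t - c 1 * c 3 * s,
    c 0 * c 3 * c 5 * t - c 0 * c 5 * s, c 0 * c 4 * s - c 0 * c 3 * c 4 * t, -(c 1 * c 2 * s),
    -(c 0 * c 2 * c 5 * t), c 0 * c 1 * s - c 0 * c 1 * c 3 * t]

theorem altForm_radVec (h3 : (3 : F) = 0) (t s : F) (w : Fin 10 → F) :
    altForm c (radVec c t s) w = 0 := by
  simp only [altForm_eq, radVec]
  simp
  linear_combination (w 1 * (c 0 * c 1 * c 3 * c 4 * t - c 0 * c 1 * c 4 * s) -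
    w 5 * c 1 * c 2 * c 4 * s) * h3

/-- The coordinates `v 0` and `v 1` are free, and eight equations give the others in turn; `e1` and
`e9` impose nothing further in characteristic `3`, as `altForm_radVec` confirms. The parameters are
scaled to match the diagonal elements of the label subgroup. -/
theorem exists_eq_radVec (h3 : (3 : F) = 0) (hc : ∀ k, c k ≠ 0) (h : ∀ w, altForm c v w = 0) :
    ∃ t s, v = radVec c t s := by
  obtain ⟨⟨e0, e1, e2, e3, e4⟩, e5, e6, e7, e8, e9⟩ := radical_equations h
  have cancel : ∀ k (y z : F), c k * y = c k * z → y = z := fun k y z hy =>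
    mul_left_cancel₀ (hc k) hy
  have h0 := hc 0
  have h2 := hc 2
  have h4 := hc 4
  have h5 := hc 5
  obtain ⟨t, v0⟩ : ∃ t, v 0 = c 2 * c 4 * c 5 * t := ⟨v 0 / (c 2 * c 4 * c 5), by field_simp⟩
  obtain ⟨s, v1⟩ : ∃ s, v 1 = c 2 * c 5 * s := ⟨v 1 / (c 2 * c 5), by field_simp⟩
  have v8 : v 8 = -(c 0 * c 2 * c 5 * t) := cancel 4 _ _ (by linear_combination e4 - c 0 * v0)
  have v5 : v 5 = c 0 * c 3 * c 5 * t - c 0 * c 5 * s :=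
    cancel 2 _ _ (by linear_combination e3 - c 0 * v1 - c 3 * v8)
  have v9 : v 9 = c 0 * c 1 * s - c 0 * c 1 * c 3 * t :=
    cancel 5 _ _ (by linear_combination e2 - c 1 * v5)
  have v4 : v 4 = c 1 * c 3 ^ 2 * t - c 1 * c 3 * s :=
    cancel 0 _ _ (by linear_combination e0 - c 3 * v9)
  have v3 : v 3 = c 1 * c 3 * c 4 * t - c 1 * c 4 * s :=
    cancel 3 _ _ (by linear_combination e8 + c 4 * v4)
  have v6 : v 6 = c 0 * c 4 * s - c 0 * c 3 * c 4 * t :=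
    cancel 5 _ _ (by linear_combination e7 - c 4 * v5)
  have v7 : v 7 = -(c 1 * c 2 * s) := cancel 5 _ _ (by linear_combination e6 - c 1 * v1)
  -- The system yields the coefficient `-2` at `s`, which is `1` modulo `3`.
  have v2 : v 2 = c 2 * c 3 * c 4 * t + c 2 * c 4 * s :=
    cancel 1 _ _ (by linear_combination -e5 + c 2 * v3 + c 4 * v7 - c 1 * c 2 * c 4 * s * h3)
  refine ⟨t, s, ?_⟩
  funext i
  fin_cases i <;> simpa [radVec]

theorem mem_radGroup_iff_of_three_ne_zero (h3 : (3 : F) ≠ 0) (hc : ∀ k, c k ≠ 0) {g : Core F} :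
    g ∈ radGroup c ↔ g.v = 0 :=
  ⟨fun h => radical_eq_zero h3 hc h, fun h w => by simp [h, altForm]⟩

theorem mem_radGroup_iff_of_three_eq_zero (h3 : (3 : F) = 0) (hc : ∀ k, c k ≠ 0) {g : Core F} :
    g ∈ radGroup c ↔ ∃ t s, g.v = radVec c t s :=
  ⟨fun h => exists_eq_radVec h3 hc h, fun ⟨t, s, h⟩ w => by rw [h, altForm_radVec h3]⟩

theorem radVec_injective (hc : ∀ k, c k ≠ 0) {t s t' s' : F} (h : radVec c t s = radVec c t' s') :
    t = t' ∧ s = s' := by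
  have h0 := congrFun h 0
  have h1 := congrFun h 1
  simpa [radVec, hc] using And.intro h0 h1

theorem radVec_add (t s t' s' : F) :
    radVec c (t + t') (s + s') = radVec c t s + radVec c t' s' := by
  funext i
  fin_cases i <;> simp [radVec] <;> ring

theorem card_radGroup_of_three_ne_zero [Fintype F] (h3 : (3 : F) ≠ 0) (hc : ∀ k, c k ≠ 0) :
    Nat.card (radGroup c) = Fintype.card F ^ 6 := by
  have e : (Fin 6 → F) ≃ radGroup c := Equiv.ofBijective
    (fun z => ⟨⟨0, z⟩, (mem_radGroup_iff_of_three_ne_zero h3 hc).2 rfl⟩)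
    ⟨fun z z' h => congrArg (fun g => g.1.z) h, fun ⟨g, hg⟩ => ⟨g.z, Subtype.ext (Core.ext
      ((mem_radGroup_iff_of_three_ne_zero h3 hc).1 hg).symm rfl)⟩⟩
  rw [← Nat.card_congr e]
  simp

theorem card_radGroup_of_three_eq_zero [Fintype F] (h3 : (3 : F) = 0) (hc : ∀ k, c k ≠ 0) :
    Nat.card (radGroup c) = Fintype.card F ^ 8 := by
  have e : (F × F) × (Fin 6 → F) ≃ radGroup c := Equiv.ofBijective
    (fun y => ⟨⟨radVec c y.1.1 y.1.2, y.2⟩,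
      (mem_radGroup_iff_of_three_eq_zero h3 hc).2 ⟨_, _, rfl⟩⟩)
    ⟨fun y y' h => by
      have h1 := radVec_injective hc (congrArg (fun g => g.1.v) h)
      exact Prod.ext (Prod.ext h1.1 h1.2) (congrArg (fun g => g.1.z) h),
    fun ⟨g, hg⟩ => by
      obtain ⟨t, s, h⟩ := (mem_radGroup_iff_of_three_eq_zero h3 hc).1 hg
      exact ⟨((t, s), g.z), Subtype.ext (Core.ext h.symm rfl)⟩⟩
  rw [← Nat.card_congr e]
  simp
  ring

end Radical


/-! ### A maximal isotropic subgroup in characteristic `3` -/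

section Isotropic

variable {F : Type*} [Field F] (c : Fin 6 → F)

/-- The coordinate `t` of `x_{1,6,7,14}(t)`. -/
def tCoord (v : Fin 10 → F) : F := v 0 / (c 2 * c 4 * c 5)

/-- The coordinate `s` of `x_{4,6,7,13}(s)`. -/
def sCoord (v : Fin 10 → F) : F := v 1 / (c 2 * c 5)

theorem tCoord_add (v w : Fin 10 → F) : tCoord c (v + w) = tCoord c v + tCoord c w := by
  simp [tCoord, add_div]

theorem sCoord_add (v w : Fin 10 → F) : sCoord c (v + w) = sCoord c v + sCoord c w := by
  simp [sCoord, add_div]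

/-- The vectors in the span of the directions of `x_{1,6,7,14}`, `x_{4,6,7,13}` and of the root
subgroups `X₉`, `X₁₀`, `X₁₁`, `X₁₉`. -/
def isoVec (t s : F) (j : Fin 4 → F) : Fin 10 → F :=
  ![c 2 * c 4 * c 5 * t, c 2 * c 5 * s, c 2 * c 3 * c 4 * t + c 2 * c 4 * s,
    c 1 * c 3 * c 4 * t + 2 * c 1 * c 4 * s, j 0, j 1, j 2, -(c 1 * c 2 * s),
    -(c 0 * c 2 * c 5 * t), j 3]

theorem isoVec_add (t s t' s' : F) (j j' : Fin 4 → F) :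
    isoVec c t s j + isoVec c t' s' j' = isoVec c (t + t') (s + s') (j + j') := by
  funext i
  fin_cases i <;> simp [isoVec] <;> ring

/-- The subgroup of the model corresponding to the subgroup `X' X_J X_Z`. -/
def isoGroup : Subgroup (Core F) where
  carrier := {g | ∃ t s j, g.v = isoVec c t s j}
  one_mem' := ⟨0, 0, 0, by
    funext i
    fin_cases i <;> simp [isoVec]⟩
  mul_mem' := by
    rintro g h ⟨t, s, j, hg⟩ ⟨t', s', j', hh⟩
    exact ⟨_, _, _, by rw [Core.mul_v, hg, hh, isoVec_add]⟩
  inv_mem' := by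
    rintro g ⟨t, s, j, hg⟩
    refine ⟨-t, -s, -j, ?_⟩
    rw [Core.inv_v, hg]
    funext i
    fin_cases i <;> simp [isoVec] <;> ring

theorem mem_isoGroup {g : Core F} : g ∈ isoGroup c ↔ ∃ t s j, g.v = isoVec c t s j := Iff.rfl

/-- The subspace of the vectors `isoVec` is isotropic: the alternating form takes on it a value
divisible by `3`. -/
theorem lin_coc_comm (h3 : (3 : F) = 0) {g h : Core F} (hg : g ∈ isoGroup c) (hh : h ∈ isoGroup c) :
    lin c (coc h.v g.v) = lin c (coc g.v h.v) := by
  obtain ⟨t, s, j, hg⟩ := hg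
  obtain ⟨t', s', j', hh⟩ := hh
  rw [hg, hh]
  have h : altForm c (isoVec c t s j) (isoVec c t' s' j') = 0 := by
    simp only [altForm_eq, isoVec]
    simp
    linear_combination (c 0 * c 1 * c 2 * c 3 * c 4 * c 5 * (t * s' - s * t')) * h3
  exact (sub_eq_zero.1 h).symm

variable {c}

theorem tCoord_isoVec (hc : ∀ k, c k ≠ 0) (t s : F) (j : Fin 4 → F) :
    tCoord c (isoVec c t s j) = t := by
  have h2 := hc 2
  have h4 := hc 4
  have h5 := hc 5
  simp [tCoord, isoVec]
  field_simp

theorem sCoord_isoVec (hc : ∀ k, c k ≠ 0) (t s : F) (j : Fin 4 → F) :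
    sCoord c (isoVec c t s j) = s := by
  have h2 := hc 2
  have h5 := hc 5
  simp [sCoord, isoVec]
  field_simp

theorem radVec_eq_isoVec (h3 : (3 : F) = 0) (t s : F) :
    radVec c t s = isoVec c t s ![c 1 * c 3 ^ 2 * t - c 1 * c 3 * s,
      c 0 * c 3 * c 5 * t - c 0 * c 5 * s, c 0 * c 4 * s - c 0 * c 3 * c 4 * t,
      c 0 * c 1 * s - c 0 * c 1 * c 3 * t] := by
  funext i
  fin_cases i <;> simp [radVec, isoVec]
  linear_combination -c 1 * c 4 * s * h3

theorem radGroup_le_isoGroup (h3 : (3 : F) = 0) (hc : ∀ k, c k ≠ 0) :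
    radGroup c ≤ isoGroup c := by
  intro g hg
  obtain ⟨t, s, h⟩ := (mem_radGroup_iff_of_three_eq_zero h3 hc).1 hg
  exact ⟨t, s, _, h.trans (radVec_eq_isoVec h3 t s)⟩

theorem card_isoGroup [Fintype F] (hc : ∀ k, c k ≠ 0) :
    Nat.card (isoGroup c) = Fintype.card F ^ 12 := by
  have e : ((F × F) × (Fin 4 → F)) × (Fin 6 → F) ≃ isoGroup c := Equiv.ofBijective
    (fun y => ⟨⟨isoVec c y.1.1.1 y.1.1.2 y.1.2, y.2⟩, ⟨_, _, _, rfl⟩⟩)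
    ⟨fun y y' h => by
      have h1 : isoVec c y.1.1.1 y.1.1.2 y.1.2 = isoVec c y'.1.1.1 y'.1.1.2 y'.1.2 :=
        congrArg (fun g => g.1.v) h
      have h2 := congrArg (tCoord c) h1
      have h3 := congrArg (sCoord c) h1
      rw [tCoord_isoVec hc, tCoord_isoVec hc] at h2
      rw [sCoord_isoVec hc, sCoord_isoVec hc] at h3
      refine Prod.ext (Prod.ext (Prod.ext h2 h3) ?_) (congrArg (fun g => g.1.z) h)
      funext i
      fin_cases i
      · exact congrFun h1 4
      · exact congrFun h1 5
      · exact congrFun h1 6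
      · exact congrFun h1 9,
    fun ⟨g, t, s, j, h⟩ => ⟨(((t, s), j), g.z), Subtype.ext (Core.ext h.symm rfl)⟩⟩
  rw [← Nat.card_congr e]
  simp
  ring

/-! ### The linear characters of the isotropic subgroup -/

variable (p : ℕ) [Fact p.Prime] [Algebra (ZMod p) F]

variable (c) in
/-- The linear character of `isoGroup c` with label `(c, b)`. -/
noncomputable def labelFun (b : F × F) (g : Core F) : ℂ :=
  phi p (b.1 * tCoord c g.v + b.2 * sCoord c g.v + lin c g.z + lin c (coc g.v g.v))

/-- For a symmetric bilinear `B`, the cocycle `B v w` is compensated by the quadratic term `-(1/2) B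
v v`. In characteristic `3` this is `B v v`, which accounts for the last summand of `labelFun`. -/
theorem labelFun_mul (h3 : (3 : F) = 0) (b : F × F) {g h : Core F} (hg : g ∈ isoGroup c)
    (hh : h ∈ isoGroup c) : labelFun c p b (g * h) = labelFun c p b g * labelFun c p b h := by
  rw [labelFun, labelFun, labelFun, ← phi_add]
  congr 1
  simp only [Core.mul_v, Core.mul_z, tCoord_add, sCoord_add, lin_add, coc_add_left, coc_add_right,
    lin_coc_comm c h3 hg hh]
  linear_combination lin c (coc g.v h.v) * h3

theorem labelFun_z (b : F × F) (z : Fin 6 → F) : labelFun c p b ⟨0, z⟩ = phi p (lin c z) := by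
  simp [labelFun, tCoord, sCoord]

theorem labelFun_ne_zero (b : F × F) (g : Core F) : labelFun c p b g ≠ 0 := phi_ne_zero p _

/-- Separates the dependence on `b`, so that labels can be compared with the base point `b = 0`. -/
theorem labelFun_isoVec (hc : ∀ k, c k ≠ 0) (b : F × F) (t s : F) (j : Fin 4 → F)
    (z : Fin 6 → F) : labelFun c p b ⟨isoVec c t s j, z⟩ =
      phi p (b.1 * t) * phi p (b.2 * s) * labelFun c p 0 ⟨isoVec c t s j, z⟩ := by
  simp only [labelFun, tCoord_isoVec hc, sCoord_isoVec hc, ← phi_add]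
  congr 1
  simp
  ring

end Isotropic

/-! ### The label subgroup -/

section LabelSubgroup

variable {F : Type*} [Field F] {P K : Set Lat} [(XIn F P K).Normal]

/-- The element of the model corresponding to `x_{1,6,7,14}(t)`. -/
def modelX1 (c : Fin 6 → F) (t : F) : Core F :=
  ⟨isoVec c t 0 0, Pi.single 3 (c 0 * c 1 * c 2 * c 3 * c 4 * c 5 * t ^ 2 / 2)⟩

/-- The element of the model corresponding to `x_{4,6,7,13}(t)`. -/
def modelX2 (c : Fin 6 → F) (t : F) : Core F :=
  ⟨isoVec c 0 t 0, Pi.single 0 (c 1 * c 2 * c 4 * c 5 * t ^ 2)⟩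

/-- The factors come in the order of `nIdx`, and `coc` involves only descending pairs, so the
product is already collected and no central correction arises. The same applies to `modelX2`. -/
theorem coreEquiv_modelX1 (hK : IsNormalPattern K P) (hS : P \ K = ↑coreS) (a : Fin 6 → Fˣ) (t : F) :
    coreEquiv hK hS (modelX1 (fun k => (a k : F)) t) = x1' P K a t := by
  unfold x1'
  have h1 := coreEquiv_single_v (F := F) hK hS 0
  have h6 := coreEquiv_single_v (F := F) hK hS 2
  have h7 := coreEquiv_single_v (F := F) hK hS 3
  have h14 := coreEquiv_single_v (F := F) hK hS 8
  have h22 := coreEquiv_single_z (F := F) hK hS 3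
  simp only [nIdx, zIdx, Matrix.cons_val] at h1 h6 h7 h14 h22
  simp only [← h1, ← h6, ← h7, ← h14, ← h22, ← map_mul]
  congr 1
  ext i
  · fin_cases i <;> simp [modelX1, isoVec]
  · fin_cases i <;> simp [modelX1, coc, Matrix.vecHead, Matrix.vecTail]

theorem coreEquiv_modelX2 (hK : IsNormalPattern K P) (hS : P \ K = ↑coreS) (a : Fin 6 → Fˣ) (t : F) :
    coreEquiv hK hS (modelX2 (fun k => (a k : F)) t) = x2' P K a t := by
  unfold x2'
  have h4 := coreEquiv_single_v (F := F) hK hS 1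
  have h6 := coreEquiv_single_v (F := F) hK hS 2
  have h7 := coreEquiv_single_v (F := F) hK hS 3
  have h13 := coreEquiv_single_v (F := F) hK hS 7
  have h12 := coreEquiv_single_z (F := F) hK hS 0
  simp only [nIdx, zIdx, Matrix.cons_val] at h4 h6 h7 h13 h12
  simp only [← h4, ← h6, ← h7, ← h13, ← h12, ← map_mul]
  congr 1
  ext i
  · fin_cases i <;> simp [modelX2, isoVec]
  · fin_cases i <;> simp [modelX2, coc, Matrix.vecHead, Matrix.vecTail]

theorem mk_zero_mem_isoGroup (c : Fin 6 → F) (z : Fin 6 → F) : (⟨0, z⟩ : Core F) ∈ isoGroup c :=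
  (mem_isoGroup c).2 ((mem_isoGroup c).1 (one_mem (isoGroup c)))

theorem single_eq_isoVec (c : Fin 6 → F) (j : Fin 4) (t : F) :
    (Pi.single ((![4, 5, 6, 9] : Fin 4 → Fin 10) j) t : Fin 10 → F) =
      isoVec c 0 0 (Pi.single j t) := by
  funext i
  fin_cases j <;> fin_cases i <;> simp [isoVec]

theorem exists_eq_nIdx {j : ℕ} (hj : j ∈ ({9, 10, 11, 19} : Finset ℕ)) :
    ∃ i : Fin 4, j = nIdx ((![4, 5, 6, 9] : Fin 4 → Fin 10) i) := by
  revert j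
  decide

theorem nIdx_mem (i : Fin 4) :
    nIdx ((![4, 5, 6, 9] : Fin 4 → Fin 10) i) ∈ ({9, 10, 11, 19} : Finset ℕ) := by
  revert i
  decide

theorem labelSubgroup_eq_map (hK : IsNormalPattern K P) (hS : P \ K = ↑coreS) (a : Fin 6 → Fˣ) :
    labelSubgroup P K a =
      (isoGroup fun k => (a k : F)).map (coreEquiv (F := F) hK hS).toMonoidHom := by
  apply le_antisymm
  · refine (Subgroup.closure_le _).2 ?_
    rintro g (((⟨t, rfl⟩ | ⟨t, rfl⟩) | ⟨j, hj, t, rfl⟩) | ⟨k, t, rfl⟩)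
    · exact ⟨_, ⟨t, 0, 0, rfl⟩, coreEquiv_modelX1 hK hS a t⟩
    · exact ⟨_, ⟨0, t, 0, rfl⟩, coreEquiv_modelX2 hK hS a t⟩
    · obtain ⟨i, rfl⟩ := exists_eq_nIdx hj
      exact ⟨_, ⟨0, 0, _, single_eq_isoVec _ i t⟩, coreEquiv_single_v hK hS _ t⟩
    · exact ⟨_, mk_zero_mem_isoGroup _ _, coreEquiv_single_z hK hS k t⟩
  · rintro _ ⟨g, ⟨t, s, j, hg⟩, rfl⟩
    have hz : ∀ z : Fin 6 → F, coreEquiv hK hS ⟨0, z⟩ ∈ labelSubgroup P K a := by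
      intro z
      have e : coreEquiv hK hS ⟨0, z⟩ = zetaProd P K z := ofCore_z z
      rw [e]
      refine Subgroup.list_prod_mem _ fun y hy => ?_
      obtain ⟨k, -, rfl⟩ := List.mem_map.1 hy
      exact Subgroup.subset_closure (.inr ⟨k, z k, rfl⟩)
    have hj : ∀ (i : Fin 4) (t : F), coreEquiv hK hS ⟨isoVec (fun k => (a k : F)) 0 0 (Pi.single i t), 0⟩ ∈
        labelSubgroup P K a := by
      intro i t
      rw [← single_eq_isoVec, coreEquiv_single_v]
      exact Subgroup.subset_closure (.inl (.inr ⟨_, nIdx_mem i, t, rfl⟩))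
    have h1 : coreEquiv hK hS (modelX1 (fun k => (a k : F)) t) ∈ labelSubgroup P K a := by
      rw [coreEquiv_modelX1]
      exact Subgroup.subset_closure (.inl (.inl (.inl ⟨t, rfl⟩)))
    have h2 : coreEquiv hK hS (modelX2 (fun k => (a k : F)) s) ∈ labelSubgroup P K a := by
      rw [coreEquiv_modelX2]
      exact Subgroup.subset_closure (.inl (.inl (.inr ⟨s, rfl⟩)))
    -- This product of generators has the same noncentral coordinates as `g`, so the two differ by a
    -- central element, which is in the subgroup by `hz`.
    have h3 := mul_mem (mul_mem (mul_mem (mul_mem (mul_mem h1 h2) (hj 0 (j 0))) (hj 1 (j 1)))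
      (hj 2 (j 2))) (hj 3 (j 3))
    simp only [← map_mul] at h3
    refine (Subgroup.mul_mem_cancel_left _ (inv_mem h3)).1 ?_
    change _ * coreEquiv hK hS g ∈ _
    rw [← map_inv, ← map_mul]
    have hz' : ∀ q : Core F, q.v = 0 → coreEquiv hK hS q ∈ labelSubgroup P K a := by
      rintro ⟨w, z⟩ (rfl : w = 0)
      exact hz z
    apply hz'
    simp only [Core.mul_v, Core.inv_v, modelX1, modelX2, isoVec_add, hg]
    rw [neg_add_eq_zero]
    congr 1
    · simp
    · simp
    · funext i
      fin_cases i <;> simp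

theorem coreEquiv_mem_labelSubgroup (hK : IsNormalPattern K P) (hS : P \ K = ↑coreS)
    (a : Fin 6 → Fˣ) {g : Core F} :
    coreEquiv hK hS g ∈ labelSubgroup P K a ↔ g ∈ isoGroup fun k => (a k : F) := by
  rw [labelSubgroup_eq_map hK hS]
  constructor
  · rintro ⟨h, hh, e⟩
    rwa [← (coreEquiv hK hS).injective e]
  · exact fun h => ⟨g, h, rfl⟩

variable (p : ℕ) [Fact p.Prime] [Algebra (ZMod p) F]

/-- The linear character with label `(a, b)` of the label subgroup. -/
noncomputable def labelChar (hK : IsNormalPattern K P) (hS : P \ K = ↑coreS) (h3 : (3 : F) = 0)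
    (a : Fin 6 → Fˣ) (b : F × F) : labelSubgroup P K a →* ℂˣ :=
  MonoidHom.mk' (fun h => Units.mk0 (labelFun (fun k => (a k : F)) p b ((coreEquiv hK hS).symm h.1))
      (labelFun_ne_zero p b _)) fun g h => by
    ext
    have hg := g.2
    have hh := h.2
    rw [← (coreEquiv hK hS).apply_symm_apply g.1, coreEquiv_mem_labelSubgroup] at hg
    rw [← (coreEquiv hK hS).apply_symm_apply h.1, coreEquiv_mem_labelSubgroup] at hh
    simp [labelFun_mul p h3 b hg hh]

theorem labelChar_apply (hK : IsNormalPattern K P) (hS : P \ K = ↑coreS) (h3 : (3 : F) = 0)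
    (a : Fin 6 → Fˣ) (b : F × F) {g : Core F} (h : coreEquiv hK hS g ∈ labelSubgroup P K a) :
    (labelChar p hK hS h3 a b ⟨_, h⟩ : ℂ) = labelFun (fun k => (a k : F)) p b g := by
  simp [labelChar]

theorem isLabelChar_labelChar (hK : IsNormalPattern K P) (hS : P \ K = ↑coreS) (h3 : (3 : F) = 0)
    (a : Fin 6 → Fˣ) (b : F × F) : IsLabelChar p a b (labelChar p hK hS h3 a b) := by
  have hc : ∀ k, (fun k => (a k : F)) k ≠ 0 := fun k => (a k).ne_zero
  rintro ⟨h, hh⟩ t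
  have key : ∀ g : Core F, h = coreEquiv hK hS g →
      (labelChar p hK hS h3 a b ⟨h, hh⟩ : ℂ) = labelFun (fun k => (a k : F)) p b g := by
    rintro g rfl
    exact labelChar_apply p hK hS h3 a b hh
  -- With `1/2 = -1`, the factor in `X₂₂` cancels the quadratic term of `labelFun`, leaving `φ (b₁
  -- t)`.
  have h2 : (2 : F)⁻¹ = -1 := by
    have : (2 : F) = -1 := by linear_combination h3
    rw [this]
    norm_num
  refine ⟨fun e => ?_, fun e => ?_, fun j hj e => ?_, fun k e => ?_⟩
  · rw [key _ (e.trans (coreEquiv_modelX1 hK hS a t).symm), labelFun, modelX1, tCoord_isoVec hc,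
      sCoord_isoVec hc, lin_single]
    congr 1
    simp [lin, coc, isoVec, Fin.sum_univ_succ, div_eq_mul_inv, h2]
    ring
  · rw [key _ (e.trans (coreEquiv_modelX2 hK hS a t).symm), labelFun, modelX2, tCoord_isoVec hc,
      sCoord_isoVec hc, lin_single]
    congr 1
    simp [lin, coc, isoVec, Fin.sum_univ_succ]
    linear_combination (a 0 * a 1 * a 2 * a 4 * a 5 * t ^ 2 : F) * h3
  · obtain ⟨i, rfl⟩ := exists_eq_nIdx hj
    rw [key _ (e.trans (coreEquiv_single_v hK hS _ t).symm), labelFun,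
      single_eq_isoVec (fun k => (a k : F)), tCoord_isoVec hc, sCoord_isoVec hc]
    simp [lin, coc, isoVec, Fin.sum_univ_succ]
  · rw [key _ (e.trans (coreEquiv_single_z hK hS k t).symm), labelFun_z, lin_single]

/-- Conjugation changes only central coordinates, and the subgroup contains the whole centre `X_Z`.
-/
theorem labelSubgroup_normal (hK : IsNormalPattern K P) (hS : P \ K = ↑coreS) (a : Fin 6 → Fˣ) :
    (labelSubgroup P K a).Normal := by
  refine ⟨fun n hn g => ?_⟩
  obtain ⟨n, rfl⟩ := (coreEquiv (F := F) hK hS).surjective n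
  obtain ⟨g, rfl⟩ := (coreEquiv (F := F) hK hS).surjective g
  rw [← map_inv, ← map_mul, ← map_mul, coreEquiv_mem_labelSubgroup, Core.conj_eq]
  exact mul_mem (mk_zero_mem_isoGroup _ _) ((coreEquiv_mem_labelSubgroup hK hS a).1 hn)

theorem index_labelSubgroup [Fintype F] (hK : IsNormalPattern K P) (hS : P \ K = ↑coreS)
    (a : Fin 6 → Fˣ) : (labelSubgroup P K a).index = Fintype.card F ^ 4 := by
  have h := (labelSubgroup P K a).card_mul_index
  have h1 : Nat.card (labelSubgroup P K a) = Fintype.card F ^ 12 := by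
    rw [labelSubgroup_eq_map hK hS, ← card_isoGroup (c := fun k => (a k : F)) fun k => (a k).ne_zero]
    exact (Nat.card_congr ((coreEquiv (F := F) hK hS).subgroupMap _).toEquiv).symm
  rw [h1, ← Nat.card_congr (coreEquiv (F := F) hK hS).toEquiv, Core.card_eq,
    show 16 = 12 + 4 from rfl, pow_add] at h
  exact Nat.eq_of_mul_eq_mul_left (pow_pos Fintype.card_pos 12) h

-- Conjugation by `y` multiplies the linear character at `g` by `φ (altForm c g.v y.v)`. This is
-- trivial in `y` exactly when `g` lies in the radical group; otherwise the sum over `y` cancels.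
open Classical in
theorem indChar_labelChar [Fintype F] (hK : IsNormalPattern K P) (hS : P \ K = ↑coreS)
    (h3 : (3 : F) = 0) (a : Fin 6 → Fˣ) (b : F × F) (g : Core F) :
    indChar (labelSubgroup P K a) (labelChar p hK hS h3 a b) (coreEquiv hK hS g) =
      if g ∈ radGroup (fun k => (a k : F)) then
        (Fintype.card F ^ 4 : ℕ) * labelFun (fun k => (a k : F)) p b g else 0 := by
  have hc : ∀ k, (fun k => (a k : F)) k ≠ 0 := fun k => (a k).ne_zero
  have := labelSubgroup_normal (F := F) hK hS a
  have : Finite (QuatternGroup F P K) := .of_equiv _ (coreEquiv (F := F) hK hS).toEquiv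
  by_cases hg : coreEquiv hK hS g ∈ labelSubgroup P K a
  · let κ : QuatternGroup F P K →* ℂ :=
      { toFun := fun y => phi p (altForm (fun k => (a k : F)) g.v ((coreEquiv hK hS).symm y).v)
        map_one' := by simp [altForm]
        map_mul' := fun y y' => by simp [altForm_add_right, phi_add] }
    have hκ : κ = 1 ↔ g ∈ radGroup (fun k => (a k : F)) := by
      constructor
      · intro h w
        refine eq_zero_of_phi_mul p fun t => ?_
        rw [← altForm_smul_right]
        have := DFunLike.congr_fun h (coreEquiv hK hS ⟨t • w, 0⟩)
        simpa [κ] using this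
      · intro h
        ext y
        simp [κ, mem_radGroup.1 h]
    have := indChar_of_mem (labelSubgroup P K a) (labelChar p hK hS h3 a b) hg κ fun y => by
      obtain ⟨y, rfl⟩ := (coreEquiv (F := F) hK hS).surjective y
      have e : (coreEquiv hK hS y)⁻¹ * coreEquiv hK hS g * coreEquiv hK hS y =
          coreEquiv hK hS (⟨0, coc g.v y.v - coc y.v g.v⟩ * g) := by
        rw [← map_inv, ← map_mul, ← map_mul]
        congr 1
        ext1
        · simp
        · simp only [Core.mul_z, Core.mul_v, Core.inv_z, Core.inv_v, coc_add_left, coc_neg_left,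
            coc_zero_left]
          abel
      have hg' := (coreEquiv_mem_labelSubgroup hK hS a).1 hg
      have hz := mk_zero_mem_isoGroup (fun k => (a k : F)) (coc g.v y.v - coc y.v g.v)
      have hm := (coreEquiv_mem_labelSubgroup hK hS a).2 (mul_mem hz hg')
      have hm' := hm
      rw [← e] at hm'
      refine ⟨hm', ?_⟩
      have e' : (⟨_, hm'⟩ : labelSubgroup P K a) = ⟨_, hm⟩ := Subtype.ext e
      rw [e', labelChar_apply, labelChar_apply, labelFun_mul p h3 b hz hg', labelFun_z, lin_sub]
      simp [κ, altForm, mul_comm]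
    rw [labelChar_apply, index_labelSubgroup hK hS] at this
    split_ifs with h
    · exact this.1 (hκ.2 h)
    · exact this.2 fun h' => h (hκ.1 h')
  · rw [indChar_of_notMem _ _ hg, if_neg]
    exact fun h => hg ((coreEquiv_mem_labelSubgroup hK hS a).2 (radGroup_le_isoGroup h3 hc h))

end LabelSubgroup


/-! ### Parametrization of the characters with central root support `Z` -/

section Parametrization

theorem character_eq_of_smul {G V : Type*} [Group G] [AddCommGroup V] [Module ℂ V]
    (ρ : Representation ℂ G V) {g : G} {m : ℂ} (h : ρ g = m • 1) :
    ρ.character g = m * ρ.character 1 := by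
  rw [Representation.character, Representation.character, h, map_smul, map_one ρ, smul_eq_mul]

variable (p : ℕ) [Fact p.Prime] {F : Type*} [Field F] [Fintype F] [Algebra (ZMod p) F]
  {P K : Set Lat} [(XIn F P K).Normal] (hK : IsNormalPattern K P) (hS : P \ K = ↑coreS)

-- The degree is forced to be `d` by the order of the radical group, so the character is determined
-- by the scalars on that group.
open Classical in
theorem character_eq_ite {c : Fin 6 → F} {n d : ℕ}
    (ρ : Representation ℂ (QuatternGroup F P K) (Fin n → ℂ)) [ρ.IsIrreducible]
    (hc : ∀ z, ρ (coreEquiv hK hS ⟨0, z⟩) = phi p (lin c z) • 1)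
    (hd : d ^ 2 * Nat.card (radGroup c) = Fintype.card F ^ 16) {μ : Core F → ℂ}
    (hμ : ∀ g ∈ radGroup c, ρ (coreEquiv hK hS g) = μ g • 1) (g : Core F) :
    ρ.character (coreEquiv hK hS g) = if g ∈ radGroup c then d * μ g else 0 := by
  have h1 := sq_finrank_mul_card_radGroup p (coreEquiv hK hS) ρ hc
  rw [← hd, Module.finrank_fin_fun] at h1
  have h2 := Nat.pow_left_injective two_ne_zero
    (Nat.eq_of_mul_eq_mul_right Nat.card_pos h1)
  split_ifs with hg
  · rw [character_eq_of_smul ρ (hμ g hg), ρ.char_one, Module.finrank_fin_fun, h2, mul_comm]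
  · exact character_eq_zero_of_notMem p (coreEquiv hK hS) ρ hc hg

/-- The root subgroup at the `k`-th central root acts by `φ (c k * t)`, which is trivial for all `t`
exactly when `c k = 0`. -/
theorem mem_irrSupp_iff {χ : QuatternGroup F P K → ℂ} : χ ∈ IrrSupp F P K ↑coreZ ↔
    ∃ (a : Fin 6 → Fˣ) (n : ℕ) (ρ : Representation ℂ (QuatternGroup F P K) (Fin n → ℂ)),
      ρ.IsIrreducible ∧
      (∀ z, ρ (coreEquiv hK hS ⟨0, z⟩) = phi p (lin (fun k => (a k : F)) z) • 1) ∧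
      χ = ρ.character := by
  have hx : ∀ (k : Fin 6) (t : F), xq P K (root (zIdx k)) t =
      coreEquiv hK hS ⟨0, Pi.single k t⟩ := fun k t => (coreEquiv_single_z hK hS k t).symm
  constructor
  · rintro ⟨⟨n, ρ, hρ, rfl⟩, hZ⟩
    obtain ⟨c, hc⟩ := exists_central_label p (coreEquiv (F := F) hK hS) ρ
    have hne : ∀ k, c k ≠ 0 := by
      intro k hk
      refine hZ (root (zIdx k)) (by simp [coreZ]) ?_
      rintro _ ⟨t, rfl⟩
      change ρ.character (xq P K (root (zIdx k)) t) = ρ.character 1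
      rw [hx, character_eq_of_smul ρ (hc _), lin_single, hk, zero_mul, phi_zero, one_mul]
    exact ⟨fun k => Units.mk0 (c k) (hne k), n, ρ, hρ, hc, rfl⟩
  · rintro ⟨a, n, ρ, hρ, hc, rfl⟩
    refine ⟨⟨n, ρ, hρ, rfl⟩, fun α hα h => ?_⟩
    obtain ⟨k, -, rfl⟩ := Finset.mem_image.1 (Finset.mem_coe.1 hα)
    have := nontrivial_of_isIrreducible ρ
    have hn : ρ.character 1 ≠ 0 := by
      rw [ρ.char_one]
      exact Nat.cast_ne_zero.2 Module.finrank_pos.ne'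
    refine (a k).ne_zero (eq_zero_of_phi_mul p fun t => ?_)
    have h1 : ρ.character (xq P K (root (zIdx k)) t) = ρ.character 1 := h ⟨t, rfl⟩
    rw [hx, character_eq_of_smul ρ (hc _), lin_single] at h1
    exact mul_right_cancel₀ hn (h1.trans (one_mul _).symm)

/-- A parametrization of the characters with central root support `Z` by a set `ι` of pairs
consisting of a central character and an extension of it to the radical. -/
theorem parametrization {ι : Type*} (a : ι → Fin 6 → Fˣ) (M : ι → Core F → ℂ) {d : ℕ}
    (hd : ∀ b : Fin 6 → Fˣ, d ^ 2 * Nat.card (radGroup fun k => (b k : F)) = Fintype.card F ^ 16)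
    (hz : ∀ i z, M i ⟨0, z⟩ = phi p (lin (fun k => (a i k : F)) z))
    (hmul : ∀ i, ∀ g ∈ radGroup (fun k => (a i k : F)), ∀ h ∈ radGroup (fun k => (a i k : F)),
      M i (g * h) = M i g * M i h)
    (hinj : ∀ i j, a i = a j → (∀ g ∈ radGroup (fun k => (a i k : F)), M i g = M j g) → i = j)
    (hsurj : ∀ (b : Fin 6 → Fˣ) (μ : Core F → ℂ),
      (∀ z, μ ⟨0, z⟩ = phi p (lin (fun k => (b k : F)) z)) →
      (∀ g ∈ radGroup (fun k => (b k : F)), ∀ h ∈ radGroup (fun k => (b k : F)),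
        μ (g * h) = μ g * μ h) →
      ∃ i, a i = b ∧ ∀ g ∈ radGroup (fun k => (b k : F)), M i g = μ g)
    (χ : ι → QuatternGroup F P K → ℂ)
    (hχ : ∀ i, ∀ g ∈ radGroup (fun k => (a i k : F)), χ i (coreEquiv hK hS g) = d * M i g)
    (hχ' : ∀ i, ∀ g ∉ radGroup (fun k => (a i k : F)), χ i (coreEquiv hK hS g) = 0) :
    Set.BijOn χ Set.univ (IrrSupp F P K ↑coreZ) ∧ (∀ i, HasCentralLabel p P K (a i) (χ i)) ∧
      ∀ ψ ∈ IrrSupp F P K ↑coreZ, ψ 1 = d := by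
  classical
  have hzr : ∀ (c : Fin 6 → F) z, (⟨0, z⟩ : Core F) ∈ radGroup c := fun c z w => by simp [altForm]
  have hd0 : (d : ℂ) ≠ 0 := by
    rintro h
    have := hd 1
    rw [Nat.cast_eq_zero.1 h, zero_pow two_ne_zero, zero_mul] at this
    exact (pow_pos Fintype.card_pos 16).ne this
  have hone : ∀ i, χ i 1 = d := by
    intro i
    have h := hχ i 1 (one_mem _)
    rw [map_one, show M i 1 = 1 from (hz i 0).trans (by simp), mul_one] at h
    exact h
  have hlabel : ∀ i, HasCentralLabel p P K (a i) (χ i) := by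
    intro i k t
    rw [← coreEquiv_single_z hK hS, hχ i _ (hzr _ _), hz, lin_single, hone]
  have hM : ∀ i, ∀ g, χ i (coreEquiv hK hS g) =
      if g ∈ radGroup (fun k => (a i k : F)) then d * M i g else 0 := by
    intro i g
    split_ifs with h
    · exact hχ i g h
    · exact hχ' i g h
  -- The scalars by which the representation acts on the radical group form a multiplicative
  -- extension of its central character, hence agree with some `M i`; the character formula then
  -- identifies `ψ` with `χ i`.
  have hsurj' : ∀ ψ ∈ IrrSupp F P K ↑coreZ, ∃ i, χ i = ψ := by
    intro ψ hψ
    obtain ⟨b, n, ρ, hρ, hc, rfl⟩ := (mem_irrSupp_iff p hK hS).1 hψ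
    obtain ⟨μ, hμ⟩ := exists_smul_of_mem_radGroup p (coreEquiv (F := F) hK hS) ρ hc
    have := nontrivial_of_isIrreducible ρ
    have hsm : ∀ c d : ℂ, (c • 1 : (Fin n → ℂ) →ₗ[ℂ] (Fin n → ℂ)) = d • 1 → c = d := fun c d h =>
      smul_left_injective ℂ (one_ne_zero (α := Module.End ℂ (Fin n → ℂ))) h
    obtain ⟨i, rfl, hi⟩ := hsurj b μ
      (fun z => hsm _ _ (by rw [← hμ _ (hzr _ z), hc]))
      (fun g hg h hh => hsm _ _ (by
        rw [← hμ _ (mul_mem hg hh), map_mul, map_mul, hμ g hg, hμ h hh, smul_mul_smul_comm, mul_one]))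
    refine ⟨i, funext fun y => ?_⟩
    obtain ⟨g, rfl⟩ := (coreEquiv (F := F) hK hS).surjective y
    rw [character_eq_ite p hK hS ρ hc (hd _) hμ, hM]
    split_ifs with hg
    · rw [hi g hg]
    · rfl
  refine ⟨⟨fun i _ => ?_, fun i _ j _ hij => ?_, fun ψ hψ => ?_⟩, hlabel, fun ψ hψ => ?_⟩
  · obtain ⟨n, ρ, hρ, hμ⟩ := exists_irreducible_of_radGroup p (coreEquiv (F := F) hK hS) (M i) (hz i)
      (hmul i)
    have hc : ∀ z, ρ (coreEquiv hK hS ⟨0, z⟩) = phi p (lin (fun k => (a i k : F)) z) • 1 := fun z => by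
      rw [hμ _ (hzr _ z), hz]
    refine (mem_irrSupp_iff p hK hS).2 ⟨a i, n, ρ, hρ, hc, funext fun y => ?_⟩
    obtain ⟨g, rfl⟩ := (coreEquiv (F := F) hK hS).surjective y
    rw [character_eq_ite p hK hS ρ hc (hd _) hμ, hM]
  · have ha : a i = a j := by
      funext k
      refine Units.ext (eq_of_phi_mul p fun t => ?_)
      have h1 := hlabel i k t
      have h2 := hlabel j k t
      rw [hij, h2, hone] at h1
      exact (mul_left_cancel₀ hd0 h1).symm
    refine hinj i j ha fun g hg => mul_left_cancel₀ hd0 ?_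
    rw [← hχ i g hg, ← hχ j g (ha ▸ hg), hij]
  · obtain ⟨i, rfl⟩ := hsurj' ψ hψ
    exact ⟨i, trivial, rfl⟩
  · obtain ⟨i, rfl⟩ := hsurj' ψ hψ
    exact hone i

/-- Two extensions of the same central character differ by a function `ν` trivial on the centre,
hence by an additive character of the plane of parameters `(t, s)`, which self-duality of `F` writes
as `φ (b₁ t) * φ (b₂ s)`. -/
theorem exists_eq_labelFun (h3 : (3 : F) = 0) {c : Fin 6 → F} (hc : ∀ k, c k ≠ 0) (μ : Core F → ℂ)
    (hz : ∀ z, μ ⟨0, z⟩ = phi p (lin c z))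
    (hmul : ∀ g ∈ radGroup c, ∀ h ∈ radGroup c, μ (g * h) = μ g * μ h) :
    ∃ b : F × F, ∀ g ∈ radGroup c, labelFun c p b g = μ g := by
  have hr : ∀ t s z, (⟨radVec c t s, z⟩ : Core F) ∈ radGroup c := fun t s z =>
    (mem_radGroup_iff_of_three_eq_zero h3 hc).2 ⟨t, s, rfl⟩
  have hle := radGroup_le_isoGroup h3 hc
  have hzr : ∀ z, (⟨0, z⟩ : Core F) ∈ radGroup c := fun z w => by simp [altForm]
  set ν : Core F → ℂ := fun g => μ g / labelFun c p 0 g with hν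
  have hνmul : ∀ g ∈ radGroup c, ∀ h ∈ radGroup c, ν (g * h) = ν g * ν h := by
    intro g hg h hh
    simp only [hν, hmul g hg h hh, labelFun_mul p h3 0 (hle hg) (hle hh), mul_div_mul_comm]
  have hνz : ∀ t s z, ν ⟨radVec c t s, z⟩ = ν ⟨radVec c t s, 0⟩ := by
    intro t s z
    have e : (⟨radVec c t s, z⟩ : Core F) = ⟨radVec c t s, 0⟩ * ⟨0, z⟩ := by ext1 <;> simp
    have h1 : ν ⟨0, z⟩ = 1 := by
      simp only [hν, hz, labelFun_z]
      exact div_self (phi_ne_zero p _)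
    rw [e, hνmul _ (hr t s 0) _ (hzr z), h1, mul_one]
  have hadd : ∀ t s t' s', ν ⟨radVec c (t + t') (s + s'), 0⟩ =
      ν ⟨radVec c t s, 0⟩ * ν ⟨radVec c t' s', 0⟩ := by
    intro t s t' s'
    rw [← hνmul _ (hr t s 0) _ (hr t' s' 0), ← hνz _ _ (coc (radVec c t s) (radVec c t' s'))]
    congr 1
    ext1 <;> simp [radVec_add]
  have h0 : ν ⟨radVec c 0 0, 0⟩ = 1 := by
    have e : radVec c 0 0 = 0 := by
      have := radVec_add (c := c) 0 0 0 0
      rw [add_zero] at this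
      exact left_eq_add.1 this
    rw [e]
    simp only [hν, hz, labelFun_z]
    exact div_self (phi_ne_zero p _)
  obtain ⟨b₁, hb₁⟩ := exists_eq_phi_mul p (fun t => ν ⟨radVec c t 0, 0⟩) h0 fun s t => by
    rw [← hadd, add_zero]
  obtain ⟨b₂, hb₂⟩ := exists_eq_phi_mul p (fun s => ν ⟨radVec c 0 s, 0⟩) h0 fun s t => by
    rw [← hadd, add_zero]
  refine ⟨(b₁, b₂), ?_⟩
  rintro ⟨w, z⟩ hg
  obtain ⟨t, s, (rfl : w = _)⟩ := (mem_radGroup_iff_of_three_eq_zero h3 hc).1 hg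
  have h1 : ν ⟨radVec c t s, z⟩ = phi p (b₁ * t) * phi p (b₂ * s) := by
    rw [hνz, ← hb₁, ← hb₂, ← hadd, add_zero, zero_add]
  rw [radVec_eq_isoVec h3, labelFun_isoVec p hc, ← radVec_eq_isoVec h3, ← h1]
  exact div_mul_cancel₀ _ (labelFun_ne_zero p 0 _)

theorem labelFun_injective (h3 : (3 : F) = 0) {c : Fin 6 → F} (hc : ∀ k, c k ≠ 0) {b b' : F × F}
    (h : ∀ g ∈ radGroup c, labelFun c p b g = labelFun c p b' g) : b = b' := by
  have key : ∀ t s, phi p (b.1 * t) * phi p (b.2 * s) = phi p (b'.1 * t) * phi p (b'.2 * s) := by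
    intro t s
    have h1 := h ⟨radVec c t s, 0⟩ ((mem_radGroup_iff_of_three_eq_zero h3 hc).2 ⟨t, s, rfl⟩)
    rw [radVec_eq_isoVec h3, labelFun_isoVec p hc, labelFun_isoVec p hc b'] at h1
    exact mul_right_cancel₀ (labelFun_ne_zero p 0 _) h1
  refine Prod.ext (eq_of_phi_mul p fun t => ?_) (eq_of_phi_mul p fun s => ?_)
  · simpa using key t 0
  · simpa using key 0 s

end Parametrization

end UE6

/-! ### The two cases of the theorem -/

theorem proposition5p1 (p : ℕ) [Fact p.Prime] (F : Type*) [Field F] [Fintype F]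
    [Algebra (ZMod p) F] (P K : Set UE6.Lat) (hK : UE6.IsNormalPattern K P)
    (hS : P \ K = ↑UE6.coreS) :
    ∃ _ : (UE6.XIn F P K).Normal,
      (p ≠ 3 →
        (UE6.IrrSupp F P K ↑UE6.coreZ).ncard = (Fintype.card F - 1) ^ 6 ∧
        (∀ χ ∈ UE6.IrrSupp F P K ↑UE6.coreZ, χ 1 = (Fintype.card F : ℂ) ^ 5) ∧
        ∃ χ : (Fin 6 → Fˣ) → UE6.QuatternGroup F P K → ℂ,
          Set.BijOn χ Set.univ (UE6.IrrSupp F P K ↑UE6.coreZ) ∧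
          ∀ a, UE6.HasCentralLabel p P K a (χ a)) ∧
      (p = 3 →
        (UE6.IrrSupp F P K ↑UE6.coreZ).ncard =
          Fintype.card F ^ 2 * (Fintype.card F - 1) ^ 6 ∧
        (∀ χ ∈ UE6.IrrSupp F P K ↑UE6.coreZ, χ 1 = (Fintype.card F : ℂ) ^ 4) ∧
        ∃ χ : (Fin 6 → Fˣ) × (F × F) → UE6.QuatternGroup F P K → ℂ,
          Set.BijOn χ Set.univ (UE6.IrrSupp F P K ↑UE6.coreZ) ∧
          ∀ a b, UE6.HasCentralLabel p P K a (χ (a, b)) ∧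
            ∃ ψ : UE6.labelSubgroup P K a →* ℂˣ,
              UE6.IsLabelChar p a b ψ ∧ χ (a, b) = UE6.indChar (UE6.labelSubgroup P K a) ψ) := by
  classical
  have hN := UE6.XIn_normal (F := F) hK
  have hchar : CharP F p := charP_of_injective_algebraMap (algebraMap (ZMod p) F).injective p
  have hunits : Nat.card (Fin 6 → Fˣ) = (Fintype.card F - 1) ^ 6 := by
    simp [Fintype.card_units]
  have hne : ∀ (a : Fin 6 → Fˣ) k, (fun k => (a k : F)) k ≠ 0 := fun a k => (a k).ne_zero
  refine ⟨hN, fun hp => ?_, fun hp => ?_⟩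
  · have h3 : (3 : F) ≠ 0 := by
      intro h
      have h' : ((3 : ℕ) : F) = 0 := by exact_mod_cast h
      rw [CharP.cast_eq_zero_iff F p] at h'
      exact hp ((Nat.prime_dvd_prime_iff_eq Fact.out Nat.prime_three).1 h')
    have hmem : ∀ (a : Fin 6 → Fˣ) (g : UE6.Core F),
        g ∈ UE6.radGroup (fun k => (a k : F)) ↔ g.v = 0 := fun a g =>
      UE6.mem_radGroup_iff_of_three_ne_zero h3 (hne a)
    obtain ⟨h1, h2, h4⟩ := UE6.parametrization p hK hS (fun a => a)
      (fun a g => UE6.phi p (UE6.lin (fun k => (a k : F)) g.z)) (d := Fintype.card F ^ 5)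
      (fun a => by
        rw [UE6.card_radGroup_of_three_ne_zero h3 (hne a)]
        ring)
      (fun a z => rfl)
      (fun a g hg h hh => by
        rw [hmem] at hg hh
        rw [← UE6.phi_add, ← UE6.lin_add, UE6.Core.mul_z, hg, UE6.coc_zero_left, add_zero])
      (fun a a' h _ => h)
      (fun a μ hz _ => ⟨a, rfl, fun g hg => by
        obtain ⟨v, z⟩ := g
        obtain rfl : v = 0 := (hmem a _).1 hg
        exact (hz z).symm⟩)
      -- For `p ≠ 3` the radical group is the centre `X_Z`, so the character is `q ^ 5` times the
      -- central character there and `0` elsewhere.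
      (fun a y => if ((UE6.coreEquiv hK hS).symm y).v = 0 then (Fintype.card F ^ 5 : ℕ) *
        UE6.phi p (UE6.lin (fun k => (a k : F)) ((UE6.coreEquiv hK hS).symm y).z) else 0)
      (fun a g hg => by
        rw [hmem] at hg
        simp [hg])
      (fun a g hg => by
        rw [hmem] at hg
        simp [hg])
    refine ⟨?_, fun χ hχ => by simpa using h4 χ hχ, _, h1, h2⟩
    rw [← h1.image_eq, h1.injOn.ncard_image, Set.ncard_univ, hunits]
  · subst hp
    have h3 : (3 : F) = 0 := by exact_mod_cast CharP.cast_eq_zero F 3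
    obtain ⟨h1, h2, h4⟩ := UE6.parametrization 3 hK hS Prod.fst
      (fun i : (Fin 6 → Fˣ) × (F × F) => UE6.labelFun (fun k => (i.1 k : F)) 3 i.2)
      (d := Fintype.card F ^ 4)
      (fun a => by
        rw [UE6.card_radGroup_of_three_eq_zero h3 (hne a)]
        ring)
      (fun i z => UE6.labelFun_z 3 _ z)
      (fun i g hg h hh => UE6.labelFun_mul 3 h3 _ (UE6.radGroup_le_isoGroup h3 (hne _) hg)
        (UE6.radGroup_le_isoGroup h3 (hne _) hh))
      (by
        rintro ⟨a, b⟩ ⟨a', b'⟩ (rfl : a = a') h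
        obtain rfl : b = b' := UE6.labelFun_injective 3 h3 (hne a) h
        rfl)
      (fun a μ hz hmul => by
        obtain ⟨b, hb⟩ := UE6.exists_eq_labelFun 3 h3 (hne a) μ hz hmul
        exact ⟨(a, b), rfl, hb⟩)
      -- The induced characters serve as the parametrized family; their irreducibility follows from
      -- having the same values as the irreducible characters over the radical group.
      (fun i => UE6.indChar (UE6.labelSubgroup P K i.1) (UE6.labelChar 3 hK hS h3 i.1 i.2))
      (fun i g hg => by rw [UE6.indChar_labelChar, if_pos hg])
      (fun i g hg => by rw [UE6.indChar_labelChar, if_neg hg])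
    refine ⟨?_, fun χ hχ => by simpa using h4 χ hχ, _, h1, fun a b => ⟨h2 (a, b), _,
      UE6.isLabelChar_labelChar 3 hK hS h3 a b, rfl⟩⟩
    rw [← h1.image_eq, h1.injOn.ncard_image, Set.ncard_univ, Nat.card_prod, hunits,
      Nat.card_prod, Nat.card_eq_fintype_card]
    ring
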